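/- **Parameters.** Fix $\log q,\log d\in\mathbb C$ such that $q=e^{\log q}$, $d=e^{\log d}$ are generic: for rational $a,b$, $e^{a\log q+b\log d}=1$ only if $a=b=0$. Put $q_1=q^{-1}d$, $q_2=q^2$, $q_3=q^{-1}d^{-1}$; complex powers $q_1^s,q_2^s,q_3^s,q^s$ are formed with the chosen logarithms. Let $\mu,\nu\in\mathbb C$ be such that none of $q_2^{\mu},q_2^{\nu},q_2^{\mu+\nu}$ lies in $q_1^{\mathbb Z}q_2^{\mathbb Z}$ (in particular, $\mu,\nu,\mu+\nu$ are not integers). **Algebra.** Let $g_{i,i}(z,w)=z-q_2w$ and $g_{i,j}(z,w)=(z-q_1w)(z-q_3w)$ for $i\ne j$ in $\mathbb Z/2\mathbb Z$. Let $\mathcal E$ be the unital associative $\mathbb C$-algebra generated by a central invertible element ${\sf t}$ and the coefficients of $E_i(z)=\sum_{k\in\mathbb Z}E_{i,k}z^{-k}$, $F_i(z)=\sum_{k\in\mathbb Z}F_{i,k}z^{-k}$, $K_i^\pm(z)=K_i^{\pm1}\exp\bigl(\pm(q-q^{-1})\sum_{r>0}H_{i,\pm r}z^{\mp r}\bigr)$,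 $i\in\mathbb Z/2\mathbb Z$, with relations: all coefficients of the $K_i^\pm(z)$ commute; $$(-1)^{i+j}g_{i,j}(z,w)K_i^\pm(z)E_j(w)+g_{j,i}(w,z)E_j(w)K_i^\pm(z)=0,$$ $$(-1)^{i+j}g_{j,i}(w,z)K_i^\pm(z)F_j(w)+g_{i,j}(z,w)F_j(w)K_i^\pm(z)=0,$$ $$[E_i(z),F_j(w)]=\tfrac{\delta_{i,j}}{q-q^{-1}}\,\delta(z/w)\,(K_i^+(w)-K_i^-(z)),\qquad \delta(z)=\sum_{k\in\mathbb Z}z^k,$$ $$(-1)^{i+j}g_{i,j}(z,w)E_i(z)E_j(w)+g_{j,i}(w,z)E_j(w)E_i(z)=0,\qquad (-1)^{i+j}g_{j,i}(w,z)F_i(z)F_j(w)+g_{i,j}(z,w)F_j(w)F_i(z)=0,$$ $$\operatorname{Sym}_{z_1,z_2,z_3}[X_i(z_1),[X_i(z_2),[X_i(z_3),X_{i+1}(w)]_{q^2}]]_{q^{-2}}=0\quad (X=E,F),$$ where $[A,B]_p=AB-pBA$ and $[A,B]=[A,B]_1$. An $\mathcal E$-module has level $\kappa$ if $K_0K_1$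 acts as the scalar $\kappa$. A rational function $f$ is balanced if it is regular at $0,\infty$ and $f(0)f(\infty)=1$. A vector $v$ has $\ell$-weight $\phi=(\phi^0,\phi^1)$ (balanced rational functions) if $K_i^\pm(z)v=\phi^i(z)v$, with $\phi^i$ expanded at $z=\infty$ for $+$ and at $z=0$ for $-$. A module is tame if it has a basis of $\ell$-weight vectors with distinct $\ell$-weights. **Boxes.** A box has a color and coordinates $(x,y,z)$, and position $p=q_1^{-x}q_2^{-y}q_3^{-z}$. The boxes are, for $i,k\in\mathbb Z_{\ge0}$ and $n\in\mathbb Z$: (I) $(i,k,1)$ of color $i+1$ mod $2$; (II) $(i+1,k+\mu,0)$ of color $i+1$ mod $2$; (III) $(0,\mu+\nu+n,0)$ of color $0$. Boxes (III) with $n<0$ are negative, all others are positive. Each family is ordered lexicographically with respect to $y>z>x$, and (I) $<$ (II) $<$ (III). **States.** A state $\lambda=\lambda^+\sqcup\lambda^-$ (positive and negative boxes) is given by a pair of partitions positioned vertically, that is, by the set of boxes (I) with $(i,k)$ in a Young diagram (a finite subset of $\mathbb Z_{\ge0}^2$ closed under decreasing either coordinate) and the set of boxes (II) with $(i,k)$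 in a second Young diagram, and by an integer $k$: $\lambda$ contains the boxes (III) with $0\le n<k$ if $k\ge0$, and those with $k\le n<0$ if $k<0$. Let $S$ be the set of states. Adding a box to $\lambda$ means adjoining a positive box $\Box\notin\lambda$ or deleting a negative box $\Box\in\lambda$; removing a box is the reverse operation. The results are written $\lambda\sqcup\Box$, $\lambda\setminus\Box$. Let $CC_i(\lambda)$ (resp. $CV_i(\lambda)$) be the set of boxes of color $i$ whose addition (resp. removal) gives a state in $S$. **$\ell$-weights.** Let $A_{j,a}(z)$, $j\in\{0,1\}$, be the pair of rational functions with $j$-th component $\frac{q_2z-a}{z-q_2a}$ and other component $\frac{(q_1z-a)(q_3z-a)}{(z-q_1a)(z-q_3a)}$. Let $\Psi=(\Psi^0,\Psi^1)$ be $$\Psi^0=q_3q^{-\mu-2\nu}\frac{(z-q_3^{-2})(z-q_2^{-\mu+1})}{(z-q_2^{-\mu-\nu})(z-q_2^{-\mu-\nu+1})},\qquad \Psi^1=q^{\mu+2\nu}\frac{(z-q_3^{-1}q_2^{-\mu-\nu})(z-q_1^{-1}q_2^{-\mu-\nu})}{(z-q_3^{-1})(z-q_1^{-1}q_2^{-\mu})}.$$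 For a box $\Box_1$ of color $c$ and position $p$ put $w_{\Box_1}=A_{c,p}^{-1}$ if $\Box_1$ is positive and $w_{\Box_1}=A_{c,p}$ if it is negative. Put $\phi_\lambda=\Psi\prod_{\Box_1\in\lambda}w_{\Box_1}$, and let $\phi_{\lambda,<\Box}$, $\phi_{\lambda,>\Box}$ be the products of $w_{\Box_1}$ over $\Box_1\in\lambda$ with $\Box_1<\Box$, resp. $\Box_1>\Box$, where the factor $\Psi$ is included in $\phi_{\lambda,<\Box}$ if $\Box$ is positive and in $\phi_{\lambda,>\Box}$ if $\Box$ is negative. On $V=\bigoplus_{\lambda\in S}\mathbb C|\lambda\rangle$ consider $$K_i^\pm(z)|\lambda\rangle=\phi_\lambda^i(z)|\lambda\rangle,\quad F_i(z)|\lambda\rangle=\sum_{\Box\in CC_i(\lambda)}a^i_{\lambda,\Box}\,\delta(z/p(\Box))\,|\lambda\sqcup\Box\rangle,\quad E_i(z)|\lambda\rangle=\sum_{\Box\in CV_i(\lambda)}b^i_{\lambda,\Box}\,\delta(z/p(\Box))\,|\lambda\setminus\Box\rangle,\tag{$*$}$$ with $$a^i_{\lambda,\Box}=\phi^i_{\lambda,>\Box}(p(\Box)),\qquad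 b^i_{\lambda,\Box}=\frac{1}{q-q^{-1}}\operatorname*{res}_{z=p(\Box)}\phi^i_{\lambda,<\Box}(z)\frac{dz}{z}\qquad\text{for positive }\Box,$$ $$a^i_{\lambda,\Box}=\frac{-1}{q-q^{-1}}\operatorname*{res}_{z=p(\Box)}\phi^i_{\lambda,>\Box}(z)\frac{dz}{z},\qquad b^i_{\lambda,\Box}=\phi^i_{\lambda,<\Box}(p(\Box))\qquad\text{for negative }\Box,$$ and let ${\sf t}$ act by a fixed non-zero scalar $\tau$. **Proposition.** All expressions in $(*)$ are well defined: the sums are finite, the $\phi^i_\lambda$ are balanced, and $\phi^i_{\lambda,>\Box}$ (for positive $\Box$), resp. $\phi^i_{\lambda,<\Box}$ (for negative $\Box$), is regular at $p(\Box)$ for all $\Box\in CC_i(\lambda)\sqcup CV_i(\lambda)$. For every $\tau\neq0$, the formulas $(*)$ define on $V$ an $\mathcal E$-module structure, and this module (the evaluation relaxed Verma module $G_0^{\mu,\nu}$) is irreducible, tame, and of level $q_3$. -/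

import Mathlib

namespace ToroidalGl2

/-! ### Parameters

Logarithms `lq` of `q` and `ld` of `d` are fixed, so that complex powers of `q₁ = q⁻¹d`, `q₂ = q²`,
`q₃ = q⁻¹d⁻¹` make sense. -/

noncomputable section Parameters

/-- `q`. -/
def q (lq : ℂ) : ℂ := Complex.exp lq

/-- `d`. -/
def d (ld : ℂ) : ℂ := Complex.exp ld

/-- `q₁ = q⁻¹ d`. -/
def q1 (lq ld : ℂ) : ℂ := (q lq)⁻¹ * d ld

/-- `q₂ = q²`. -/
def q2 (lq : ℂ) : ℂ := q lq ^ 2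

/-- `q₃ = q⁻¹ d⁻¹`. -/
def q3 (lq ld : ℂ) : ℂ := (q lq)⁻¹ * (d ld)⁻¹

/-- The complex power `q ^ s`. -/
def qPow (lq s : ℂ) : ℂ := Complex.exp (s * lq)

/-- The complex power `q₁ ^ s`. -/
def q1Pow (lq ld s : ℂ) : ℂ := Complex.exp (s * (ld - lq))

/-- The complex power `q₂ ^ s`. -/
def q2Pow (lq s : ℂ) : ℂ := Complex.exp (s * (2 * lq))

/-- The complex power `q₃ ^ s`. -/
def q3Pow (lq ld s : ℂ) : ℂ := Complex.exp (s * (-lq - ld))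

/-- `q`, `d` are generic: `q ^ a * d ^ b = 1` with rational `a`, `b` only for `a = b = 0`. -/
def GenericParameters (lq ld : ℂ) : Prop :=
  ∀ a b : ℚ, Complex.exp ((a : ℂ) * lq + (b : ℂ) * ld) = 1 → a = 0 ∧ b = 0

/-- `s` is generic: `q₂ ^ s` is not of the form `q₁ ^ m * q₂ ^ n` with integers `m`, `n`. -/
def GenericExponent (lq ld s : ℂ) : Prop :=
  ∀ m n : ℤ, q2Pow lq s ≠ q1 lq ld ^ m * q2 lq ^ n

end Parameters

/-! ### The quantum toroidal algebra of type `gl₂` (parallel realization) -/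

noncomputable section Algebra

/-- The generators: coefficients of `E_i(z) = ∑ E_{i,k} z^{-k}`, `F_i(z) = ∑ F_{i,k} z^{-k}`,
`K_i^+(z) = ∑_{r ≥ 0} K^+_{i,r} z^{-r}`, `K_i^-(z) = ∑_{r ≥ 0} K^-_{i,r} z^r`, and `t`, `t⁻¹`.
Here `K^±_{i,0} = K_i^{±1}`, and the elements `H_{i,±r}` are the coefficients of
`± log (K_i^{∓1} K_i^±(z)) / (q - q⁻¹)`, so they carry the same information. -/
inductive Gen : Type
  | E (i : ZMod 2) (k : ℤ)
  | F (i : ZMod 2) (k : ℤ)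
  | Kplus (i : ZMod 2) (r : ℕ)
  | Kminus (i : ZMod 2) (r : ℕ)
  | t
  | tInv

/-- The free algebra on the generators. -/
abbrev FreeGen : Type := FreeAlgebra ℂ Gen

namespace FreeGen

def E (i : ZMod 2) (k : ℤ) : FreeGen := FreeAlgebra.ι ℂ (Gen.E i k)

def F (i : ZMod 2) (k : ℤ) : FreeGen := FreeAlgebra.ι ℂ (Gen.F i k)

/-- The coefficient of `z ^ (-k)` in `K_i^+(z)`, `k ∈ ℤ`. -/
def Kplus (i : ZMod 2) (k : ℤ) : FreeGen :=
  if 0 ≤ k then FreeAlgebra.ι ℂ (Gen.Kplus i k.toNat) else 0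

/-- The coefficient of `z ^ (-k)` in `K_i^-(z)`, `k ∈ ℤ`. -/
def Kminus (i : ZMod 2) (k : ℤ) : FreeGen :=
  if k ≤ 0 then FreeAlgebra.ι ℂ (Gen.Kminus i (-k).toNat) else 0

def t : FreeGen := FreeAlgebra.ι ℂ Gen.t

def tInv : FreeGen := FreeAlgebra.ι ℂ Gen.tInv

end FreeGen

/-- For `M(z,w) = ∑ M k l z^{-k} w^{-l}`, the coefficient of `z^{-k} w^{-l}` in
`g_{i,j}(z,w) M(z,w)`, where `g_{i,j}(z,w) = z - q₂ w` for `i = j` and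
`g_{i,j}(z,w) = (z - q₁ w)(z - q₃ w) = z² - (q₁ + q₃) z w + q₁ q₃ w²` for `i ≠ j`. -/
def gMul (lq ld : ℂ) (i j : ZMod 2) (M : ℤ → ℤ → FreeGen) (k l : ℤ) : FreeGen :=
  if i = j then M (k + 1) l - q2 lq • M k (l + 1)
  else M (k + 2) l - (q1 lq ld + q3 lq ld) • M (k + 1) (l + 1)
    + (q1 lq ld * q3 lq ld) • M k (l + 2)

/-- The sign `(-1) ^ (i + j)`. -/
def sgn (i j : ZMod 2) : ℂ := if i = j then 1 else -1

/-- The coefficient of `z^{-k} w^{-l}` in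
`(-1)^{i+j} g_{i,j}(z,w) A(z) B(w) + g_{j,i}(w,z) B(w) A(z)`. -/
def quadE (lq ld : ℂ) (i j : ZMod 2) (A B : ℤ → FreeGen) (k l : ℤ) : FreeGen :=
  sgn i j • gMul lq ld i j (fun k l => A k * B l) k l
    + gMul lq ld j i (fun l k => B l * A k) l k

/-- The coefficient of `z^{-k} w^{-l}` in
`(-1)^{i+j} g_{j,i}(w,z) A(z) B(w) + g_{i,j}(z,w) B(w) A(z)`. -/
def quadF (lq ld : ℂ) (i j : ZMod 2) (A B : ℤ → FreeGen) (k l : ℤ) : FreeGen :=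
  sgn i j • gMul lq ld j i (fun l k => A k * B l) l k
    + gMul lq ld i j (fun k l => B l * A k) k l

/-- `[A, B]_p = A B - p B A`. -/
def qComm (p : ℂ) (A B : FreeGen) : FreeGen := A * B - p • (B * A)

/-- The coefficient of `z₁^{-k₁} z₂^{-k₂} z₃^{-k₃} w^{-l}` in
`Sym_{z₁,z₂,z₃} [A(z₁), [A(z₂), [A(z₃), B(w)]_{q²}]]_{q^{-2}}`. -/
def serre (lq : ℂ) (A B : ℤ → FreeGen) (k : Fin 3 → ℤ) (l : ℤ) : FreeGen :=
  (1 / 6 : ℂ) • ∑ s : Equiv.Perm (Fin 3),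
    qComm ((q lq ^ 2)⁻¹) (A (k (s 0)))
      (qComm 1 (A (k (s 1))) (qComm (q lq ^ 2) (A (k (s 2))) (B l)))

open FreeGen in
/-- The defining relations, coefficient by coefficient. -/
inductive Rel (lq ld : ℂ) : FreeGen → FreeGen → Prop
  | K_mul_Kinv (i : ZMod 2) : Rel lq ld (Kplus i 0 * Kminus i 0) 1
  | Kinv_mul_K (i : ZMod 2) : Rel lq ld (Kminus i 0 * Kplus i 0) 1
  | t_mul_tInv : Rel lq ld (t * tInv) 1
  | tInv_mul_t : Rel lq ld (tInv * t) 1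
  | t_central (g : Gen) : Rel lq ld (t * FreeAlgebra.ι ℂ g) (FreeAlgebra.ι ℂ g * t)
  | KpKp (i j : ZMod 2) (k l : ℤ) : Rel lq ld (Kplus i k * Kplus j l) (Kplus j l * Kplus i k)
  | KmKm (i j : ZMod 2) (k l : ℤ) : Rel lq ld (Kminus i k * Kminus j l) (Kminus j l * Kminus i k)
  | KpKm (i j : ZMod 2) (k l : ℤ) : Rel lq ld (Kplus i k * Kminus j l) (Kminus j l * Kplus i k)
  | KpE (i j : ZMod 2) (k l : ℤ) : Rel lq ld (quadE lq ld i j (Kplus i) (E j) k l) 0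
  | KmE (i j : ZMod 2) (k l : ℤ) : Rel lq ld (quadE lq ld i j (Kminus i) (E j) k l) 0
  | KpF (i j : ZMod 2) (k l : ℤ) : Rel lq ld (quadF lq ld i j (Kplus i) (F j) k l) 0
  | KmF (i j : ZMod 2) (k l : ℤ) : Rel lq ld (quadF lq ld i j (Kminus i) (F j) k l) 0
  | EF (i j : ZMod 2) (k l : ℤ) :
      Rel lq ld (E i k * F j l - F j l * E i k)
        (if i = j then (1 / (q lq - (q lq)⁻¹)) • (Kplus i (k + l) - Kminus i (k + l)) else 0)
  | EE (i j : ZMod 2) (k l : ℤ) : Rel lq ld (quadE lq ld i j (E i) (E j) k l) 0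
  | FF (i j : ZMod 2) (k l : ℤ) : Rel lq ld (quadF lq ld i j (F i) (F j) k l) 0
  | serreE (i : ZMod 2) (k : Fin 3 → ℤ) (l : ℤ) :
      Rel lq ld (serre lq (E i) (E (i + 1)) k l) 0
  | serreF (i : ZMod 2) (k : Fin 3 → ℤ) (l : ℤ) :
      Rel lq ld (serre lq (F i) (F (i + 1)) k l) 0

/-- The quantum toroidal algebra `𝓔` of type `gl₂` with parameters `q = e^{lq}`, `d = e^{ld}`. -/
abbrev Toroidal (lq ld : ℂ) : Type := RingQuot (Rel lq ld)

/-- The image of a generator in `𝓔`. -/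
def Toroidal.gen (lq ld : ℂ) (g : Gen) : Toroidal lq ld :=
  RingQuot.mkAlgHom ℂ (Rel lq ld) (FreeAlgebra.ι ℂ g)

end Algebra

/-! ### Rational functions -/

noncomputable section Rational

open RatFunc

/-- The rational function `z - a`. -/
def lin (a : ℂ) : RatFunc ℂ := RatFunc.X - RatFunc.C a

/-- The value `f(a)` (meaningful only where `f` is regular). -/
def value (f : RatFunc ℂ) (a : ℂ) : ℂ := RatFunc.eval (RingHom.id ℂ) a f

/-- `f` is regular at `z = a`. -/
def RegularAt (f : RatFunc ℂ) (a : ℂ) : Prop := f.denom.eval a ≠ 0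

/-- The coefficient of `z ^ n` in the Laurent expansion of `f` at `z = 0`. -/
def coeffZero (f : RatFunc ℂ) (n : ℤ) : ℂ := (f : LaurentSeries ℂ).coeff n

/-- The coefficient of `z ^ (-n)` in the Laurent expansion of `f` at `z = ∞`. -/
def coeffInfty (f : RatFunc ℂ) (n : ℤ) : ℂ :=
  coeffZero (RatFunc.eval RatFunc.C (RatFunc.X)⁻¹ f) n

/-- The residue `res_{z = a} f(z) dz`: the coefficient of `u ^ (-1)` in the Laurent expansion of
`f(a + u)` at `u = 0`. -/
def residue (f : RatFunc ℂ) (a : ℂ) : ℂ := coeffZero (RatFunc.laurent a f) (-1)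

/-- `f` is balanced: regular at `0` and `∞`, with `f(0) f(∞) = 1`. -/
def Balanced (f : RatFunc ℂ) : Prop :=
  RegularAt f 0 ∧ f.intDegree ≤ 0 ∧ value f 0 * coeffInfty f 0 = 1

/-- The `i`-th component of `A_{j,a}(z)`. -/
def rootA (lq ld : ℂ) (j : ZMod 2) (a : ℂ) (i : ZMod 2) : RatFunc ℂ :=
  if i = j then
    (RatFunc.C (q2 lq) * RatFunc.X - RatFunc.C a) / (RatFunc.X - RatFunc.C (q2 lq * a))
  else
    ((RatFunc.C (q1 lq ld) * RatFunc.X - RatFunc.C a) *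
        (RatFunc.C (q3 lq ld) * RatFunc.X - RatFunc.C a)) /
      ((RatFunc.X - RatFunc.C (q1 lq ld * a)) * (RatFunc.X - RatFunc.C (q3 lq ld * a)))

end Rational

/-! ### Modules over `𝓔` -/

section Modules

universe u

/-- `v` has `ℓ`-weight `φ`, a pair of balanced rational functions: `K_i^±(z) v = φ^i(z) v`, where
`φ^i(z)` is expanded at `z = ∞` for the sign `+` and at `z = 0` for the sign `-`. -/
def IsLWeightVector (lq ld : ℂ) {M : Type u} [AddCommGroup M] [Module ℂ M]
    [Module (Toroidal lq ld) M] (φ : ZMod 2 → RatFunc ℂ) (v : M) : Prop :=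
  ∀ i : ZMod 2, Balanced (φ i) ∧ ∀ r : ℕ,
    Toroidal.gen lq ld (Gen.Kplus i r) • v = coeffInfty (φ i) r • v ∧
    Toroidal.gen lq ld (Gen.Kminus i r) • v = coeffZero (φ i) r • v

/-- `M` is tame: it has a basis of `ℓ`-weight vectors with distinct `ℓ`-weights. -/
def IsTame (lq ld : ℂ) (M : Type u) [AddCommGroup M] [Module ℂ M]
    [Module (Toroidal lq ld) M] : Prop :=
  ∃ (ι : Type u) (b : Module.Basis ι ℂ M) (φ : ι → ZMod 2 → RatFunc ℂ),
    Function.Injective φ ∧ ∀ j, IsLWeightVector lq ld (φ j) (b j)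

/-- `M` has level `κ`: the central element `K₀ K₁` acts by the scalar `κ`. -/
def HasLevel (lq ld κ : ℂ) (M : Type u) [AddCommGroup M] [Module ℂ M]
    [Module (Toroidal lq ld) M] : Prop :=
  ∀ v : M, (Toroidal.gen lq ld (Gen.Kplus 0 0) * Toroidal.gen lq ld (Gen.Kplus 1 0)) • v = κ • v

end Modules

/-! ### Combinatorial modules -/

/-- The data of a combinatorial module. The type `B` is the (totally ordered) set of all boxes. A
state is a finite set `s` of boxes; `s⁺` is the set of its positive elements and `s⁻` the set of its
negative elements. -/
structure CombinatorialData (B : Type) where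
  /-- color of a box -/
  color : B → ZMod 2
  /-- coordinates of a box -/
  x : B → ℂ
  y : B → ℂ
  z : B → ℂ
  /-- `true` for negative boxes and `false` for positive boxes -/
  neg : B → Bool
  /-- the set of states -/
  states : Set (Finset B)
  /-- the `ℓ`-weight of the reference state `∅` -/
  Psi : ZMod 2 → RatFunc ℂ

namespace CombinatorialData

noncomputable section

variable {B : Type} [LinearOrder B] (D : CombinatorialData B) (lq ld : ℂ)

/-- The position `p = q₁^{-x} q₂^{-y} q₃^{-z}` of a box. -/
def pos (b : B) : ℂ := q1Pow lq ld (-D.x b) * q2Pow lq (-D.y b) * q3Pow lq ld (-D.z b)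

/-- The state `s ⊔ b` obtained by adding the box `b`. -/
def addBox (s : Finset B) (b : B) : Finset B := if D.neg b then s.erase b else insert b s

/-- The state `s \ b` obtained by removing the box `b`. -/
def removeBox (s : Finset B) (b : B) : Finset B := if D.neg b then insert b s else s.erase b

/-- `CC_i(s)`: the concave boxes of color `i`. -/
def concave (s : Finset B) (i : ZMod 2) : Set B :=
  {b | D.color b = i ∧ (b ∈ s ↔ D.neg b = true) ∧ D.addBox s b ∈ D.states}

/-- `CV_i(s)`: the convex boxes of color `i`. -/
def convex (s : Finset B) (i : ZMod 2) : Set B :=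
  {b | D.color b = i ∧ (b ∈ s ↔ D.neg b = false) ∧ D.removeBox s b ∈ D.states}

/-- The factor of a box of a state in the `i`-th component of the `ℓ`-weight of the state:
`A^{-1}_{c,p}` for a positive box and `A_{c,p}` for a negative box. -/
def factor (b : B) (i : ZMod 2) : RatFunc ℂ :=
  if D.neg b then rootA lq ld (D.color b) (D.pos lq ld b) i
  else (rootA lq ld (D.color b) (D.pos lq ld b) i)⁻¹

/-- The `i`-th component `φ_s^i(z)` of the `ℓ`-weight of a state. -/
def phi (s : Finset B) (i : ZMod 2) : RatFunc ℂ := D.Psi i * ∏ b ∈ s, D.factor lq ld b i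

/-- `φ_{s,<b}^i(z)`. The factor `Ψ^i` is included if `b` is positive. -/
def phiLT (s : Finset B) (b : B) (i : ZMod 2) : RatFunc ℂ :=
  (if D.neg b then 1 else D.Psi i) * ∏ c ∈ s with c < b, D.factor lq ld c i

/-- `φ_{s,>b}^i(z)`. The factor `Ψ^i` is included if `b` is negative. -/
def phiGT (s : Finset B) (b : B) (i : ZMod 2) : RatFunc ℂ :=
  (if D.neg b then D.Psi i else 1) * ∏ c ∈ s with b < c, D.factor lq ld c i

/-- The coefficient `a_{s,b}^i` of `s ⊔ b` in the action of `F_i` on `s`. -/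
def coeffF (s : Finset B) (b : B) (i : ZMod 2) : ℂ :=
  if D.neg b then
    -1 / (q lq - (q lq)⁻¹) * residue (D.phiGT lq ld s b i / RatFunc.X) (D.pos lq ld b)
  else value (D.phiGT lq ld s b i) (D.pos lq ld b)

/-- The coefficient `b_{s,b}^i` of `s \ b` in the action of `E_i` on `s`. -/
def coeffE (s : Finset B) (b : B) (i : ZMod 2) : ℂ :=
  if D.neg b then value (D.phiLT lq ld s b i) (D.pos lq ld b)
  else 1 / (q lq - (q lq)⁻¹) * residue (D.phiLT lq ld s b i / RatFunc.X) (D.pos lq ld b)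

/-- The vector space `⊕_{s} ℂ |s⟩`. -/
abbrev Space (D : CombinatorialData B) : Type := D.states →₀ ℂ

/-- The basis vector `|s⟩`. -/
def ket (s : D.states) : D.Space := Finsupp.single s 1

/-- All expressions in the formulas for the action are meaningful: the sums over concave and convex
boxes are finite, the functions `φ_s^i(z)` are balanced, and every rational function is regular at
the point at which it is evaluated. -/
structure WellDefined : Prop where
  finite_concave : ∀ s ∈ D.states, ∀ i, (D.concave s i).Finite
  finite_convex : ∀ s ∈ D.states, ∀ i, (D.convex s i).Finite
  balanced : ∀ s ∈ D.states, ∀ i, Balanced (D.phi lq ld s i)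
  regular_pos : ∀ s ∈ D.states, ∀ i, ∀ b ∈ D.concave s i ∪ D.convex s i, D.neg b = false →
    RegularAt (D.phiGT lq ld s b i) (D.pos lq ld b)
  regular_neg : ∀ s ∈ D.states, ∀ i, ∀ b ∈ D.concave s i ∪ D.convex s i, D.neg b = true →
    RegularAt (D.phiLT lq ld s b i) (D.pos lq ld b)

/-- The action of `𝓔` on `⊕_s ℂ |s⟩` is given by the formulas
`K_i^±(z) |s⟩ = φ_s^i(z) |s⟩`,
`F_i(z) |s⟩ = ∑_{b ∈ CC_i(s)} a_{s,b}^i δ(z / p(b)) |s ⊔ b⟩`,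
`E_i(z) |s⟩ = ∑_{b ∈ CV_i(s)} b_{s,b}^i δ(z / p(b)) |s \ b⟩`, `t |s⟩ = τ |s⟩`.
The coefficient of `z ^ (-k)` in `δ(z / p)` is `p ^ k`. -/
structure ActsByFormulas (τ : ℂ) [Module (Toroidal lq ld) D.Space] : Prop where
  Kplus : ∀ (s : D.states) (i : ZMod 2) (r : ℕ),
    Toroidal.gen lq ld (Gen.Kplus i r) • D.ket s = coeffInfty (D.phi lq ld s i) r • D.ket s
  Kminus : ∀ (s : D.states) (i : ZMod 2) (r : ℕ),
    Toroidal.gen lq ld (Gen.Kminus i r) • D.ket s = coeffZero (D.phi lq ld s i) r • D.ket s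
  F : ∀ (s : D.states) (i : ZMod 2) (k : ℤ),
    Toroidal.gen lq ld (Gen.F i k) • D.ket s =
      ∑ᶠ b : D.concave (s : Finset B) i,
        (D.coeffF lq ld s b i * D.pos lq ld b ^ k) • D.ket ⟨D.addBox s b, b.2.2.2⟩
  E : ∀ (s : D.states) (i : ZMod 2) (k : ℤ),
    Toroidal.gen lq ld (Gen.E i k) • D.ket s =
      ∑ᶠ b : D.convex (s : Finset B) i,
        (D.coeffE lq ld s b i * D.pos lq ld b ^ k) • D.ket ⟨D.removeBox s b, b.2.2.2⟩
  t : ∀ s : D.states, Toroidal.gen lq ld Gen.t • D.ket s = τ • D.ket s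

end

end CombinatorialData

/-! ### The data of the evaluation relaxed Verma module -/

/-- The boxes: `low i k` has coordinates `(i, k, 1)`, `pedestal i k` has coordinates
`(i + 1, k + μ, 0)`, and `tower k` has coordinates `(0, μ + ν + k, 0)`. -/
inductive RBox : Type
  | low (i k : ℕ)
  | pedestal (i k : ℕ)
  | tower (k : ℤ)

namespace RBox

/-- The sorting key `(family, height, x)`. -/
def key : RBox → ℕ ×ₗ ℤ ×ₗ ℕ
  | low i k => toLex (0, toLex ((k : ℤ), i))
  | pedestal i k => toLex (1, toLex ((k : ℤ), i))
  | tower k => toLex (2, toLex (k, 0))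

theorem key_injective : Function.Injective key := by
  intro a b h
  cases a <;> cases b <;> simp [key, Prod.ext_iff] at h ⊢ <;> omega

/-- Each family is ordered lexicographically with respect to `y > z > x`, and
`low < pedestal < tower`. -/
noncomputable instance : LinearOrder RBox := LinearOrder.lift' key key_injective

end RBox

noncomputable section Relaxed

/-- The finite set of boxes of the state given by two partitions and an integer `n`. A partition is
positioned vertically: the cell `(i, k)` of its diagram is the box with horizontal coordinate `i` and
height `k` in its family. For `n ≥ 0` there are the positive boxes `tower 0, …, tower (n - 1)`, and
for `n < 0` the negative boxes `tower (-1), …, tower n`. -/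
def relaxedState (l m : YoungDiagram) (n : ℤ) : Finset RBox :=
  l.cells.image (fun c => RBox.low c.1 c.2) ∪ m.cells.image (fun c => RBox.pedestal c.1 c.2) ∪
    (Finset.Ico 0 n ∪ Finset.Ico n 0).image RBox.tower

/-- The pair `Ψ(G_0^{μ,ν})`. -/
def relaxedPsi (lq ld μ ν : ℂ) (i : ZMod 2) : RatFunc ℂ :=
  if i = 0 then
    RatFunc.C (q3 lq ld * qPow lq (-μ - 2 * ν)) *
      ((lin (q3 lq ld ^ (-2 : ℤ)) * lin (q2Pow lq (-μ + 1))) /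
        (lin (q2Pow lq (-μ - ν)) * lin (q2Pow lq (-μ - ν + 1))))
  else
    RatFunc.C (qPow lq (μ + 2 * ν)) *
      ((lin ((q3 lq ld)⁻¹ * q2Pow lq (-μ - ν)) * lin ((q1 lq ld)⁻¹ * q2Pow lq (-μ - ν))) /
        (lin ((q3 lq ld)⁻¹) * lin ((q1 lq ld)⁻¹ * q2Pow lq (-μ))))

/-- The combinatorial data of `G_0^{μ,ν}`. -/
def relaxedData (lq ld μ ν : ℂ) : CombinatorialData RBox where
  color
    | .low i _ => (i : ZMod 2) + 1
    | .pedestal i _ => (i : ZMod 2) + 1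
    | .tower _ => 0
  x
    | .low i _ => i
    | .pedestal i _ => i + 1
    | .tower _ => 0
  y
    | .low _ k => k
    | .pedestal _ k => k + μ
    | .tower k => μ + ν + k
  z
    | .low _ _ => 1
    | .pedestal _ _ => 0
    | .tower _ => 0
  neg
    | .low _ _ => false
    | .pedestal _ _ => false
    | .tower k => decide (k < 0)
  states := {s | ∃ (l m : YoungDiagram) (n : ℤ), s = relaxedState l m n}
  Psi := relaxedPsi lq ld μ ν

end Relaxed

end ToroidalGl2

/-! Since q₁q₂q₃ = 1, a position depends only on a family and two integer coordinates, and
genericity makes the positions of all points of the three lattices `Fin 3 × ℤ × ℤ` distinct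
(`posPt_injective`). A state is encoded by a set of filled lattice points: a positive box is filled
when present, a negative one when absent, and the points that are not boxes have a fixed value.
States become exactly the order ideals (`mem_states_iff`), and adding a box of either sign fills one
point. This removes the distinction between positive and negative boxes from most of the argument.

The divisor of Ψ is the six-term sum `cornerOrd` of the empty ideal, and each box contributes the
same six-term pattern. Hence the order of φ_s at a lattice point of the right colour is `cornerOrd
s` (`ordAt_phi`). For an ideal this sum is at least −1, with −1 exactly at the corners, which are
the points that can be filled or emptied. So the poles of φ_s are simple and sit at the concave and
convex boxes. The order on boxes refines the order of each lattice, so cutting φ_s at a corner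
leaves the simple pole on the side of Ψ and a unit on the other side. This gives regularity and
non-vanishing of all matrix coefficients.

For the relations, split F_i(z) and E_i(z) into one-box operators `boxOp`. Changing a box c
multiplies the coefficient of b by 1 or by a ratio of two values of the exchange function `exch`.
Consequently a product of one-box operators, in any order, equals the product of `exchN` over the
pairs of the word times a vector independent of the order (`exists_word`). Inadmissible orders are
included, because the exchange function vanishes on a covering pair taken in the wrong order. The
argument only needs that no two boxes are diagonal neighbours. Such a pair forces two boxes of each
colour (`not_diagonal`), which occurs neither in the quadratic nor in the Serre relations. These
relations therefore reduce to scalar identities, `gPoly_exch` and `serre_identity`.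

Operators E and F of different boxes commute. At a single corner their commutator is the residue of
φ_s, and the sum of these residues is the difference of the two expansions of φ_s by partial
fractions (`coeffInfty_sub_coeffZero`). The relations of K with E and F come from the rational
identity `gRat_rootA`. Only finitely many boxes act non-trivially on a given vector, so it suffices
to work with finite sets of boxes (`eventually_repOn`).

The six-term sums determine the ideal, so the ℓ-weights are distinct (`phi_injective`); this gives
tameness and puts basis vectors into every non-zero submodule. Non-vanishing coefficients and paths
to the empty state (`induction_to_empty`) give irreducibility. Boxes change the two components at
infinity by inverse factors, so the level is read off from Ψ. -/

namespace ToroidalGl2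

/-! ### Orders, values and Laurent expansions of rational functions. -/

noncomputable section RationalFunctions

open Polynomial
open scoped RatFunc

/-- The order of vanishing of a rational function at a point. -/
def ordAt (a : ℂ) (f : RatFunc ℂ) : ℤ := f.num.rootMultiplicity a - f.denom.rootMultiplicity a

theorem ordAt_div (a : ℂ) {p r : ℂ[X]} (hp : p ≠ 0) (hr : r ≠ 0) :
    ordAt a (algebraMap _ _ p / algebraMap _ _ r) = p.rootMultiplicity a - r.rootMultiplicity a := by
  have h := (RatFunc.num_mul_eq_mul_denom_iff (K := ℂ) (x := algebraMap _ _ p / algebraMap _ _ r)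
    (p := p) hr).2 rfl
  set f : RatFunc ℂ := algebraMap _ _ p / algebraMap _ _ r
  have hd : f.denom ≠ 0 := RatFunc.denom_ne_zero f
  have hn : f.num ≠ 0 := by
    intro h0
    rw [h0, zero_mul] at h
    exact mul_ne_zero hp hd h.symm
  have h1 := rootMultiplicity_mul (x := a) (mul_ne_zero hn hr)
  have h2 := rootMultiplicity_mul (x := a) (mul_ne_zero hp hd)
  rw [h, h2] at h1
  unfold ordAt
  omega

theorem ordAt_mul (a : ℂ) {f g : RatFunc ℂ} (hf : f ≠ 0) (hg : g ≠ 0) :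
    ordAt a (f * g) = ordAt a f + ordAt a g := by
  have h1 := RatFunc.num_ne_zero hf
  have h2 := RatFunc.num_ne_zero hg
  have h3 := RatFunc.denom_ne_zero f
  have h4 := RatFunc.denom_ne_zero g
  have : f * g = algebraMap ℂ[X] _ (f.num * g.num) / algebraMap ℂ[X] _ (f.denom * g.denom) := by
    conv_lhs => rw [← RatFunc.num_div_denom f, ← RatFunc.num_div_denom g]
    rw [map_mul, map_mul, div_mul_div_comm]
  rw [this, ordAt_div a (mul_ne_zero h1 h2) (mul_ne_zero h3 h4),
    rootMultiplicity_mul (mul_ne_zero h1 h2), rootMultiplicity_mul (mul_ne_zero h3 h4)]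
  unfold ordAt
  push_cast
  ring

@[simp] theorem ordAt_C (a c : ℂ) : ordAt a (RatFunc.C c) = 0 := by
  simp only [ordAt, RatFunc.num_C, RatFunc.denom_C, rootMultiplicity_C]
  rw [← Polynomial.C_1, rootMultiplicity_C]
  simp

@[simp] theorem ordAt_one (a : ℂ) : ordAt a 1 = 0 := by
  rw [← map_one RatFunc.C, ordAt_C]

theorem ordAt_inv (a : ℂ) (f : RatFunc ℂ) : ordAt a f⁻¹ = -ordAt a f := by
  by_cases hf : f = 0
  · subst hf
    rw [inv_zero, ← map_zero RatFunc.C, ordAt_C, neg_zero]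
  have := ordAt_mul a hf (inv_ne_zero hf)
  rw [mul_inv_cancel₀ hf, ordAt_one] at this
  omega

theorem lin_eq (b : ℂ) : lin b = algebraMap ℂ[X] _ (Polynomial.X - Polynomial.C b) := by
  simp [lin, RatFunc.algebraMap_X, RatFunc.algebraMap_C]

theorem lin_ne_zero (b : ℂ) : lin b ≠ 0 := by
  rw [lin_eq, Ne, FaithfulSMul.algebraMap_eq_zero_iff]
  exact X_sub_C_ne_zero b

theorem ordAt_lin (a b : ℂ) : ordAt a (lin b) = if a = b then 1 else 0 := by
  have : lin b = algebraMap ℂ[X] _ (Polynomial.X - Polynomial.C b) / algebraMap ℂ[X] _ 1 := by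
    rw [lin_eq]; simp
  rw [this, ordAt_div a (X_sub_C_ne_zero b) one_ne_zero, rootMultiplicity_X_sub_C,
    ← Polynomial.C_1, rootMultiplicity_C]
  split_ifs <;> simp

theorem ordAt_prod {ι : Type*} (a : ℂ) (s : Finset ι) (f : ι → RatFunc ℂ) (hf : ∀ i ∈ s, f i ≠ 0) :
    ordAt a (∏ i ∈ s, f i) = ∑ i ∈ s, ordAt a (f i) := by
  classical
  induction s using Finset.induction_on with
  | empty => simp
  | insert i s hi ih =>
    have h' : ∀ i ∈ s, f i ≠ 0 := fun j hj => hf j (Finset.mem_insert_of_mem hj)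
    rw [Finset.prod_insert hi, Finset.sum_insert hi, ordAt_mul a (hf i (Finset.mem_insert_self i s))
      (Finset.prod_ne_zero_iff.2 h'), ih h']

theorem not_isRoot_num_and_denom (a : ℂ) (f : RatFunc ℂ) (h : f.denom.eval a = 0) :
    f.num.eval a ≠ 0 := by
  intro h'
  obtain ⟨u, v, huv⟩ := RatFunc.isCoprime_num_denom f
  have := congrArg (Polynomial.eval a) huv
  simp [h, h'] at this

/-- Numerator and denominator are coprime, so a zero of the denominator is not cancelled and would
make the order negative. -/
theorem regularAt_of_ordAt {a : ℂ} {f : RatFunc ℂ} (h : 0 ≤ ordAt a f) : RegularAt f a := by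
  intro h0
  have h1 := not_isRoot_num_and_denom a f h0
  have h2 : f.num.rootMultiplicity a = 0 := rootMultiplicity_eq_zero h1
  have h3 : 0 < f.denom.rootMultiplicity a :=
    (rootMultiplicity_pos (RatFunc.denom_ne_zero f)).2 h0
  unfold ordAt at h
  omega

theorem eval_denom_eq_zero_of_ordAt {a : ℂ} {f : RatFunc ℂ} (h : ordAt a f < 0) :
    f.denom.eval a = 0 := by
  by_contra h0
  have h2 : f.denom.rootMultiplicity a = 0 := rootMultiplicity_eq_zero h0
  unfold ordAt at h
  omega

theorem RegularAt.mul {a : ℂ} {f g : RatFunc ℂ} (hf : RegularAt f a) (hg : RegularAt g a) :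
    RegularAt (f * g) a := by
  intro h
  have := eval_eq_zero_of_dvd_of_eval_eq_zero (RatFunc.denom_mul_dvd f g) h
  rw [eval_mul] at this
  exact (mul_ne_zero hf hg) this

theorem RegularAt.add {a : ℂ} {f g : RatFunc ℂ} (hf : RegularAt f a) (hg : RegularAt g a) :
    RegularAt (f + g) a := by
  intro h
  have := eval_eq_zero_of_dvd_of_eval_eq_zero (RatFunc.denom_add_dvd f g) h
  rw [eval_mul] at this
  exact (mul_ne_zero hf hg) this

theorem regularAt_C (a c : ℂ) : RegularAt (RatFunc.C c) a := by simp [RegularAt]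

theorem regularAt_algebraMap (a : ℂ) (p : ℂ[X]) : RegularAt (algebraMap _ _ p) a := by
  simp [RegularAt]

theorem regularAt_lin (a b : ℂ) : RegularAt (lin b) a := by
  rw [lin_eq]; exact regularAt_algebraMap _ _

theorem RegularAt.neg {a : ℂ} {f : RatFunc ℂ} (hf : RegularAt f a) : RegularAt (-f) a := by
  have : -f = RatFunc.C (-1) * f := by simp
  rw [this]
  exact (regularAt_C a _).mul hf

theorem RegularAt.sub {a : ℂ} {f g : RatFunc ℂ} (hf : RegularAt f a) (hg : RegularAt g a) :
    RegularAt (f - g) a := by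
  rw [sub_eq_add_neg]
  exact hf.add hg.neg

theorem value_mul {a : ℂ} {f g : RatFunc ℂ} (hf : RegularAt f a) (hg : RegularAt g a) :
    value (f * g) a = value f a * value g a :=
  RatFunc.eval_mul _ _ hf hg

theorem value_add {a : ℂ} {f g : RatFunc ℂ} (hf : RegularAt f a) (hg : RegularAt g a) :
    value (f + g) a = value f a + value g a :=
  RatFunc.eval_add _ _ hf hg

@[simp] theorem value_C (a c : ℂ) : value (RatFunc.C c) a = c := by simp [value]

@[simp] theorem value_one (a : ℂ) : value 1 a = 1 := by simp [value]

@[simp] theorem value_lin (a b : ℂ) : value (lin b) a = a - b := by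
  rw [lin_eq, value, RatFunc.eval_algebraMap]; simp

theorem value_ne_zero {a : ℂ} {f : RatFunc ℂ} (hf : f ≠ 0) (h : ordAt a f = 0) :
    value f a ≠ 0 := by
  have hr := regularAt_of_ordAt h.ge
  have hr' : RegularAt f⁻¹ a := regularAt_of_ordAt (by rw [ordAt_inv, h]; simp)
  have := value_mul hr hr'
  rw [mul_inv_cancel₀ hf, value_one] at this
  exact left_ne_zero_of_mul (this ▸ one_ne_zero)

theorem value_inv {a : ℂ} {f : RatFunc ℂ} (h : ordAt a f = 0) :
    value f⁻¹ a = (value f a)⁻¹ := by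
  by_cases hf : f = 0
  · subst hf; simp [value]
  have hr := regularAt_of_ordAt h.ge
  have hr' : RegularAt f⁻¹ a := regularAt_of_ordAt (by rw [ordAt_inv, h]; simp)
  have := value_mul hr hr'
  rw [mul_inv_cancel₀ hf, value_one] at this
  exact (inv_eq_of_mul_eq_one_right this.symm).symm

theorem value_neg {a : ℂ} {f : RatFunc ℂ} (hf : RegularAt f a) : value (-f) a = -value f a := by
  have : -f = RatFunc.C (-1) * f := by simp
  rw [this, value_mul (regularAt_C a _) hf, value_C, neg_one_mul]

theorem value_sub {a : ℂ} {f g : RatFunc ℂ} (hf : RegularAt f a) (hg : RegularAt g a) :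
    value (f - g) a = value f a - value g a := by
  rw [sub_eq_add_neg, value_add hf hg.neg, value_neg hg, sub_eq_add_neg]

/-! Laurent expansions -/

/-- The expansion at `0` as a ring homomorphism. -/
def toLaurent (F : Type*) [Field F] : RatFunc F →+* LaurentSeries F :=
  algebraMap (RatFunc F) (LaurentSeries F)

theorem toLaurent_polynomial {F : Type*} [Field F] (p : F[X]) :
    toLaurent F (algebraMap F[X] _ p) = HahnSeries.ofPowerSeries ℤ F (p : PowerSeries F) := by
  rw [RatFunc.coe_coe, RatFunc.coePolynomial_eq_algebraMap]; rfl

theorem toLaurent_C {F : Type*} [Field F] (c : F) :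
    toLaurent F (RatFunc.C c) = HahnSeries.C c := by
  rw [← RatFunc.algebraMap_C, toLaurent_polynomial]; simp

theorem toLaurent_X {F : Type*} [Field F] :
    toLaurent F RatFunc.X = HahnSeries.single 1 1 := RatFunc.coe_X

theorem toLaurent_injective {F : Type*} [Field F] : Function.Injective (toLaurent F) :=
  (toLaurent F).injective

theorem coeffZero_eq (f : RatFunc ℂ) (n : ℤ) : coeffZero f n = (toLaurent ℂ f).coeff n := rfl

theorem coeffZero_add (f g : RatFunc ℂ) (n : ℤ) :
    coeffZero (f + g) n = coeffZero f n + coeffZero g n := by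
  simp [coeffZero_eq]

theorem coeffZero_sub (f g : RatFunc ℂ) (n : ℤ) :
    coeffZero (f - g) n = coeffZero f n - coeffZero g n := by
  simp [coeffZero_eq]

theorem coeffZero_C_mul (c : ℂ) (f : RatFunc ℂ) (n : ℤ) :
    coeffZero (RatFunc.C c * f) n = c * coeffZero f n := by
  simp [coeffZero_eq, toLaurent_C, HahnSeries.C_apply]

theorem coeffZero_X_mul (f : RatFunc ℂ) (n : ℤ) :
    coeffZero (RatFunc.X * f) n = coeffZero f (n - 1) := by
  simp [coeffZero_eq, toLaurent_X, HahnSeries.coeff_single_mul]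

theorem coeffZero_C (c : ℂ) (n : ℤ) :
    coeffZero (RatFunc.C c) n = if n = 0 then c else 0 := by
  simp [coeffZero_eq, toLaurent_C, HahnSeries.coeff_single]

theorem exists_powerSeries {f : RatFunc ℂ} (hf : RegularAt f 0) :
    ∃ φ : PowerSeries ℂ, toLaurent ℂ f = HahnSeries.ofPowerSeries ℤ ℂ φ ∧
      PowerSeries.constantCoeff φ = value f 0 := by
  have hd : PowerSeries.constantCoeff (f.denom : PowerSeries ℂ) ≠ 0 := by
    simpa [RegularAt, Polynomial.coeff_zero_eq_eval_zero] using hf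
  refine ⟨(f.num : PowerSeries ℂ) * (f.denom : PowerSeries ℂ)⁻¹, ?_, ?_⟩
  · conv_lhs => rw [← RatFunc.num_div_denom f, map_div₀]
    have h0 : toLaurent ℂ (algebraMap ℂ[X] _ f.denom) ≠ 0 := by
      simp [RatFunc.denom_ne_zero]
    rw [div_eq_iff h0]
    rw [toLaurent_polynomial, toLaurent_polynomial, ← map_mul, mul_assoc, PowerSeries.inv_mul_cancel _ hd, mul_one]
  · simp [value, RatFunc.eval, Polynomial.coeff_zero_eq_eval_zero, div_eq_mul_inv]

theorem coeffZero_zero {f : RatFunc ℂ} (hf : RegularAt f 0) : coeffZero f 0 = value f 0 := by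
  obtain ⟨φ, h1, h2⟩ := exists_powerSeries hf
  rw [coeffZero_eq, h1, ← h2]
  simpa using LaurentSeries.coeff_coe_powerSeries φ 0

theorem coeffZero_of_neg {f : RatFunc ℂ} (hf : RegularAt f 0) {n : ℤ} (hn : n < 0) :
    coeffZero f n = 0 := by
  obtain ⟨φ, h1, h2⟩ := exists_powerSeries hf
  rw [coeffZero_eq, h1, PowerSeries.coeff_coe, if_pos hn]

theorem coeffZero_injective {f g : RatFunc ℂ} (h : ∀ n, coeffZero f n = coeffZero g n) : f = g :=
  toLaurent_injective (HahnSeries.ext (_root_.funext h))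

/-- The inverse of the variable is transcendental over ℂ. No denominator dies under z ↦ z⁻¹, which
is what makes this substitution a ring homomorphism. -/
theorem eval₂_X_inv_ne_zero {p : ℂ[X]} (hp : p ≠ 0) :
    p.eval₂ RatFunc.C (RatFunc.X)⁻¹ ≠ 0 := by
  have h : Transcendental ℂ (RatFunc.X : RatFunc ℂ)⁻¹ :=
    fun h => RatFunc.transcendental_X (by simpa using h.inv)
  exact (transcendental_iff.1 h p).mt hp

/-- The substitution `z ↦ z⁻¹`. -/
def invSub : RatFunc ℂ →+* RatFunc ℂ where
  toFun := RatFunc.eval RatFunc.C (RatFunc.X)⁻¹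
  map_one' := RatFunc.eval_one _ _
  map_zero' := RatFunc.eval_zero _ _
  map_mul' _ _ := RatFunc.eval_mul _ _ (eval₂_X_inv_ne_zero (RatFunc.denom_ne_zero _))
    (eval₂_X_inv_ne_zero (RatFunc.denom_ne_zero _))
  map_add' _ _ := RatFunc.eval_add _ _ (eval₂_X_inv_ne_zero (RatFunc.denom_ne_zero _))
    (eval₂_X_inv_ne_zero (RatFunc.denom_ne_zero _))

theorem coeffInfty_eq (f : RatFunc ℂ) (n : ℤ) : coeffInfty f n = coeffZero (invSub f) n := rfl

@[simp] theorem invSub_C (c : ℂ) : invSub (RatFunc.C c) = RatFunc.C c := RatFunc.eval_C _ _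

@[simp] theorem invSub_X : invSub RatFunc.X = RatFunc.X⁻¹ := RatFunc.eval_X _ _

theorem coeffInfty_sub (f g : RatFunc ℂ) (n : ℤ) :
    coeffInfty (f - g) n = coeffInfty f n - coeffInfty g n := by
  simp [coeffInfty_eq, coeffZero_sub]

theorem coeffInfty_add (f g : RatFunc ℂ) (n : ℤ) :
    coeffInfty (f + g) n = coeffInfty f n + coeffInfty g n := by
  simp [coeffInfty_eq, coeffZero_add]

theorem coeffInfty_C_mul (c : ℂ) (f : RatFunc ℂ) (n : ℤ) :
    coeffInfty (RatFunc.C c * f) n = c * coeffInfty f n := by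
  simp [coeffInfty_eq, coeffZero_C_mul]

theorem coeffInfty_C (c : ℂ) (n : ℤ) :
    coeffInfty (RatFunc.C c) n = if n = 0 then c else 0 := by
  simp [coeffInfty_eq, coeffZero_C]

theorem coeffInfty_X_mul (f : RatFunc ℂ) (n : ℤ) :
    coeffInfty (RatFunc.X * f) n = coeffInfty f (n + 1) := by
  rw [coeffInfty_eq, coeffInfty_eq, map_mul, invSub_X]
  have := coeffZero_X_mul (RatFunc.X⁻¹ * invSub f) (n + 1)
  rw [mul_inv_cancel_left₀ RatFunc.X_ne_zero, add_sub_cancel_right] at this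
  exact this.symm

/-- A simple pole contributes its coefficient to the residue. -/
theorem residue_eq {f : RatFunc ℂ} {a : ℂ} (hf : RegularAt (f * lin a) a) :
    residue f a = value (f * lin a) a := by
  set g := f * lin a with hg
  have hreg : RegularAt (RatFunc.laurent a g) 0 ∧ value (RatFunc.laurent a g) 0 = value g a := by
    have h1 : RatFunc.laurent a g =
        algebraMap ℂ[X] _ (taylor a g.num) * (algebraMap ℂ[X] _ (taylor a g.denom))⁻¹ := by
      conv_lhs => rw [← RatFunc.num_div_denom g]
      rw [RatFunc.laurent_div, div_eq_mul_inv]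
    have h2 : (taylor a g.denom).eval 0 ≠ 0 := by
      rw [taylor_eval]; simpa [RegularAt] using hf
    have h3 : taylor a g.denom ≠ 0 := by rintro h; simp [h] at h2
    have h4 : ordAt 0 (algebraMap ℂ[X] (RatFunc ℂ) (taylor a g.denom)) = 0 := by
      rw [ordAt, RatFunc.num_algebraMap, RatFunc.denom_algebraMap,
        rootMultiplicity_eq_zero h2, ← Polynomial.C_1, rootMultiplicity_C]
      simp
    have h5 : RegularAt (algebraMap ℂ[X] (RatFunc ℂ) (taylor a g.denom))⁻¹ 0 :=
      regularAt_of_ordAt (by rw [ordAt_inv, h4]; simp)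
    refine ⟨h1 ▸ (regularAt_algebraMap _ _).mul h5, ?_⟩
    rw [h1, value_mul (regularAt_algebraMap _ _) h5, value_inv h4]
    simp [value, RatFunc.eval, eval₂_id, div_eq_mul_inv]
  -- Translation by a turns z − a into z, so the coefficient of index −1 for f is the constant
  -- coefficient for f · (z − a).
  have h : RatFunc.laurent a g = RatFunc.X * RatFunc.laurent a f := by
    rw [hg, lin, map_mul, map_sub, RatFunc.laurent_X, RatFunc.laurent_C]
    ring
  have := coeffZero_X_mul (RatFunc.laurent a f) 0
  rw [← h, coeffZero_zero hreg.1, hreg.2] at this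
  rw [residue, this]
  rfl

end RationalFunctions

end ToroidalGl2

namespace ToroidalGl2

/-! ### Partial fractions, and balanced functions. -/

noncomputable section PartialFractions

open Polynomial hiding map_ne_zero

theorem RegularAt.ordAt_nonneg {a : ℂ} {f : RatFunc ℂ} (h : RegularAt f a) : 0 ≤ ordAt a f := by
  have h2 : f.denom.rootMultiplicity a = 0 := rootMultiplicity_eq_zero h
  unfold ordAt
  omega

theorem regularAt_inv {a : ℂ} {f : RatFunc ℂ} (h : ordAt a f = 0) : RegularAt f⁻¹ a :=
  regularAt_of_ordAt (by rw [ordAt_inv, h]; simp)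

theorem regularAt_lin_inv {a b : ℂ} (h : a ≠ b) : RegularAt (lin b)⁻¹ a :=
  regularAt_inv (by rw [ordAt_lin, if_neg h])

theorem value_lin_inv {a b : ℂ} (h : a ≠ b) : value (lin b)⁻¹ a = (a - b)⁻¹ := by
  rw [value_inv (by rw [ordAt_lin, if_neg h]), value_lin]

theorem RegularAt.mul_lin_inv {a : ℂ} {g : RatFunc ℂ} (hg : RegularAt g a) (h0 : value g a = 0) :
    RegularAt (g * (lin a)⁻¹) a := by
  by_cases h : g = 0
  · subst h; rw [zero_mul, ← map_zero RatFunc.C]; exact regularAt_C _ _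
  apply regularAt_of_ordAt
  rw [ordAt_mul a h (inv_ne_zero (lin_ne_zero a)), ordAt_inv, ordAt_lin, if_pos rfl]
  have h1 := hg.ordAt_nonneg
  have h2 : ordAt a g ≠ 0 := fun h2 => value_ne_zero h h2 h0
  omega

theorem intDegree_lin (a : ℂ) : (lin a).intDegree = 1 := by
  rw [lin_eq, RatFunc.intDegree_polynomial, natDegree_X_sub_C]; rfl

/-- Over ℂ a denominator without roots is constant, and the degree bound then makes the numerator
constant. -/
theorem exists_eq_C_of_regular {f : RatFunc ℂ} (hdeg : f.intDegree ≤ 0) (h : ∀ a, RegularAt f a) :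
    ∃ c, f = RatFunc.C c := by
  have hd : f.denom = 1 := by
    have h0 : f.denom.natDegree = 0 := by
      by_contra h0
      obtain ⟨a, ha⟩ := IsAlgClosed.exists_root f.denom
        (fun h1 => h0 (natDegree_eq_of_degree_eq_some h1))
      exact h a ha
    exact (RatFunc.monic_denom f).natDegree_eq_zero.1 h0
  have hn : f.num.natDegree = 0 := by
    have : (f.num.natDegree : ℤ) - f.denom.natDegree ≤ 0 := hdeg
    rw [hd, natDegree_one] at this
    omega
  obtain ⟨c, hc⟩ := natDegree_eq_zero.1 hn
  refine ⟨c, ?_⟩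
  rw [← RatFunc.num_div_denom f, hd, ← hc, map_one, div_one, RatFunc.algebraMap_C]

/-- Induction on the set of possible poles, for all f at once: subtracting the principal part at one
point removes that pole and changes neither the degree bound nor the coefficients at the other
points. -/
theorem partial_fractions (T : Finset ℂ) : ∀ (f : RatFunc ℂ), f.intDegree ≤ 0 →
    (∀ a ∈ T, RegularAt (f * lin a) a) → (∀ a ∉ T, RegularAt f a) →
    ∃ c, f = RatFunc.C c + ∑ a ∈ T, RatFunc.C (value (f * lin a) a) * (lin a)⁻¹ := by
  induction T using Finset.induction_on with
  | empty =>
    intro f hdeg _ h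
    obtain ⟨c, hc⟩ := exists_eq_C_of_regular hdeg (fun a => h a (Finset.notMem_empty a))
    exact ⟨c, by simpa using hc⟩
  | insert a T ha ih =>
    intro f hdeg hpole hreg
    set r := value (f * lin a) a with hr
    have hla := lin_ne_zero a
    have hra := hpole a (Finset.mem_insert_self a T)
    have hregC : ∀ b, b ≠ a → RegularAt (RatFunc.C r * (lin a)⁻¹) b := fun b hb =>
      (regularAt_C b r).mul (regularAt_lin_inv hb)
    have key : ∀ b ∈ T, RegularAt ((f - RatFunc.C r * (lin a)⁻¹) * lin b) b ∧
        value ((f - RatFunc.C r * (lin a)⁻¹) * lin b) b = value (f * lin b) b := by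
      intro b hb
      have hba : b ≠ a := by rintro rfl; exact ha hb
      have h1 := hpole b (Finset.mem_insert_of_mem hb)
      have h2 := (hregC b hba).mul (regularAt_lin b b)
      rw [sub_mul]
      refine ⟨h1.sub h2, ?_⟩
      rw [value_sub h1 h2, value_mul (hregC b hba) (regularAt_lin b b), value_lin]
      simp
    have hcomb : (f - RatFunc.C r * (lin a)⁻¹).intDegree ≤ 0 ∧
        ∀ b ∉ T, RegularAt (f - RatFunc.C r * (lin a)⁻¹) b := ?_
    · obtain ⟨c, hc⟩ := ih (f - RatFunc.C r * (lin a)⁻¹) hcomb.1 (fun b hb => (key b hb).1) hcomb.2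
      refine ⟨c, ?_⟩
      rw [Finset.sum_congr rfl (fun b hb => by rw [(key b hb).2])] at hc
      rw [Finset.sum_insert ha, ← hr]
      linear_combination hc
    refine ⟨?_, ?_⟩
    · by_cases h0 : f - RatFunc.C r * (lin a)⁻¹ = 0
      · rw [h0]; simp
      by_cases hr0 : RatFunc.C r * (lin a)⁻¹ = 0
      · rw [hr0, sub_zero]; exact hdeg
      have hC : RatFunc.C r ≠ 0 := left_ne_zero_of_mul hr0
      rw [sub_eq_add_neg] at h0 ⊢
      refine (RatFunc.intDegree_add_le (neg_ne_zero.2 hr0) h0).trans (max_le hdeg ?_)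
      rw [RatFunc.intDegree_neg, RatFunc.intDegree_mul hC (inv_ne_zero hla), RatFunc.intDegree_C,
        RatFunc.intDegree_inv, intDegree_lin]
      norm_num
    · intro b hb
      by_cases hba : b = a
      · subst hba
        have h1 : f - RatFunc.C r * (lin b)⁻¹ = (f * lin b - RatFunc.C r) * (lin b)⁻¹ := by
          field_simp
        rw [h1]
        exact (hra.sub (regularAt_C b r)).mul_lin_inv (by
          rw [value_sub hra (regularAt_C b r), value_C, hr, sub_self])
      · exact (hreg b (by simp [hba, hb])).sub (hregC b hba)

/-- Both expansions of 1/(z − a) satisfy the recursion given by (z − a) · 1/(z − a) = 1. Their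
difference satisfies the homogeneous recursion, so it is geometric and is fixed by its value at n =
1. This is the source of the delta functions. -/
theorem coeff_lin_inv {a : ℂ} (ha : a ≠ 0) (n : ℤ) :
    coeffInfty (lin a)⁻¹ n - coeffZero (lin a)⁻¹ (-n) = a ^ (n - 1) := by
  have hla := lin_ne_zero a
  have e : RatFunc.X * (lin a)⁻¹ - RatFunc.C a * (lin a)⁻¹ = RatFunc.C 1 := by
    rw [← sub_mul, map_one]
    exact mul_inv_cancel₀ hla
  have hz : ∀ n, coeffZero (lin a)⁻¹ (n - 1) - a * coeffZero (lin a)⁻¹ n = if n = 0 then 1 else 0 := by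
    intro n
    rw [← coeffZero_X_mul, ← coeffZero_C_mul, ← coeffZero_sub, e, coeffZero_C]
  have hi : ∀ n, coeffInfty (lin a)⁻¹ (n + 1) - a * coeffInfty (lin a)⁻¹ n =
      if n = 0 then 1 else 0 := by
    intro n
    rw [← coeffInfty_X_mul, ← coeffInfty_C_mul, ← coeffInfty_sub, e, coeffInfty_C]
  set d : ℤ → ℂ := fun n => coeffInfty (lin a)⁻¹ n - coeffZero (lin a)⁻¹ (-n) with hd
  have hrec : ∀ n, d (n + 1) = a * d n := by
    intro n
    have h1 := hz (-n)
    have h2 := hi n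
    simp only [hd, neg_add, ← sub_eq_add_neg]
    simp only [neg_eq_zero] at h1
    linear_combination h2 - h1
  have h1 : d 1 = 1 := by
    have hr0 : RegularAt (lin a)⁻¹ 0 := regularAt_lin_inv ha.symm
    -- 1/(z − a) vanishes at infinity: after z ↦ z⁻¹ it is z times a function regular at 0.
    have hinv : RegularAt (invSub (lin a)⁻¹) 0 ∧ value (invSub (lin a)⁻¹) 0 = 0 := by
      have hne : (0 : ℂ) ≠ a⁻¹ := (inv_ne_zero ha).symm
      have : invSub (lin a)⁻¹ = lin 0 * (RatFunc.C (-a⁻¹) * (lin a⁻¹)⁻¹) := by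
        rw [map_inv₀, lin, map_sub, invSub_X, invSub_C]
        have hX : (RatFunc.X : RatFunc ℂ) ≠ 0 := RatFunc.X_ne_zero
        have hCa : RatFunc.C a ≠ 0 := (map_ne_zero RatFunc.C).2 ha
        have h3 : RatFunc.X⁻¹ - RatFunc.C a = -RatFunc.C a * lin a⁻¹ * RatFunc.X⁻¹ := by
          rw [lin, map_inv₀]
          field_simp
          ring
        have h4 : (lin 0 : RatFunc ℂ) = RatFunc.X := by simp [lin]
        rw [h3, h4, ← inv_neg, map_inv₀, map_neg, mul_inv, mul_inv, inv_inv]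
        ring
      have hr : RegularAt (RatFunc.C (-a⁻¹) * (lin a⁻¹)⁻¹) 0 :=
        (regularAt_C _ _).mul (regularAt_lin_inv hne)
      rw [this]
      exact ⟨(regularAt_lin _ _).mul hr, by rw [value_mul (regularAt_lin _ _) hr]; simp⟩
    have h2 := hi 0
    rw [if_pos rfl, coeffInfty_eq _ 0, coeffZero_zero hinv.1, hinv.2] at h2
    simp only [hd]
    rw [coeffZero_of_neg hr0 (by norm_num)]
    simpa using h2
  have hmain : ∀ n : ℤ, d n = a ^ (n - 1) := by
    intro n
    induction n using Int.inductionOn' (b := 1) with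
    | zero => simpa using h1
    | succ k _ ih =>
      rw [hrec, ih, add_sub_cancel_right, ← zpow_one_add₀ ha]
      congr 1
      ring
    | pred k _ ih =>
      have := hrec (k - 1)
      rw [sub_add_cancel, ih] at this
      have h3 : a ^ (k - 1) = a * a ^ (k - 1 - 1) := by
        rw [← zpow_one_add₀ ha]; congr 1; ring
      rw [h3] at this
      exact (mul_left_cancel₀ ha this).symm
  exact hmain n

/-- The residues in the action are taken against dz/z, hence the extra factor 1/a. -/
theorem residue_div_X {f : RatFunc ℂ} {a : ℂ} (ha : a ≠ 0) (hf : RegularAt (f * lin a) a) :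
    residue (f / RatFunc.X) a = value (f * lin a) a / a := by
  have hX : (RatFunc.X : RatFunc ℂ) = lin 0 := by simp [lin]
  have e : f / RatFunc.X * lin a = f * lin a * (lin 0)⁻¹ := by rw [hX]; ring
  rw [residue_eq (by rw [e]; exact hf.mul (regularAt_lin_inv ha)), e,
    value_mul hf (regularAt_lin_inv ha), value_lin_inv ha, sub_zero, div_eq_mul_inv]

/-- The difference of the expansions at infinity and at zero is a sum over simple poles. -/
theorem coeffInfty_sub_coeffZero (T : Finset ℂ) (f : RatFunc ℂ) (hdeg : f.intDegree ≤ 0)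
    (hT : (0 : ℂ) ∉ T) (hpole : ∀ a ∈ T, RegularAt (f * lin a) a)
    (hreg : ∀ a ∉ T, RegularAt f a) (n : ℤ) :
    coeffInfty f n - coeffZero f (-n) = ∑ a ∈ T, residue (f / RatFunc.X) a * a ^ n := by
  have hsumI : ∀ g : ℂ → RatFunc ℂ, coeffInfty (∑ a ∈ T, g a) n = ∑ a ∈ T, coeffInfty (g a) n := by
    intro g
    exact map_sum (⟨⟨fun f => coeffInfty f n, by simpa using coeffInfty_C 0 n⟩,
      fun f g => coeffInfty_add f g n⟩ : RatFunc ℂ →+ ℂ) g T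
  have hsumZ : ∀ g : ℂ → RatFunc ℂ, coeffZero (∑ a ∈ T, g a) (-n) =
      ∑ a ∈ T, coeffZero (g a) (-n) := by
    intro g
    exact map_sum (⟨⟨fun f => coeffZero f (-n), by simpa using coeffZero_C 0 (-n)⟩,
      fun f g => coeffZero_add f g (-n)⟩ : RatFunc ℂ →+ ℂ) g T
  have hne : ∀ a ∈ T, a ≠ 0 := fun a ha h => hT (h ▸ ha)
  obtain ⟨c, hc⟩ := partial_fractions T f hdeg hpole hreg
  have hres : ∀ a ∈ T, residue (f / RatFunc.X) a * a ^ n = value (f * lin a) a *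
      (coeffInfty (lin a)⁻¹ n - coeffZero (lin a)⁻¹ (-n)) := by
    intro a ha
    rw [residue_div_X (hne a ha) (hpole a ha), coeff_lin_inv (hne a ha), zpow_sub_one₀ (hne a ha)]
    ring
  rw [Finset.sum_congr rfl hres]
  generalize (fun a => value (f * lin a) a) = r at hc
  conv_lhs => rw [hc]
  rw [coeffInfty_add, coeffZero_add, hsumI, hsumZ, coeffInfty_C, coeffZero_C]
  simp only [neg_eq_zero, add_sub_add_left_eq_sub]
  rw [← Finset.sum_sub_distrib]
  refine Finset.sum_congr rfl fun a _ => ?_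
  rw [coeffInfty_C_mul, coeffZero_C_mul, mul_sub]

/-- `f` is a unit at `0` and at `∞`, with the given values there. -/
structure BalancedData (f : RatFunc ℂ) (v w : ℂ) : Prop where
  ne_zero : f ≠ 0
  ord_zero : ordAt 0 f = 0
  value_zero : value f 0 = v
  ord_infty : ordAt 0 (invSub f) = 0
  value_infty : value (invSub f) 0 = w
  degree : f.intDegree = 0

namespace BalancedData

theorem mul {f g : RatFunc ℂ} {v w v' w' : ℂ} (hf : BalancedData f v w)
    (hg : BalancedData g v' w') : BalancedData (f * g) (v * v') (w * w') := by
  have h1 : invSub f ≠ 0 := (map_ne_zero _).2 hf.ne_zero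
  have h2 : invSub g ≠ 0 := (map_ne_zero _).2 hg.ne_zero
  refine ⟨mul_ne_zero hf.ne_zero hg.ne_zero, ?_, ?_, ?_, ?_, ?_⟩
  · rw [ordAt_mul _ hf.ne_zero hg.ne_zero, hf.ord_zero, hg.ord_zero, add_zero]
  · rw [value_mul (regularAt_of_ordAt hf.ord_zero.ge) (regularAt_of_ordAt hg.ord_zero.ge),
      hf.value_zero, hg.value_zero]
  · rw [map_mul, ordAt_mul _ h1 h2, hf.ord_infty, hg.ord_infty, add_zero]
  · rw [map_mul, value_mul (regularAt_of_ordAt hf.ord_infty.ge)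
      (regularAt_of_ordAt hg.ord_infty.ge), hf.value_infty, hg.value_infty]
  · rw [RatFunc.intDegree_mul hf.ne_zero hg.ne_zero, hf.degree, hg.degree, add_zero]

theorem inv {f : RatFunc ℂ} {v w : ℂ} (hf : BalancedData f v w) : BalancedData f⁻¹ v⁻¹ w⁻¹ := by
  refine ⟨inv_ne_zero hf.ne_zero, ?_, ?_, ?_, ?_, ?_⟩
  · rw [ordAt_inv, hf.ord_zero, neg_zero]
  · rw [value_inv hf.ord_zero, hf.value_zero]
  · rw [map_inv₀, ordAt_inv, hf.ord_infty, neg_zero]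
  · rw [map_inv₀, value_inv hf.ord_infty, hf.value_infty]
  · rw [RatFunc.intDegree_inv, hf.degree, neg_zero]

theorem const {c : ℂ} (hc : c ≠ 0) : BalancedData (RatFunc.C c) c c :=
  ⟨(map_ne_zero _).2 hc, ordAt_C _ _, value_C _ _, by simp, by simp, RatFunc.intDegree_C c⟩

theorem one : BalancedData 1 1 1 := by
  simpa using const one_ne_zero

theorem lin_div_lin {a b : ℂ} (ha : a ≠ 0) (hb : b ≠ 0) :
    BalancedData (lin a / lin b) (a / b) 1 := by
  -- The pole of z − a at infinity is isolated in the factor z⁻¹, which cancels in a quotient of two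
  -- such factors.
  have hinv : ∀ {a : ℂ}, a ≠ 0 → invSub (lin a) = RatFunc.C (-a) * lin a⁻¹ * RatFunc.X⁻¹ := by
    intro a ha
    have hX : (RatFunc.X : RatFunc ℂ) ≠ 0 := RatFunc.X_ne_zero
    have hCa : RatFunc.C a ≠ 0 := (map_ne_zero RatFunc.C).2 ha
    rw [lin, lin, map_sub, invSub_X, invSub_C, map_inv₀, map_neg]
    field_simp
    ring
  have h0 : ∀ {a : ℂ}, a ≠ 0 → ordAt 0 (lin a) = 0 := fun ha => by
    rw [ordAt_lin, if_neg ha.symm]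
  have hC : ∀ {a : ℂ}, a ≠ 0 → RatFunc.C (-a) ≠ 0 := fun ha =>
    (map_ne_zero RatFunc.C).2 (neg_ne_zero.2 ha)
  have e : invSub (lin a / lin b) =
      (RatFunc.C (-a) * lin a⁻¹) * (RatFunc.C (-b) * lin b⁻¹)⁻¹ := by
    have hX : (RatFunc.X : RatFunc ℂ) ≠ 0 := RatFunc.X_ne_zero
    rw [map_div₀, hinv ha, hinv hb, mul_div_mul_right _ _ (inv_ne_zero hX), div_eq_mul_inv]
  have ho : ∀ {a : ℂ}, a ≠ 0 → ordAt 0 (RatFunc.C (-a) * lin a⁻¹) = 0 := fun ha => by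
    rw [ordAt_mul _ (hC ha) (lin_ne_zero _), ordAt_C, h0 (inv_ne_zero ha), add_zero]
  have hv : ∀ {a : ℂ}, a ≠ 0 → value (RatFunc.C (-a) * lin a⁻¹) 0 = 1 := fun ha => by
    rw [value_mul (regularAt_C _ _) (regularAt_lin _ _), value_C, value_lin, zero_sub, neg_mul_neg,
      mul_inv_cancel₀ ha]
  have hn : ∀ {a : ℂ}, a ≠ 0 → RatFunc.C (-a) * lin a⁻¹ ≠ 0 := fun ha =>
    mul_ne_zero (hC ha) (lin_ne_zero _)
  refine ⟨div_ne_zero (lin_ne_zero _) (lin_ne_zero _), ?_, ?_, ?_, ?_, ?_⟩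
  · rw [div_eq_mul_inv, ordAt_mul _ (lin_ne_zero _) (inv_ne_zero (lin_ne_zero _)), ordAt_inv,
      h0 ha, h0 hb, neg_zero, add_zero]
  · rw [div_eq_mul_inv, value_mul (regularAt_lin _ _) (regularAt_lin_inv hb.symm), value_lin,
      value_lin_inv hb.symm]
    field_simp
    simp
  · rw [e, ordAt_mul _ (hn ha) (inv_ne_zero (hn hb)), ordAt_inv, ho ha, ho hb]
    simp
  · rw [e, value_mul (regularAt_of_ordAt (ho ha).ge) (regularAt_inv (ho hb)), value_inv (ho hb),
      hv ha, hv hb]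
    simp
  · rw [RatFunc.intDegree_div (lin_ne_zero _) (lin_ne_zero _), intDegree_lin, intDegree_lin,
      sub_self]

theorem prod {ι : Type*} (s : Finset ι) (f : ι → RatFunc ℂ) (v w : ι → ℂ)
    (h : ∀ i ∈ s, BalancedData (f i) (v i) (w i)) :
    BalancedData (∏ i ∈ s, f i) (∏ i ∈ s, v i) (∏ i ∈ s, w i) := by
  classical
  induction s using Finset.induction_on with
  | empty => simpa using one
  | insert i s hi ih =>
    rw [Finset.prod_insert hi, Finset.prod_insert hi, Finset.prod_insert hi]
    exact (h i (Finset.mem_insert_self i s)).mul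
      (ih fun j hj => h j (Finset.mem_insert_of_mem hj))

theorem coeffInfty_zero {f : RatFunc ℂ} {v w : ℂ} (h : BalancedData f v w) :
    coeffInfty f 0 = w := by
  rw [coeffInfty_eq, coeffZero_zero (regularAt_of_ordAt h.ord_infty.ge), h.value_infty]

theorem coeffZero_zero {f : RatFunc ℂ} {v w : ℂ} (h : BalancedData f v w) :
    coeffZero f 0 = v := by
  rw [ToroidalGl2.coeffZero_zero (regularAt_of_ordAt h.ord_zero.ge), h.value_zero]

theorem coeffInfty_neg {f : RatFunc ℂ} {v w : ℂ} (h : BalancedData f v w) {n : ℤ} (hn : n < 0) :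
    coeffInfty f n = 0 :=
  coeffZero_of_neg (regularAt_of_ordAt h.ord_infty.ge) hn

theorem coeffZero_neg {f : RatFunc ℂ} {v w : ℂ} (h : BalancedData f v w) {n : ℤ} (hn : n < 0) :
    coeffZero f n = 0 :=
  coeffZero_of_neg (regularAt_of_ordAt h.ord_zero.ge) hn

theorem balanced {f : RatFunc ℂ} {v w : ℂ} (h : BalancedData f v w) (hvw : v * w = 1) :
    Balanced f :=
  ⟨regularAt_of_ordAt h.ord_zero.ge, h.degree.le, by rw [h.value_zero, h.coeffInfty_zero, hvw]⟩

end BalancedData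

end PartialFractions

end ToroidalGl2

namespace ToroidalGl2

/-! ### Combinatorics of the states -/

/-- Lattice points: a family and two coordinates. -/
abbrev Pt : Type := Fin 3 × ℤ × ℤ

/-- The lattice point of a box. -/
def RBox.pt : RBox → Pt
  | .low i k => (0, i, k)
  | .pedestal i k => (1, i, k)
  | .tower n => (2, 0, n)

/-- The colour of a lattice point. -/
def Pt.col (a : Pt) : ZMod 2 := if a.1 = 2 then (a.2.1 : ZMod 2) else (a.2.1 : ZMod 2) + 1

/-- The sign of a box. -/
def RBox.isNeg : RBox → Bool
  | .low _ _ => false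
  | .pedestal _ _ => false
  | .tower n => decide (n < 0)

theorem RBox.pt_injective : Function.Injective RBox.pt := by
  intro a b h
  cases a <;> cases b <;> simp [RBox.pt] at h ⊢ <;> omega

theorem RBox.pt_inj {a b : RBox} : a.pt = b.pt ↔ a = b := RBox.pt_injective.eq_iff

/-- The lattice points in the extended order ideal of a state. -/
def filled (s : Finset RBox) : Pt → Prop
  | (0, x, y) => x < 0 ∨ y < 0 ∨ RBox.low x.toNat y.toNat ∈ s
  | (1, x, y) => x < 0 ∨ y < 0 ∨ RBox.pedestal x.toNat y.toNat ∈ s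
  | (2, x, y) => x < 0 ∨ (x = 0 ∧ (RBox.tower y ∈ s ↔ 0 ≤ y))

theorem filled_low (s : Finset RBox) (x y : ℤ) :
    filled s (0, x, y) ↔ x < 0 ∨ y < 0 ∨ RBox.low x.toNat y.toNat ∈ s := Iff.rfl

theorem filled_pedestal (s : Finset RBox) (x y : ℤ) :
    filled s (1, x, y) ↔ x < 0 ∨ y < 0 ∨ RBox.pedestal x.toNat y.toNat ∈ s := Iff.rfl

theorem filled_tower (s : Finset RBox) (x y : ℤ) :
    filled s (2, x, y) ↔ x < 0 ∨ (x = 0 ∧ (RBox.tower y ∈ s ↔ 0 ≤ y)) := Iff.rfl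

/-- A positive box is filled when present and a negative one when absent, so adding a box fills a
point whatever its sign. -/
theorem filled_pt (s : Finset RBox) (b : RBox) :
    filled s b.pt ↔ (b ∈ s ↔ b.isNeg = false) := by
  cases b with
  | low i k =>
    simp only [RBox.pt, filled_low, RBox.isNeg, Int.toNat_natCast, iff_true,
      Int.not_ofNat_neg, false_or]
  | pedestal i k =>
    simp only [RBox.pt, filled_pedestal, RBox.isNeg, Int.toNat_natCast, iff_true,
      Int.not_ofNat_neg, false_or]
  | tower n => simp [RBox.pt, filled_tower, RBox.isNeg]

theorem filled_low_nat {s : Finset RBox} {i k : ℕ} :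
    filled s (0, (i : ℤ), (k : ℤ)) ↔ RBox.low i k ∈ s := by
  simpa [RBox.isNeg, RBox.pt] using filled_pt s (RBox.low i k)

theorem filled_pedestal_nat {s : Finset RBox} {i k : ℕ} :
    filled s (1, (i : ℤ), (k : ℤ)) ↔ RBox.pedestal i k ∈ s := by
  simpa [RBox.isNeg, RBox.pt] using filled_pt s (RBox.pedestal i k)

/-- Outside of the boxes, the extended order ideal does not depend on the state. -/
theorem filled_of_not_box {a : Pt} (ha : ∀ b : RBox, b.pt ≠ a) (s t : Finset RBox) :
    filled s a ↔ filled t a := by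
  obtain ⟨c, x, y⟩ := a
  fin_cases c
  · change filled s (0, x, y) ↔ filled t (0, x, y)
    rw [filled_low, filled_low]
    by_cases hx : x < 0
    · simp [hx]
    by_cases hy : y < 0
    · simp [hy]
    exact absurd (by simp [RBox.pt]; omega) (ha (RBox.low x.toNat y.toNat))
  · change filled s (1, x, y) ↔ filled t (1, x, y)
    rw [filled_pedestal, filled_pedestal]
    by_cases hx : x < 0
    · simp [hx]
    by_cases hy : y < 0
    · simp [hy]
    exact absurd (by simp [RBox.pt]; omega) (ha (RBox.pedestal x.toNat y.toNat))
  · change filled s (2, x, y) ↔ filled t (2, x, y)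
    rw [filled_tower, filled_tower]
    by_cases hx : x = 0
    · exact absurd (by simp [RBox.pt, hx]) (ha (RBox.tower y))
    simp [hx]

/-- Adding or removing a box. -/
noncomputable def toggle (s : Finset RBox) (b : RBox) : Finset RBox := symmDiff s {b}

theorem mem_toggle {s : Finset RBox} {b c : RBox} :
    c ∈ toggle s b ↔ if c = b then c ∉ s else c ∈ s := by
  unfold toggle
  rw [Finset.mem_symmDiff, Finset.mem_singleton]
  split_ifs with h <;> simp [h]

theorem toggle_toggle (s : Finset RBox) (b : RBox) : toggle (toggle s b) b = s := by
  unfold toggle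
  rw [symmDiff_assoc, symmDiff_self, symmDiff_bot]

theorem toggle_comm (s : Finset RBox) (b c : RBox) :
    toggle (toggle s b) c = toggle (toggle s c) b := by
  unfold toggle
  rw [symmDiff_assoc, symmDiff_assoc, symmDiff_comm ({b} : Finset RBox)]

/-- Inserting or deleting a box flips exactly one point, which allows both signs to be treated
together. -/
theorem filled_toggle (s : Finset RBox) (b : RBox) (a : Pt) :
    filled (toggle s b) a ↔ if a = b.pt then ¬ filled s a else filled s a := by
  by_cases h : ∃ c : RBox, c.pt = a
  · obtain ⟨c, rfl⟩ := h
    simp only [filled_pt, mem_toggle, RBox.pt_inj]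
    split_ifs <;> tauto
  · push Not at h
    rw [if_neg (fun h' => h b h'.symm)]
    exact filled_of_not_box h _ _

theorem filled_toggle_self (s : Finset RBox) (b : RBox) :
    filled (toggle s b) b.pt ↔ ¬ filled s b.pt := by simp [filled_toggle]

theorem filled_toggle_of_ne (s : Finset RBox) {b : RBox} {a : Pt} (h : a ≠ b.pt) :
    filled (toggle s b) a ↔ filled s a := by simp [filled_toggle, h]

/-- The extended order ideal is closed under decreasing the coordinates. -/
def Lower (s : Finset RBox) : Prop :=
  ∀ (c : Fin 3) (x y : ℤ), (filled s (c, x + 1, y) → filled s (c, x, y)) ∧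
    (filled s (c, x, y + 1) → filled s (c, x, y))

theorem Lower.y {s : Finset RBox} (h : Lower s) {c : Fin 3} {x y : ℤ} (hf : filled s (c, x, y)) :
    filled s (c, x, y - 1) := (h c x (y - 1)).2 (by simpa using hf)

theorem low_mem_relaxedState (l m : YoungDiagram) (n : ℤ) (i k : ℕ) :
    RBox.low i k ∈ relaxedState l m n ↔ (i, k) ∈ l := by
  simp [relaxedState]

theorem pedestal_mem_relaxedState (l m : YoungDiagram) (n : ℤ) (i k : ℕ) :
    RBox.pedestal i k ∈ relaxedState l m n ↔ (i, k) ∈ m := by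
  simp [relaxedState]

theorem tower_mem_relaxedState (l m : YoungDiagram) (n k : ℤ) :
    RBox.tower k ∈ relaxedState l m n ↔ (0 ≤ k ∧ k < n) ∨ (n ≤ k ∧ k < 0) := by
  simp [relaxedState]

theorem lower_relaxedState (l m : YoungDiagram) (n : ℤ) : Lower (relaxedState l m n) := by
  intro c x y
  have hle : ∀ (d : YoungDiagram) (i k i' k' : ℕ), i' ≤ i → k' ≤ k → (i, k) ∈ d → (i', k') ∈ d :=
    fun d i k i' k' h1 h2 h => d.up_left_mem h1 h2 h
  fin_cases c
  · change (filled _ (0, x + 1, y) → filled _ (0, x, y)) ∧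
      (filled _ (0, x, y + 1) → filled _ (0, x, y))
    simp only [filled_low, low_mem_relaxedState]
    constructor
    · rintro (h | h | h)
      · omega
      · omega
      · exact Or.inr (Or.inr (hle _ _ _ _ _ (by omega) (by omega) h))
    · rintro (h | h | h)
      · omega
      · omega
      · exact Or.inr (Or.inr (hle _ _ _ _ _ (by omega) (by omega) h))
  · change (filled _ (1, x + 1, y) → filled _ (1, x, y)) ∧
      (filled _ (1, x, y + 1) → filled _ (1, x, y))
    simp only [filled_pedestal, pedestal_mem_relaxedState]
    constructor
    · rintro (h | h | h)
      · omega
      · omega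
      · exact Or.inr (Or.inr (hle _ _ _ _ _ (by omega) (by omega) h))
    · rintro (h | h | h)
      · omega
      · omega
      · exact Or.inr (Or.inr (hle _ _ _ _ _ (by omega) (by omega) h))
  · change (filled _ (2, x + 1, y) → filled _ (2, x, y)) ∧
      (filled _ (2, x, y + 1) → filled _ (2, x, y))
    simp only [filled_tower, tower_mem_relaxedState]
    omega

/-- Only finitely many tower boxes lie in s, so high points of the column are empty and low ones are
filled; a lower subset of ℤ of this kind is a half-line. -/
theorem exists_tower_height {s : Finset RBox} (h : Lower s) :
    ∃ n : ℤ, ∀ y, filled s (2, 0, y) ↔ y < n := by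
  have hinj : Set.InjOn RBox.tower (RBox.tower ⁻¹' (s : Set RBox)) := fun a _ b _ hab => by
    simpa using hab
  set T := s.preimage RBox.tower hinj with hT
  have hmem : ∀ y, y ∈ T ↔ RBox.tower y ∈ s := fun y => by simp [hT]
  obtain ⟨M, hM⟩ := T.bddAbove
  obtain ⟨m, hm⟩ := T.bddBelow
  have hbd : ∀ y, filled s (2, 0, y) → y ≤ max M 0 := by
    intro y hy
    simp only [filled_tower, lt_irrefl, true_and, false_or] at hy
    by_cases h0 : 0 ≤ y
    · exact le_max_of_le_left (hM ((hmem y).2 (hy.2 h0)))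
    · exact le_max_of_le_right (by omega)
  -- This height is negative and below every tower box of s, so the box is negative and absent,
  -- hence filled.
  have hin : filled s (2, 0, min (m - 1) (-1)) := by
    simp only [filled_tower, lt_irrefl, true_and, false_or]
    constructor
    · intro h1
      have := hm ((hmem _).2 h1)
      omega
    · intro h1; omega
  obtain ⟨u, hu, hu'⟩ := Int.exists_greatest_of_bdd ⟨_, hbd⟩ ⟨_, hin⟩
  refine ⟨u + 1, fun y => ⟨fun hy => by have := hu' y hy; omega, fun hy => ?_⟩⟩
  have hall : ∀ k : ℕ, filled s (2, 0, u - k) := by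
    intro k
    induction k with
    | zero => simpa using hu
    | succ k ih => have := h.y ih; push_cast; convert this using 3; ring
  have := hall (u - y).toNat
  rwa [show u - ((u - y).toNat : ℤ) = y by omega] at this

theorem exists_diagram {s : Finset RBox} (f : ℕ → ℕ → RBox)
    (hf : ∀ i k i' k', f i k = f i' k' → i = i' ∧ k = k')
    (hx : ∀ i k, f (i + 1) k ∈ s → f i k ∈ s) (hy : ∀ i k, f i (k + 1) ∈ s → f i k ∈ s) :
    ∃ l : YoungDiagram, ∀ i k, f i k ∈ s ↔ (i, k) ∈ l := by
  have hinj : Set.InjOn (fun c : ℕ × ℕ => f c.1 c.2) ((fun c : ℕ × ℕ => f c.1 c.2) ⁻¹' (s : Set _)) :=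
    fun a _ b _ hab => Prod.ext (hf _ _ _ _ hab).1 (hf _ _ _ _ hab).2
  have hx' : ∀ n i k, f (i + n) k ∈ s → f i k ∈ s := by
    intro n
    induction n with
    | zero => intro i k h; exact h
    | succ n ih => intro i k h; exact ih i k (hx _ _ (by rwa [← add_assoc] at h))
  have hy' : ∀ n i k, f i (k + n) ∈ s → f i k ∈ s := by
    intro n
    induction n with
    | zero => intro i k h; exact h
    | succ n ih => intro i k h; exact ih i k (hy _ _ (by rwa [← add_assoc] at h))
  refine ⟨⟨s.preimage _ hinj, ?_⟩, fun i k => by simp [← YoungDiagram.mem_cells]⟩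
  rintro ⟨i, k⟩ ⟨i', k'⟩ hle hmem
  simp only [Finset.coe_preimage, Set.mem_preimage, Finset.mem_coe] at hmem ⊢
  obtain ⟨h1, h2⟩ : i' ≤ i ∧ k' ≤ k := hle
  obtain ⟨a, rfl⟩ := Nat.exists_eq_add_of_le h1
  obtain ⟨b, rfl⟩ := Nat.exists_eq_add_of_le h2
  exact hx' a i' k' (hy' b _ k' hmem)

/-- An ideal splits along the three families: in the two quadrants it gives finite lower sets, i.e.
Young diagrams, and in the tower column a half-line whose end is the integer of the state. -/
theorem mem_states_iff (lq ld μ ν : ℂ) (s : Finset RBox) :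
    s ∈ (relaxedData lq ld μ ν).states ↔ Lower s := by
  constructor
  · rintro ⟨l, m, n, rfl⟩
    exact lower_relaxedState l m n
  · intro h
    obtain ⟨n, hn⟩ := exists_tower_height h
    obtain ⟨l, hl⟩ := exists_diagram (s := s) RBox.low (by intro i k i' k' h; simpa using h)
      (fun i k hm => filled_low_nat.1 ((h 0 i k).1
        (by exact_mod_cast filled_low_nat.2 hm)))
      (fun i k hm => filled_low_nat.1 ((h 0 i k).2
        (by exact_mod_cast filled_low_nat.2 hm)))
    obtain ⟨m, hm⟩ := exists_diagram (s := s) RBox.pedestal (by intro i k i' k' h; simpa using h)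
      (fun i k hm => filled_pedestal_nat.1 ((h 1 i k).1
        (by exact_mod_cast filled_pedestal_nat.2 hm)))
      (fun i k hm => filled_pedestal_nat.1 ((h 1 i k).2
        (by exact_mod_cast filled_pedestal_nat.2 hm)))
    refine ⟨l, m, n, ?_⟩
    ext b
    cases b with
    | low i k => rw [low_mem_relaxedState, hl]
    | pedestal i k => rw [pedestal_mem_relaxedState, hm]
    | tower k =>
      rw [tower_mem_relaxedState]
      have := hn k
      simp only [filled_tower, lt_irrefl, true_and, false_or] at this
      by_cases hk : 0 ≤ k <;> simp only [hk, iff_true, iff_false] at this <;> grind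

/-! ### Corners of an ideal and the six-term sum. -/

open Classical in
/-- The indicator function of the extended order ideal. -/
noncomputable def chi (s : Finset RBox) (a : Pt) : ℤ := if filled s a then 1 else 0

/-- Translation of a lattice point. -/
def Pt.shift (a : Pt) (x y : ℤ) : Pt := (a.1, a.2.1 + x, a.2.2 + y)

/-- The order of the `ℓ`-weight of `s` at a lattice point. -/
noncomputable def cornerOrd (s : Finset RBox) (a : Pt) : ℤ :=
  chi s (a.shift 0 1) + chi s (a.shift 1 0) + chi s (a.shift (-1) (-1))
    - chi s (a.shift 0 (-1)) - chi s (a.shift (-1) 0) - chi s (a.shift 1 1)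

/-- The lattice points directly below `a` are filled. -/
def LowFull (s : Finset RBox) (a : Pt) : Prop :=
  filled s (a.shift (-1) 0) ∧ filled s (a.shift 0 (-1)) ∧ filled s (a.shift (-1) (-1))

/-- The lattice points directly above `a` are not filled. -/
def UpFree (s : Finset RBox) (a : Pt) : Prop :=
  ¬ filled s (a.shift 1 0) ∧ ¬ filled s (a.shift 0 1) ∧ ¬ filled s (a.shift 1 1)

theorem Lower.shift_x {s : Finset RBox} (h : Lower s) (a : Pt) (x y : ℤ)
    (hf : filled s (a.shift (x + 1) y)) : filled s (a.shift x y) :=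
  (h a.1 (a.2.1 + x) (a.2.2 + y)).1 (by simpa [Pt.shift, add_assoc] using hf)

theorem Lower.shift_y {s : Finset RBox} (h : Lower s) (a : Pt) (x y : ℤ)
    (hf : filled s (a.shift x (y + 1))) : filled s (a.shift x y) :=
  (h a.1 (a.2.1 + x) (a.2.2 + y)).2 (by simpa [Pt.shift, add_assoc] using hf)

@[simp] theorem Pt.shift_zero (a : Pt) : a.shift 0 0 = a := by simp [Pt.shift]

theorem Pt.shift_shift (a : Pt) (x y x' y' : ℤ) :
    (a.shift x y).shift x' y' = a.shift (x + x') (y + y') := by simp [Pt.shift, add_assoc]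

theorem Pt.shift_inj {a : Pt} {x y x' y' : ℤ} : a.shift x y = a.shift x' y' ↔ x = x' ∧ y = y' := by
  simp [Pt.shift]

theorem Pt.shift_eq_iff {a b : Pt} {x y : ℤ} : a.shift x y = b ↔ a = b.shift (-x) (-y) := by
  obtain ⟨c, u, v⟩ := a
  obtain ⟨c', u', v'⟩ := b
  simp only [Pt.shift, Prod.mk.injEq]
  constructor <;> rintro ⟨h1, h2, h3⟩ <;> refine ⟨h1, ?_, ?_⟩ <;> omega

theorem Lower.lowFull_of_filled {s : Finset RBox} (h : Lower s) {a : Pt} (ha : filled s a) :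
    LowFull s a := by
  have h1 : filled s (a.shift (-1) 0) := h.shift_x a _ _ (by simpa using ha)
  have h2 : filled s (a.shift 0 (-1)) := h.shift_y a _ _ (by simpa using ha)
  exact ⟨h1, h2, h.shift_x a _ _ (by simpa using h2)⟩

theorem Lower.upFree_of_not_filled {s : Finset RBox} (h : Lower s) {a : Pt} (ha : ¬ filled s a) :
    UpFree s a := by
  have h1 : ¬ filled s (a.shift 1 0) := fun h' => ha (by simpa using h.shift_x a 0 0 h')
  have h2 : ¬ filled s (a.shift 0 1) := fun h' => ha (by simpa using h.shift_y a 0 0 h')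
  exact ⟨h1, h2, fun h' => h1 (h.shift_y a 1 0 h')⟩

theorem cornerOrd_of_corner {s : Finset RBox} {a : Pt} (h1 : LowFull s a) (h2 : UpFree s a) :
    cornerOrd s a = -1 := by
  simp [cornerOrd, chi, h1.1, h1.2.1, h1.2.2, h2.1, h2.2.1, h2.2.2]

/-- The order of the `ℓ`-weight of a state is at least `-1`, with equality at the corners only. -/
theorem Lower.cornerOrd {s : Finset RBox} (h : Lower s) (a : Pt) :
    -1 ≤ cornerOrd s a ∧ (cornerOrd s a = -1 → LowFull s a ∧ UpFree s a) := by
  -- These are the covering relations along (−1,−1) ≤ (−1,0), (0,−1) ≤ a ≤ (1,0), (0,1) ≤ (1,1). In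
  -- an ideal the upper part χ(0,1) + χ(1,0) − χ(1,1) is at least 0, with equality when all three
  -- points are empty. The lower part χ(−1,0) + χ(0,−1) − χ(−1,−1) is at most 1, with equality when
  -- all three are filled.
  have h1 := h.shift_x a (-1) (-1)
  have h2 := h.shift_y a (-1) (-1)
  have h3 := h.shift_x a (-1) 0
  have h4 := h.shift_y a 0 (-1)
  have h5 := h.shift_x a 0 0
  have h6 := h.shift_y a 0 0
  have h7 := h.shift_x a 0 1
  have h8 := h.shift_y a 1 0
  norm_num at h1 h2 h3 h4 h5 h6 h7 h8
  unfold ToroidalGl2.cornerOrd LowFull UpFree chi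
  split_ifs <;> simp_all

/-- A corner is the point of a box. -/
theorem exists_box_of_corner {s : Finset RBox} {a : Pt} (h1 : LowFull s a) (h2 : UpFree s a) :
    ∃ b : RBox, b.pt = a := by
  by_contra h
  push Not at h
  obtain ⟨c, x, y⟩ := a
  obtain ⟨hl1, hl2, -⟩ := h1
  obtain ⟨hu1, hu2, -⟩ := h2
  fin_cases c
  -- In a quadrant, emptiness at (x+1, y) forces y ≥ 0 and emptiness at (x, y+1) forces x ≥ 0.
  · change filled s (0, x + 0, y + -1) at hl2
    change ¬ filled s (0, x + 1, y + 0) at hu1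
    change ¬ filled s (0, x + 0, y + 1) at hu2
    rw [filled_low] at hu1 hu2
    push Not at hu1 hu2
    exact h (RBox.low x.toNat y.toNat) (by simp [RBox.pt]; omega)
  · change ¬ filled s (1, x + 1, y + 0) at hu1
    change ¬ filled s (1, x + 0, y + 1) at hu2
    rw [filled_pedestal] at hu1 hu2
    push Not at hu1 hu2
    exact h (RBox.pedestal x.toNat y.toNat) (by simp [RBox.pt]; omega)
  -- In the tower family a filled point has x ≤ 0 and an empty one has x ≥ 0, so only the column x =
  -- 0 remains.
  · change filled s (2, x + 0, y + -1) at hl2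
    change ¬ filled s (2, x + 0, y + 1) at hu2
    rw [filled_tower] at hl2 hu2
    push Not at hu2
    exact h (RBox.tower y) (by simp [RBox.pt]; omega)

/-- Filling a point can break the ideal condition only against its lower neighbours; the diagonal
one is implied by the other two. -/
theorem Lower.toggle_iff_of_not_filled {s : Finset RBox} (h : Lower s) {b : RBox}
    (hb : ¬ filled s b.pt) : Lower (toggle s b) ↔ LowFull s b.pt := by
  constructor
  · intro h'
    have := h'.lowFull_of_filled ((filled_toggle_self s b).2 hb)
    unfold LowFull at this ⊢
    rwa [filled_toggle_of_ne, filled_toggle_of_ne, filled_toggle_of_ne] at this <;>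
      · rw [Ne, Pt.shift_eq_iff, ← Pt.shift_zero b.pt, Pt.shift_shift, Pt.shift_inj]; simp
  · intro hl c x y
    have key : ∀ a' : Pt, filled (toggle s b) a' → a' = b.pt ∨ filled s a' := by
      intro a' h'
      by_cases ha : a' = b.pt
      · exact Or.inl ha
      · exact Or.inr ((filled_toggle_of_ne s ha).1 h')
    have back : ∀ a' : Pt, filled s a' → filled (toggle s b) a' := by
      intro a' h'
      rw [filled_toggle_of_ne]
      · exact h'
      · rintro rfl; exact hb h'
    constructor
    · intro h'
      rcases key _ h' with h1 | h1
      · have := hl.1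
        rw [← h1] at this
        exact back _ (by simpa [Pt.shift] using this)
      · exact back _ ((h c x y).1 h1)
    · intro h'
      rcases key _ h' with h1 | h1
      · have := hl.2.1
        rw [← h1] at this
        exact back _ (by simpa [Pt.shift] using this)
      · exact back _ ((h c x y).2 h1)

theorem Lower.toggle_iff_of_filled {s : Finset RBox} (h : Lower s) {b : RBox}
    (hb : filled s b.pt) : Lower (toggle s b) ↔ UpFree s b.pt := by
  constructor
  · intro h'
    have := h'.upFree_of_not_filled (a := b.pt) (by rw [filled_toggle_self]; exact not_not.2 hb)
    unfold UpFree at this ⊢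
    rwa [filled_toggle_of_ne, filled_toggle_of_ne, filled_toggle_of_ne] at this <;>
      · rw [Ne, Pt.shift_eq_iff, ← Pt.shift_zero b.pt, Pt.shift_shift, Pt.shift_inj]; simp
  · intro hl c x y
    have key : ∀ a' : Pt, filled (toggle s b) a' → filled s a' := by
      intro a' h'
      by_cases ha : a' = b.pt
      · exact ha ▸ hb
      · exact (filled_toggle_of_ne s ha).1 h'
    have back : ∀ a' : Pt, a' ≠ b.pt → filled s a' → filled (toggle s b) a' := by
      intro a' h1 h'
      rwa [filled_toggle_of_ne s h1]
    constructor
    · intro h'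
      have h1 := key _ h'
      refine back _ ?_ ((h c x y).1 h1)
      intro h2
      have := hl.1
      rw [← h2] at this
      exact this (by simpa [Pt.shift] using h1)
    · intro h'
      have h1 := key _ h'
      refine back _ ?_ ((h c x y).2 h1)
      intro h2
      have := hl.2.1
      rw [← h2] at this
      exact this (by simpa [Pt.shift] using h1)

/-- The order on boxes in terms of the lattice points. -/
theorem RBox.lt_of_fst_eq {b c : RBox} (h : b < c) (hf : b.pt.1 = c.pt.1) :
    b.pt.2.2 < c.pt.2.2 ∨ (b.pt.2.2 = c.pt.2.2 ∧ b.pt.2.1 < c.pt.2.1) := by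
  have h' : b.key < c.key := h
  cases b <;> cases c <;> simp [RBox.pt, RBox.key, Prod.Lex.toLex_lt_toLex] at hf h' ⊢ <;> omega

/-- The linear order refines the order of each lattice: the three upper neighbours (1,0), (0,1),
(1,1) come later and the three lower ones come earlier. -/
theorem RBox.lt_shift {b c : RBox} (h : b < c) {x y : ℤ} (hc : c.pt = b.pt.shift x y) :
    0 < y ∨ (y = 0 ∧ 0 < x) := by
  have := RBox.lt_of_fst_eq h (by rw [hc]; rfl)
  rw [hc] at this
  simp only [Pt.shift] at this
  omega

theorem RBox.lt_shift' {b c : RBox} (h : b < c) {x y : ℤ} (hb : b.pt = c.pt.shift x y) :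
    y < 0 ∨ (y = 0 ∧ x < 0) := by
  have := RBox.lt_of_fst_eq h (by rw [hb]; rfl)
  rw [hb] at this
  simp only [Pt.shift] at this
  omega

end ToroidalGl2

namespace ToroidalGl2

/-! ### Positions of lattice points and the divisors of the functions A. -/

noncomputable section Positions

/-- The genericity assumptions on the parameters. -/
structure GenericData (lq ld μ ν : ℂ) : Prop where
  params : GenericParameters lq ld
  mu : GenericExponent lq ld μ
  nu : GenericExponent lq ld ν
  mu_nu : GenericExponent lq ld (μ + ν)

variable (lq ld μ ν : ℂ)

theorem q1_eq : q1 lq ld = Complex.exp (ld - lq) := by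
  rw [q1, q, d, ← Complex.exp_neg, ← Complex.exp_add]; congr 1; ring

theorem q2_eq : q2 lq = Complex.exp (2 * lq) := by
  rw [q2, q, ← Complex.exp_nat_mul]; norm_num

theorem q3_eq : q3 lq ld = Complex.exp (-lq - ld) := by
  rw [q3, q, d, ← Complex.exp_neg, ← Complex.exp_neg, ← Complex.exp_add]; congr 1

theorem q1_ne_zero : q1 lq ld ≠ 0 := by rw [q1_eq]; exact Complex.exp_ne_zero _

theorem q2_ne_zero : q2 lq ≠ 0 := by rw [q2_eq]; exact Complex.exp_ne_zero _

theorem q3_ne_zero : q3 lq ld ≠ 0 := by rw [q3_eq]; exact Complex.exp_ne_zero _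

theorem q1_mul_q2_mul_q3 : q1 lq ld * q2 lq * q3 lq ld = 1 := by
  rw [q1_eq, q2_eq, q3_eq, ← Complex.exp_add, ← Complex.exp_add, ← Complex.exp_zero]
  congr 1
  ring

/-- Logarithm of the position of the point `(0, 0)` of a family. -/
def logBase : Fin 3 → ℂ
  | 0 => lq + ld
  | 1 => -μ * (2 * lq) - (ld - lq)
  | 2 => -(μ + ν) * (2 * lq)

/-- Logarithm of the position of a lattice point. -/
def logPos (a : Pt) : ℂ := logBase lq ld μ ν a.1 - a.2.1 * (ld - lq) - a.2.2 * (2 * lq)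

/-- The position of a lattice point. -/
def posPt (a : Pt) : ℂ := Complex.exp (logPos lq ld μ ν a)

theorem posPt_ne_zero (a : Pt) : posPt lq ld μ ν a ≠ 0 := Complex.exp_ne_zero _

theorem posPt_shift (a : Pt) (x y : ℤ) :
    posPt lq ld μ ν (a.shift x y) = posPt lq ld μ ν a * q1 lq ld ^ (-x) * q2 lq ^ (-y) := by
  rw [posPt, posPt, q1_eq, q2_eq, ← Complex.exp_int_mul, ← Complex.exp_int_mul, ← Complex.exp_add,
    ← Complex.exp_add]
  congr 1
  simp only [logPos, Pt.shift]
  push_cast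
  ring

variable {lq ld μ ν}

theorem GenericExponent.exp_ne {s : ℂ} (h : GenericExponent lq ld s) (m n : ℤ) {z w : ℂ}
    (hz : z - w = s * (2 * lq) - m * (ld - lq) - n * (2 * lq)) :
    Complex.exp z ≠ Complex.exp w := by
  intro he
  apply h m n
  rw [q2Pow, q1_eq, q2_eq, ← Complex.exp_int_mul, ← Complex.exp_int_mul, ← Complex.exp_add,
    show s * (2 * lq) = (z - w) + (m * (ld - lq) + n * (2 * lq)) by rw [hz]; ring, Complex.exp_add,
    Complex.exp_sub, he, div_self (Complex.exp_ne_zero _), one_mul]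

/-- In terms of log q and log d the combination is (2n − m) log q + m log d, to which genericity
applies. -/
theorem GenericParameters.int_eq_zero (h : GenericParameters lq ld) (m n : ℤ) {z w : ℂ}
    (hz : z - w = m * (ld - lq) + n * (2 * lq)) (he : Complex.exp z = Complex.exp w) :
    m = 0 ∧ n = 0 := by
  have := h (2 * n - m) m (by
    push_cast
    rw [show (2 * (n : ℂ) - m) * lq + m * ld = z - w by rw [hz]; ring, Complex.exp_sub, he,
      div_self (Complex.exp_ne_zero _)])
  obtain ⟨h1, h2⟩ := this
  have h3 : m = 0 := by exact_mod_cast h2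
  subst h3
  refine ⟨rfl, ?_⟩
  have : (2 * n : ℚ) = 0 := by simpa using h1
  have h4 : n = 0 := by exact_mod_cast (by linarith : (n : ℚ) = 0)
  exact h4

/-- Points of one family are separated by genericity of q and d; families 0, 1 by that of μ,
families 0, 2 by that of μ + ν, and families 1, 2 by that of ν. All divisor computations rest on
this. -/
theorem GenericData.posPt_injective (h : GenericData lq ld μ ν) :
    Function.Injective (posPt lq ld μ ν) := by
  rintro ⟨c, x, y⟩ ⟨c', x', y'⟩ he
  have hsame : c = c' → ((c, x, y) : Pt) = (c', x', y') := by
    rintro rfl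
    obtain ⟨h1, h2⟩ := h.params.int_eq_zero (x' - x) (y' - y)
      (by simp only [logPos]; push_cast; ring) he
    simp only [Prod.mk.injEq, true_and]
    omega
  -- The integer corrections here and below compare the base points, using log q₃⁻¹ = log q₁ + log
  -- q₂.
  have h01 : ∀ x y x' y' : ℤ, posPt lq ld μ ν (0, x, y) ≠ posPt lq ld μ ν (1, x', y') :=
    fun x y x' y' => h.mu.exp_ne (x - x' - 2) (y - y' - 1)
      (by simp only [logPos, logBase]; push_cast; ring)
  have h02 : ∀ x y x' y' : ℤ, posPt lq ld μ ν (0, x, y) ≠ posPt lq ld μ ν (2, x', y') :=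
    fun x y x' y' => h.mu_nu.exp_ne (x - x' - 1) (y - y' - 1)
      (by simp only [logPos, logBase]; push_cast; ring)
  have h12 : ∀ x y x' y' : ℤ, posPt lq ld μ ν (1, x, y) ≠ posPt lq ld μ ν (2, x', y') :=
    fun x y x' y' => h.nu.exp_ne (x - x' + 1) (y - y')
      (by simp only [logPos, logBase]; push_cast; ring)
  fin_cases c <;> fin_cases c'
  · exact hsame rfl
  · exact absurd he (h01 _ _ _ _)
  · exact absurd he (h02 _ _ _ _)
  · exact absurd he.symm (h01 _ _ _ _)
  · exact hsame rfl
  · exact absurd he (h12 _ _ _ _)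
  · exact absurd he.symm (h02 _ _ _ _)
  · exact absurd he.symm (h12 _ _ _ _)
  · exact hsame rfl

variable (lq ld μ ν)

theorem q2_mul_posPt (a : Pt) : q2 lq * posPt lq ld μ ν a = posPt lq ld μ ν (a.shift 0 (-1)) := by
  rw [posPt_shift]; simp [mul_comm]

theorem posPt_div_q2 (a : Pt) : posPt lq ld μ ν a / q2 lq = posPt lq ld μ ν (a.shift 0 1) := by
  rw [posPt_shift]; simp [div_eq_mul_inv]

theorem q1_mul_posPt (a : Pt) : q1 lq ld * posPt lq ld μ ν a = posPt lq ld μ ν (a.shift (-1) 0) := by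
  rw [posPt_shift]; simp [mul_comm]

theorem posPt_div_q1 (a : Pt) : posPt lq ld μ ν a / q1 lq ld = posPt lq ld μ ν (a.shift 1 0) := by
  rw [posPt_shift]; simp [div_eq_mul_inv]

/-- By q₁q₂q₃ = 1, multiplication by q₃ is a diagonal step; this is why two integer coordinates
suffice. -/
theorem q3_mul_posPt (a : Pt) : q3 lq ld * posPt lq ld μ ν a = posPt lq ld μ ν (a.shift 1 1) := by
  have h1 := q1_ne_zero lq ld
  have h2 := q2_ne_zero lq
  rw [posPt_shift]
  simp only [zpow_neg, zpow_one]
  field_simp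
  linear_combination posPt lq ld μ ν a * q1_mul_q2_mul_q3 lq ld

theorem posPt_div_q3 (a : Pt) :
    posPt lq ld μ ν a / q3 lq ld = posPt lq ld μ ν (a.shift (-1) (-1)) := by
  rw [div_eq_iff (q3_ne_zero lq ld), mul_comm, q3_mul_posPt, Pt.shift_shift]
  simp

theorem pos_eq (b : RBox) : (relaxedData lq ld μ ν).pos lq ld b = posPt lq ld μ ν b.pt := by
  unfold CombinatorialData.pos posPt q1Pow q2Pow q3Pow
  rw [← Complex.exp_add, ← Complex.exp_add]
  congr 1
  cases b <;> simp [relaxedData, logPos, logBase, RBox.pt] <;> ring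

theorem color_eq (b : RBox) : (relaxedData lq ld μ ν).color b = b.pt.col := by
  cases b <;> simp [relaxedData, Pt.col, RBox.pt]

theorem neg_eq (b : RBox) : (relaxedData lq ld μ ν).neg b = b.isNeg := by
  cases b <;> simp [relaxedData, RBox.isNeg]

theorem Pt.col_shift (a : Pt) (x y : ℤ) : (a.shift x y).col = a.col + x := by
  unfold Pt.col Pt.shift
  split_ifs <;> push_cast <;> ring

theorem Pt.col_shift_even (a : Pt) (y : ℤ) : (a.shift 0 y).col = a.col := by
  simp [Pt.col_shift]

theorem Pt.col_shift_one (a : Pt) (y : ℤ) : (a.shift 1 y).col = a.col + 1 := by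
  simp [Pt.col_shift]

theorem Pt.col_shift_neg_one (a : Pt) (y : ℤ) : (a.shift (-1) y).col = a.col + 1 := by
  rw [Pt.col_shift]
  push_cast
  rw [show (-1 : ZMod 2) = 1 from rfl]

theorem ZMod.two_ne_iff (i j : ZMod 2) : i ≠ j ↔ i = j + 1 := by
  revert i j; decide

theorem ZMod.two_add_one_ne (i : ZMod 2) : i + 1 ≠ i := by
  revert i; decide

theorem rootA_same (j : ZMod 2) (a : Pt) : rootA lq ld j (posPt lq ld μ ν a) j =
    RatFunc.C (q2 lq) * (lin (posPt lq ld μ ν (a.shift 0 1)) /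
      lin (posPt lq ld μ ν (a.shift 0 (-1)))) := by
  rw [rootA, if_pos rfl, ← posPt_div_q2, ← q2_mul_posPt, lin, lin, ← mul_div_assoc, mul_sub,
    ← map_mul, mul_div_cancel₀ _ (q2_ne_zero lq)]

theorem rootA_diff {i j : ZMod 2} (hij : i ≠ j) (a : Pt) : rootA lq ld j (posPt lq ld μ ν a) i =
    RatFunc.C (q1 lq ld * q3 lq ld) *
      ((lin (posPt lq ld μ ν (a.shift 1 0)) / lin (posPt lq ld μ ν (a.shift (-1) 0))) *
      (lin (posPt lq ld μ ν (a.shift (-1) (-1))) / lin (posPt lq ld μ ν (a.shift 1 1)))) := by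
  rw [rootA, if_neg hij, ← posPt_div_q1, ← q1_mul_posPt, ← posPt_div_q3, ← q3_mul_posPt]
  have h1 : ∀ r p : ℂ, r ≠ 0 → RatFunc.C r * RatFunc.X - RatFunc.C p = RatFunc.C r * lin (p / r) :=
    fun r p hr => by rw [lin, mul_sub, ← map_mul, mul_div_cancel₀ _ hr]
  rw [h1 _ _ (q1_ne_zero lq ld), h1 _ _ (q3_ne_zero lq ld), map_mul RatFunc.C (q1 lq ld) (q3 lq ld),
    div_mul_div_comm]
  change _ / (lin _ * lin _) = _
  ring

/-- At infinity the component of its own colour is q₂ and the other is q₁q₃ = q₂⁻¹. The two being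
inverse is why boxes do not affect the level. -/
theorem balancedData_rootA (i j : ZMod 2) (a : Pt) :
    BalancedData (rootA lq ld j (posPt lq ld μ ν a) i)
      (if i = j then q2 lq else (q2 lq)⁻¹)⁻¹ (if i = j then q2 lq else (q2 lq)⁻¹) := by
  have h1 := q1_ne_zero lq ld
  have h2 := q2_ne_zero lq
  have h3 := q3_ne_zero lq ld
  have h123 := q1_mul_q2_mul_q3 lq ld
  have hp := posPt_ne_zero lq ld μ ν
  have hpa := hp a
  split_ifs with hij
  · subst hij
    rw [rootA_same]
    convert (BalancedData.const h2).mul (BalancedData.lin_div_lin (hp _) (hp _)) using 1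
    · rw [← posPt_div_q2, ← q2_mul_posPt]; field_simp
    · ring
  · rw [rootA_diff _ _ _ _ hij]
    convert (BalancedData.const (mul_ne_zero h1 h3)).mul
      ((BalancedData.lin_div_lin (hp _) (hp _)).mul (BalancedData.lin_div_lin (hp _) (hp _))) using 1
    · rw [← posPt_div_q1, ← q1_mul_posPt, ← posPt_div_q3, ← q3_mul_posPt]
      field_simp
      linear_combination h123
    · field_simp; linear_combination -h123

theorem rootA_ne_zero (i j : ZMod 2) (a : Pt) : rootA lq ld j (posPt lq ld μ ν a) i ≠ 0 :=
  (balancedData_rootA lq ld μ ν i j a).ne_zero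

/-- The order of `A_p` at the lattice point `a`, in the component of the colour of `a`. -/
def ordA (p a : Pt) : ℤ :=
  (if p = a.shift 0 (-1) then 1 else 0) - (if p = a.shift 0 1 then 1 else 0)
    + (if p = a.shift (-1) 0 then 1 else 0) + (if p = a.shift 1 1 then 1 else 0)
    - (if p = a.shift 1 0 then 1 else 0) - (if p = a.shift (-1) (-1) then 1 else 0)

theorem ordAt_div' (z : ℂ) (a b : ℂ) :
    ordAt z (lin a / lin b) = (if z = a then 1 else 0) - (if z = b then 1 else 0) := by
  rw [div_eq_mul_inv, ordAt_mul _ (lin_ne_zero _) (inv_ne_zero (lin_ne_zero _)), ordAt_inv,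
    ordAt_lin, ordAt_lin, sub_eq_add_neg]

theorem lin_div_ne_zero (a b : ℂ) : lin a / lin b ≠ 0 :=
  div_ne_zero (lin_ne_zero _) (lin_ne_zero _)

theorem C_ne_zero {c : ℂ} (hc : c ≠ 0) : RatFunc.C c ≠ 0 := (map_ne_zero RatFunc.C).2 hc

theorem ordAt_rootA_not (z : ℂ) (hz : ∀ a, posPt lq ld μ ν a ≠ z) (i j : ZMod 2) (p : Pt) :
    ordAt z (rootA lq ld j (posPt lq ld μ ν p) i) = 0 := by
  have hz' : ∀ a, z ≠ posPt lq ld μ ν a := fun a => (hz a).symm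
  by_cases hij : i = j
  · subst hij
    rw [rootA_same, ordAt_mul _ (C_ne_zero (q2_ne_zero lq)) (lin_div_ne_zero _ _), ordAt_C,
      ordAt_div']
    simp [hz']
  · rw [rootA_diff _ _ _ _ hij, ordAt_mul _
      (C_ne_zero (mul_ne_zero (q1_ne_zero lq ld) (q3_ne_zero lq ld)))
      (mul_ne_zero (lin_div_ne_zero _ _) (lin_div_ne_zero _ _)), ordAt_C,
      ordAt_mul _ (lin_div_ne_zero _ _) (lin_div_ne_zero _ _), ordAt_div', ordAt_div']
    simp [hz']

theorem Pt.eq_shift_iff {a p : Pt} {x y : ℤ} : a = p.shift x y ↔ p = a.shift (-x) (-y) := by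
  rw [eq_comm, Pt.shift_eq_iff]

variable {lq ld μ ν}

/-- The own-colour component has its divisor at the vertical neighbours of p, which share its
colour. The other component has its divisor at neighbours one step away in x, of the opposite
colour. So component i only sees points of colour i. -/
theorem GenericData.ordAt_rootA (h : GenericData lq ld μ ν) (i : ZMod 2) (p a : Pt) :
    ordAt (posPt lq ld μ ν a) (rootA lq ld p.col (posPt lq ld μ ν p) i) =
      if a.col = i then ordA p a else 0 := by
  have hinj : ∀ a b, posPt lq ld μ ν a = posPt lq ld μ ν b ↔ a = b :=
    fun a b => h.posPt_injective.eq_iff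
  have e0 : ∀ y, p = a.shift 0 y → p.col = a.col := fun y hp => by rw [hp, Pt.col_shift_even]
  have e1 : ∀ y, p = a.shift 1 y → p.col = a.col + 1 := fun y hp => by rw [hp, Pt.col_shift_one]
  have e2 : ∀ y, p = a.shift (-1) y → p.col = a.col + 1 := fun y hp => by
    rw [hp, Pt.col_shift_neg_one]
  by_cases hij : i = p.col
  · subst hij
    rw [rootA_same, ordAt_mul _ (C_ne_zero (q2_ne_zero lq)) (lin_div_ne_zero _ _), ordAt_C,
      ordAt_div']
    simp only [hinj, Pt.eq_shift_iff (a := a), neg_zero, neg_neg, zero_add]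
    by_cases hc : a.col = p.col
    · have hc' : p.col ≠ a.col + 1 := by rw [← hc]; exact (ZMod.two_add_one_ne _).symm
      rw [if_pos hc, ordA]
      simp only [if_neg (fun h => hc' (e1 _ h)), if_neg (fun h => hc' (e2 _ h))]
      ring
    · rw [if_neg hc]
      simp only [if_neg (fun h => hc (e0 _ h).symm)]
      ring
  · rw [rootA_diff _ _ _ _ hij, ordAt_mul _
      (C_ne_zero (mul_ne_zero (q1_ne_zero lq ld) (q3_ne_zero lq ld)))
      (mul_ne_zero (lin_div_ne_zero _ _) (lin_div_ne_zero _ _)), ordAt_C,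
      ordAt_mul _ (lin_div_ne_zero _ _) (lin_div_ne_zero _ _), ordAt_div', ordAt_div']
    simp only [hinj, Pt.eq_shift_iff (a := a), neg_zero, neg_neg, zero_add]
    by_cases hc : a.col = i
    · have hc' : p.col ≠ a.col := by rw [hc]; exact fun h => hij h.symm
      rw [if_pos hc, ordA]
      simp only [if_neg (fun h => hc' (e0 _ h))]
      ring
    · have hc' : p.col ≠ a.col + 1 := by
        exact (by decide : ∀ u v w : ZMod 2, ¬u = v → ¬v = w → w ≠ u + 1) _ _ _ hc hij
      rw [if_neg hc]
      simp only [if_neg (fun h => hc' (e1 _ h)), if_neg (fun h => hc' (e2 _ h))]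
      ring

end Positions

end ToroidalGl2

namespace ToroidalGl2

/-! ### The divisor of the weight of a state, and its values at zero and infinity. -/

noncomputable section Weights

variable (lq ld μ ν : ℂ)

theorem qPow_ne_zero (s : ℂ) : qPow lq s ≠ 0 := Complex.exp_ne_zero _

theorem relaxedPsi_zero : relaxedPsi lq ld μ ν 0 = RatFunc.C (q3 lq ld * qPow lq (-μ - 2 * ν)) *
    ((lin (posPt lq ld μ ν (0, -1, -1)) / lin (posPt lq ld μ ν (2, 0, 0))) *
      (lin (posPt lq ld μ ν (1, -1, -1)) / lin (posPt lq ld μ ν (2, 0, -1)))) := by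
  have e1 : q3 lq ld ^ (-2 : ℤ) = posPt lq ld μ ν (0, -1, -1) := by
    rw [q3_eq, ← Complex.exp_int_mul, posPt]
    congr 1; simp only [logPos, logBase]; push_cast; ring
  have e2 : q2Pow lq (-μ + 1) = posPt lq ld μ ν (1, -1, -1) := by
    rw [q2Pow, posPt]
    congr 1; simp only [logPos, logBase]; push_cast; ring
  have e3 : q2Pow lq (-μ - ν) = posPt lq ld μ ν (2, 0, 0) := by
    rw [q2Pow, posPt]
    congr 1; simp only [logPos, logBase]; push_cast; ring
  have e4 : q2Pow lq (-μ - ν + 1) = posPt lq ld μ ν (2, 0, -1) := by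
    rw [q2Pow, posPt]
    congr 1; simp only [logPos, logBase]; push_cast; ring
  rw [relaxedPsi, if_pos rfl, e1, e2, e3, e4, div_mul_div_comm]

theorem relaxedPsi_one : relaxedPsi lq ld μ ν 1 = RatFunc.C (qPow lq (μ + 2 * ν)) *
    ((lin (posPt lq ld μ ν (2, -1, -1)) / lin (posPt lq ld μ ν (0, 0, 0))) *
      (lin (posPt lq ld μ ν (2, 1, 0)) / lin (posPt lq ld μ ν (1, 0, 0)))) := by
  have e1 : (q3 lq ld)⁻¹ * q2Pow lq (-μ - ν) = posPt lq ld μ ν (2, -1, -1) := by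
    rw [q3_eq, ← Complex.exp_neg, q2Pow, ← Complex.exp_add, posPt]
    congr 1; simp only [logPos, logBase]; push_cast; ring
  have e2 : (q1 lq ld)⁻¹ * q2Pow lq (-μ - ν) = posPt lq ld μ ν (2, 1, 0) := by
    rw [q1_eq, ← Complex.exp_neg, q2Pow, ← Complex.exp_add, posPt]
    congr 1; simp only [logPos, logBase]; push_cast; ring
  have e3 : (q3 lq ld)⁻¹ = posPt lq ld μ ν (0, 0, 0) := by
    rw [q3_eq, ← Complex.exp_neg, posPt]
    congr 1; simp only [logPos, logBase]; push_cast; ring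
  have e4 : (q1 lq ld)⁻¹ * q2Pow lq (-μ) = posPt lq ld μ ν (1, 0, 0) := by
    rw [q1_eq, ← Complex.exp_neg, q2Pow, ← Complex.exp_add, posPt]
    congr 1; simp only [logPos, logBase]; push_cast; ring
  rw [relaxedPsi, if_neg (by decide), e1, e2, e3, e4, div_mul_div_comm]

/-- The value at infinity of the `ℓ`-weight of the reference state. -/
def psiInfty (i : ZMod 2) : ℂ :=
  if i = 0 then q3 lq ld * qPow lq (-μ - 2 * ν) else qPow lq (μ + 2 * ν)

/-- The ratios of linear factors tend to 1 at infinity, and at zero they multiply to the inverse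
square of the leading constant; the exponents ∓(μ + 2ν) are chosen for this. -/
theorem balancedData_psi (i : ZMod 2) : BalancedData (relaxedPsi lq ld μ ν i)
    (psiInfty lq ld μ ν i)⁻¹ (psiInfty lq ld μ ν i) := by
  have hp := posPt_ne_zero lq ld μ ν
  obtain rfl | rfl : i = 0 ∨ i = 1 := by revert i; decide
  · rw [relaxedPsi_zero, psiInfty, if_pos rfl]
    have hc : q3 lq ld * qPow lq (-μ - 2 * ν) ≠ 0 :=
      mul_ne_zero (q3_ne_zero lq ld) (qPow_ne_zero lq _)
    convert (BalancedData.const hc).mul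
      ((BalancedData.lin_div_lin (hp _) (hp _)).mul (BalancedData.lin_div_lin (hp _) (hp _))) using 1
    · rw [q3_eq, qPow]
      simp only [posPt, ← Complex.exp_add, ← Complex.exp_sub, ← Complex.exp_neg]
      congr 1; simp only [logPos, logBase]; push_cast; ring
    · ring
  · rw [relaxedPsi_one, psiInfty, if_neg (by decide)]
    have hc : qPow lq (μ + 2 * ν) ≠ 0 := Complex.exp_ne_zero _
    convert (BalancedData.const hc).mul
      ((BalancedData.lin_div_lin (hp _) (hp _)).mul (BalancedData.lin_div_lin (hp _) (hp _))) using 1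
    · rw [qPow]
      simp only [posPt, ← Complex.exp_add, ← Complex.exp_sub, ← Complex.exp_neg]
      congr 1; simp only [logPos, logBase]; push_cast; ring
    · ring

theorem psiInfty_mul : psiInfty lq ld μ ν 0 * psiInfty lq ld μ ν 1 = q3 lq ld := by
  rw [psiInfty, psiInfty, if_pos rfl, if_neg (by decide), mul_assoc, qPow, qPow, ← Complex.exp_add]
  rw [show (-μ - 2 * ν) * lq + (μ + 2 * ν) * lq = 0 by ring, Complex.exp_zero, mul_one]

theorem psiInfty_ne_zero (i : ZMod 2) : psiInfty lq ld μ ν i ≠ 0 := by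
  rw [psiInfty]
  split_ifs
  · exact mul_ne_zero (q3_ne_zero lq ld) (qPow_ne_zero lq _)
  · exact Complex.exp_ne_zero _

/-- The ideal of the empty state consists of complements of quadrants in families 0 and 1, and of x
< 0 together with the negative half of the column x = 0 in family 2. The points where its six-term
sum is non-zero are the zeros and poles of Ψ; in particular (2, 0, 0) can be filled and (2, 0, −1)
can be emptied. -/
theorem cornerOrd_empty (a : Pt) : cornerOrd ∅ a =
    (if a = (0, -1, -1) then 1 else 0) + (if a = (1, -1, -1) then 1 else 0)
    + (if a = (2, -1, -1) then 1 else 0) + (if a = (2, 1, 0) then 1 else 0)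
    - (if a = (0, 0, 0) then 1 else 0) - (if a = (1, 0, 0) then 1 else 0)
    - (if a = (2, 0, 0) then 1 else 0) - (if a = (2, 0, -1) then 1 else 0) := by
  have c0 : ∀ x y, chi ∅ (0, x, y) = if x < 0 ∨ y < 0 then 1 else 0 := fun x y => by
    simp [chi, filled_low]
  have c1 : ∀ x y, chi ∅ (1, x, y) = if x < 0 ∨ y < 0 then 1 else 0 := fun x y => by
    simp [chi, filled_pedestal]
  have c2 : ∀ x y, chi ∅ (2, x, y) = if x < 0 ∨ (x = 0 ∧ y < 0) then 1 else 0 := fun x y => by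
    simp [chi, filled_tower]
  obtain ⟨c, x, y⟩ := a
  fin_cases c
  · change cornerOrd ∅ (0, x, y) = _
    simp only [cornerOrd, Pt.shift, c0]
    simp
    grind (splits := 40)
  · change cornerOrd ∅ (1, x, y) = _
    simp only [cornerOrd, Pt.shift, c1]
    simp
    grind (splits := 40)
  · change cornerOrd ∅ (2, x, y) = _
    simp only [cornerOrd, Pt.shift, c2]
    simp
    grind (splits := 40)

variable {lq ld μ ν}

theorem GenericData.ordAt_psi (h : GenericData lq ld μ ν) (i : ZMod 2) (a : Pt) :
    ordAt (posPt lq ld μ ν a) (relaxedPsi lq ld μ ν i) =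
      if a.col = i then cornerOrd ∅ a else 0 := by
  have hinj : ∀ a b, posPt lq ld μ ν a = posPt lq ld μ ν b ↔ a = b :=
    fun a b => h.posPt_injective.eq_iff
  rw [cornerOrd_empty]
  have z1 : ∀ p : Pt, p.col = 0 → a.col = 1 → a ≠ p := by
    rintro p h1 h2 rfl; rw [h1] at h2; exact absurd h2 (by decide)
  have z0 : ∀ p : Pt, p.col = 1 → a.col = 0 → a ≠ p := by
    rintro p h1 h2 rfl; rw [h1] at h2; exact absurd h2 (by decide)
  have hcol : a.col = 0 ∨ a.col = 1 := by generalize a.col = i; revert i; decide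
  have c1 : Pt.col (0, -1, -1) = 0 := by decide
  have c2 : Pt.col (1, -1, -1) = 0 := by decide
  have c3 : Pt.col (2, -1, -1) = 1 := by decide
  have c4 : Pt.col (2, 1, 0) = 1 := by decide
  have c5 : Pt.col (0, 0, 0) = 1 := by decide
  have c6 : Pt.col (1, 0, 0) = 1 := by decide
  have c7 : Pt.col (2, 0, 0) = 0 := by decide
  have c8 : Pt.col (2, 0, -1) = 0 := by decide
  obtain rfl | rfl : i = 0 ∨ i = 1 := by revert i; decide
  · rw [relaxedPsi_zero, ordAt_mul _
      (C_ne_zero (mul_ne_zero (q3_ne_zero lq ld) (qPow_ne_zero lq _)))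
      (mul_ne_zero (lin_div_ne_zero _ _) (lin_div_ne_zero _ _)), ordAt_C,
      ordAt_mul _ (lin_div_ne_zero _ _) (lin_div_ne_zero _ _), ordAt_div', ordAt_div']
    simp only [hinj]
    rcases hcol with hc | hc
    · rw [if_pos hc]
      simp only [if_neg (z0 _ c3 hc), if_neg (z0 _ c4 hc), if_neg (z0 _ c5 hc),
        if_neg (z0 _ c6 hc)]
      ring
    · rw [if_neg (show ¬ a.col = 0 by rw [hc]; decide)]
      simp only [if_neg (z1 _ c1 hc), if_neg (z1 _ c2 hc), if_neg (z1 _ c7 hc),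
        if_neg (z1 _ c8 hc)]
      ring
  · rw [relaxedPsi_one, ordAt_mul _ (C_ne_zero (qPow_ne_zero lq _))
      (mul_ne_zero (lin_div_ne_zero _ _) (lin_div_ne_zero _ _)), ordAt_C,
      ordAt_mul _ (lin_div_ne_zero _ _) (lin_div_ne_zero _ _), ordAt_div', ordAt_div']
    simp only [hinj]
    rcases hcol with hc | hc
    · rw [if_neg (show ¬ a.col = 1 by rw [hc]; decide)]
      simp only [if_neg (z0 _ c3 hc), if_neg (z0 _ c4 hc), if_neg (z0 _ c5 hc),
        if_neg (z0 _ c6 hc)]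
      ring
    · rw [if_pos hc]
      simp only [if_neg (z1 _ c1 hc), if_neg (z1 _ c2 hc), if_neg (z1 _ c7 hc),
        if_neg (z1 _ c8 hc)]
      ring

theorem ordAt_psi_not (z : ℂ) (hz : ∀ a, posPt lq ld μ ν a ≠ z) (i : ZMod 2) :
    ordAt z (relaxedPsi lq ld μ ν i) = 0 := by
  have hz' : ∀ a, z ≠ posPt lq ld μ ν a := fun a => (hz a).symm
  obtain rfl | rfl : i = 0 ∨ i = 1 := by revert i; decide
  · rw [relaxedPsi_zero, ordAt_mul _
      (C_ne_zero (mul_ne_zero (q3_ne_zero lq ld) (qPow_ne_zero lq _)))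
      (mul_ne_zero (lin_div_ne_zero _ _) (lin_div_ne_zero _ _)), ordAt_C,
      ordAt_mul _ (lin_div_ne_zero _ _) (lin_div_ne_zero _ _), ordAt_div', ordAt_div']
    simp [hz']
  · rw [relaxedPsi_one, ordAt_mul _ (C_ne_zero (qPow_ne_zero lq _))
      (mul_ne_zero (lin_div_ne_zero _ _) (lin_div_ne_zero _ _)), ordAt_C,
      ordAt_mul _ (lin_div_ne_zero _ _) (lin_div_ne_zero _ _), ordAt_div', ordAt_div']
    simp [hz']

/-- `+1` for positive boxes and `-1` for negative boxes. -/
def RBox.sign (b : RBox) : ℤ := if b.isNeg then -1 else 1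

/-- Present positive boxes count +1 and present negative ones −1, which is the change of the
indicator function relative to the empty state. -/
theorem sum_sign (s : Finset RBox) (a : Pt) :
    ∑ b ∈ s, (if b.pt = a then b.sign else 0) = chi s a - chi ∅ a := by
  by_cases h : ∃ c : RBox, c.pt = a
  · obtain ⟨c, rfl⟩ := h
    simp only [RBox.pt_inj, Finset.sum_ite_eq', chi, filled_pt, RBox.sign]
    by_cases h1 : c ∈ s <;> cases h2 : c.isNeg <;> simp [h1]
  · push Not at h
    have h2 : chi s a = chi ∅ a := by
      classical exact if_congr (filled_of_not_box h s ∅) rfl rfl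
    rw [h2, sub_self]
    exact Finset.sum_eq_zero fun b _ => if_neg (h b)

variable (lq ld μ ν)

theorem factor_eq (b : RBox) (i : ZMod 2) : (relaxedData lq ld μ ν).factor lq ld b i =
    if b.isNeg then rootA lq ld b.pt.col (posPt lq ld μ ν b.pt) i
    else (rootA lq ld b.pt.col (posPt lq ld μ ν b.pt) i)⁻¹ := by
  rw [CombinatorialData.factor, neg_eq, color_eq, pos_eq]

theorem factor_ne_zero (b : RBox) (i : ZMod 2) : (relaxedData lq ld μ ν).factor lq ld b i ≠ 0 := by
  rw [factor_eq]
  split_ifs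
  · exact rootA_ne_zero _ _ _ _ _ _ _
  · exact inv_ne_zero (rootA_ne_zero _ _ _ _ _ _ _)

theorem psi_ne_zero (i : ZMod 2) : relaxedPsi lq ld μ ν i ≠ 0 :=
  (balancedData_psi lq ld μ ν i).ne_zero

theorem phi_eq (s : Finset RBox) (i : ZMod 2) : (relaxedData lq ld μ ν).phi lq ld s i =
    relaxedPsi lq ld μ ν i * ∏ b ∈ s, (relaxedData lq ld μ ν).factor lq ld b i := rfl

theorem phi_ne_zero (s : Finset RBox) (i : ZMod 2) : (relaxedData lq ld μ ν).phi lq ld s i ≠ 0 :=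
  mul_ne_zero (psi_ne_zero lq ld μ ν i)
    (Finset.prod_ne_zero_iff.2 fun b _ => factor_ne_zero lq ld μ ν b i)

variable {lq ld μ ν}

theorem GenericData.ordAt_factor (h : GenericData lq ld μ ν) (b : RBox) (i : ZMod 2) (a : Pt) :
    ordAt (posPt lq ld μ ν a) ((relaxedData lq ld μ ν).factor lq ld b i) =
      if a.col = i then -(b.sign * ordA b.pt a) else 0 := by
  rw [factor_eq, RBox.sign]
  split_ifs with h1 h2 h2
  · rw [h.ordAt_rootA, if_pos h2]; ring
  · rw [h.ordAt_rootA, if_neg h2]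
  · rw [ordAt_inv, h.ordAt_rootA, if_pos h2]; ring
  · rw [ordAt_inv, h.ordAt_rootA, if_neg h2]; ring

theorem ordAt_factor_not (z : ℂ) (hz : ∀ a, posPt lq ld μ ν a ≠ z) (b : RBox) (i : ZMod 2) :
    ordAt z ((relaxedData lq ld μ ν).factor lq ld b i) = 0 := by
  rw [factor_eq]
  split_ifs
  · exact ordAt_rootA_not lq ld μ ν z hz _ _ _
  · rw [ordAt_inv, ordAt_rootA_not lq ld μ ν z hz, neg_zero]

/-- A box contributes to the order at a only from one of the six neighbours of a. By `sum_sign` the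
total at each neighbour is χ_s − χ_∅, and the χ_∅ part cancels against the order of Ψ. The set s
need not be a state, which is used for truncations. -/
theorem GenericData.ordAt_phi (h : GenericData lq ld μ ν) (s : Finset RBox) (i : ZMod 2) (a : Pt) :
    ordAt (posPt lq ld μ ν a) ((relaxedData lq ld μ ν).phi lq ld s i) =
      if a.col = i then cornerOrd s a else 0 := by
  rw [phi_eq, ordAt_mul _ (psi_ne_zero lq ld μ ν i) (Finset.prod_ne_zero_iff.2
    fun b _ => factor_ne_zero lq ld μ ν b i), h.ordAt_psi,
    ordAt_prod _ _ _ fun b _ => factor_ne_zero lq ld μ ν b i]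
  simp only [h.ordAt_factor]
  by_cases hc : a.col = i
  · simp only [if_pos hc]
    have key : ∀ b : RBox, -(b.sign * ordA b.pt a) =
        (if b.pt = a.shift 0 1 then b.sign else 0) + (if b.pt = a.shift 1 0 then b.sign else 0)
        + (if b.pt = a.shift (-1) (-1) then b.sign else 0)
        - (if b.pt = a.shift 0 (-1) then b.sign else 0)
        - (if b.pt = a.shift (-1) 0 then b.sign else 0)
        - (if b.pt = a.shift 1 1 then b.sign else 0) := by
      intro b
      rw [ordA]
      simp only [mul_sub, mul_add, mul_ite, mul_one, mul_zero]
      ring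
    simp only [key, Finset.sum_add_distrib, Finset.sum_sub_distrib, sum_sign, cornerOrd]
    ring
  · simp [if_neg hc]

theorem ordAt_phi_not (z : ℂ) (hz : ∀ a, posPt lq ld μ ν a ≠ z) (s : Finset RBox) (i : ZMod 2) :
    ordAt z ((relaxedData lq ld μ ν).phi lq ld s i) = 0 := by
  rw [phi_eq, ordAt_mul _ (psi_ne_zero lq ld μ ν i) (Finset.prod_ne_zero_iff.2
    fun b _ => factor_ne_zero lq ld μ ν b i), ordAt_psi_not z hz,
    ordAt_prod _ _ _ fun b _ => factor_ne_zero lq ld μ ν b i]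
  simp [ordAt_factor_not z hz]

/-- The values at zero and at infinity of the `ℓ`-weight of a state. -/
theorem exists_balancedData_phi (lq ld μ ν : ℂ) (s : Finset RBox) : ∃ u : ℂ, u ≠ 0 ∧ ∀ i : ZMod 2,
    BalancedData ((relaxedData lq ld μ ν).phi lq ld s i)
      (psiInfty lq ld μ ν i * (if i = 0 then u else u⁻¹))⁻¹
      (psiInfty lq ld μ ν i * (if i = 0 then u else u⁻¹)) := by
  have h2 := q2_ne_zero lq
  have step : ∀ b : RBox, ∃ u : ℂ, u ≠ 0 ∧ ∀ i : ZMod 2,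
      BalancedData ((relaxedData lq ld μ ν).factor lq ld b i)
        (if i = 0 then u else u⁻¹)⁻¹ (if i = 0 then u else u⁻¹) := by
    intro b
    have h1 := fun i => balancedData_rootA lq ld μ ν i b.pt.col b.pt
    have hA : ∃ u : ℂ, u ≠ 0 ∧ ∀ i : ZMod 2,
        BalancedData (rootA lq ld b.pt.col (posPt lq ld μ ν b.pt) i)
          (if i = 0 then u else u⁻¹)⁻¹ (if i = 0 then u else u⁻¹) := by
      -- The value at infinity of component 0 is q₂ for a box of colour 0 and q₂⁻¹ for a box of
      -- colour 1; component 1 has the inverse.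
      obtain hc | hc : b.pt.col = 0 ∨ b.pt.col = 1 := by
        generalize b.pt.col = i; revert i; decide
      · exact ⟨q2 lq, h2, fun i => by simpa only [hc] using h1 i⟩
      · refine ⟨(q2 lq)⁻¹, inv_ne_zero h2, fun i => ?_⟩
        have hi : i = 0 ∨ i = 1 := by revert i; decide
        have h3 := h1 i
        rw [hc] at h3 ⊢
        obtain rfl | rfl := hi
        · simpa using h3
        · simpa using h3
    obtain ⟨u, hu, h⟩ := hA
    cases hn : b.isNeg
    · refine ⟨u⁻¹, inv_ne_zero hu, fun i => ?_⟩
      rw [factor_eq, hn, if_neg (by decide)]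
      have h3 := (h i).inv
      split_ifs at h3 ⊢ <;> simpa using h3
    · refine ⟨u, hu, fun i => ?_⟩
      rw [factor_eq, hn, if_pos rfl]
      exact h i
  choose u hu hm using step
  refine ⟨∏ b ∈ s, u b, Finset.prod_ne_zero_iff.2 fun b _ => hu b, fun i => ?_⟩
  have := (balancedData_psi lq ld μ ν i).mul (BalancedData.prod s _ _ _ fun b _ => hm b i)
  rw [phi_eq]
  convert this using 1
  · rw [Finset.prod_inv_distrib, ← mul_inv]
    split_ifs
    · rfl
    · rw [Finset.prod_inv_distrib]
  · split_ifs
    · rfl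
    · rw [Finset.prod_inv_distrib]

end Weights

end ToroidalGl2

namespace ToroidalGl2

/-! ### Truncated weights, corners and the exchange function. -/

noncomputable section Coefficients

/-- Signs change only along the tower: above a positive box everything is positive, below a negative
one everything is negative. -/
theorem RBox.isNeg_of_shift {b c : RBox} {x y : ℤ} (hc : c.pt = b.pt.shift x y)
    (h : (0 ≤ y ∧ b.isNeg = false) ∨ (y ≤ 0 ∧ b.isNeg = true)) : c.isNeg = b.isNeg := by
  cases b <;> cases c <;> simp [RBox.pt, RBox.isNeg, Pt.shift] at hc h ⊢ <;> omega

theorem lower_empty : Lower ∅ := by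
  have := lower_relaxedState ⊥ ⊥ 0
  convert this
  simp [relaxedState]

/-- Boxes up and to the right of a positive b are positive and do not precede b, so truncation
leaves them empty; points that are not boxes keep their value in the empty state. -/
theorem not_filled_shift_filter {s : Finset RBox} {b : RBox} (hb : b.isNeg = false) {x y : ℤ}
    (hx : 0 ≤ x) (hy : 0 ≤ y) (h0 : ¬ filled ∅ (b.pt.shift x y)) :
    ¬ filled (s.filter (· < b)) (b.pt.shift x y) := by
  by_cases h : ∃ c : RBox, c.pt = b.pt.shift x y
  · obtain ⟨c, hc⟩ := h
    have hn := RBox.isNeg_of_shift hc (Or.inl ⟨hy, hb⟩)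
    have hnot : ¬ c < b := fun hlt => by
      have := RBox.lt_shift' hlt hc
      omega
    rw [← hc, filled_pt, hn, hb]
    simp [hnot]
  · push Not at h
    rwa [filled_of_not_box h _ ∅]

/-- Boxes down and to the left of b precede it, so truncation does not touch them. -/
theorem filled_shift_filter {s : Finset RBox} {b : RBox} {x y : ℤ}
    (hx : x < 0 ∧ y ≤ 0 ∨ x ≤ 0 ∧ y < 0) (h0 : filled s (b.pt.shift x y)) :
    filled (s.filter (· < b)) (b.pt.shift x y) := by
  by_cases h : ∃ c : RBox, c.pt = b.pt.shift x y
  · obtain ⟨c, hc⟩ := h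
    have hlt : c < b := by
      rcases lt_trichotomy c b with h | h | h
      · exact h
      · rw [h, ← Pt.shift_zero b.pt, Pt.shift_shift, Pt.shift_inj] at hc; omega
      · have := RBox.lt_shift h hc; omega
    rw [← hc, filled_pt] at h0 ⊢
    simpa [hlt] using h0
  · push Not at h
    rwa [filled_of_not_box h _ s]

theorem filled_shift_filter' {s : Finset RBox} {b : RBox} (hb : b.isNeg = true) {x y : ℤ}
    (hx : x ≤ 0) (hy : y ≤ 0) (h0 : filled ∅ (b.pt.shift x y)) :
    filled (s.filter (b < ·)) (b.pt.shift x y) := by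
  by_cases h : ∃ c : RBox, c.pt = b.pt.shift x y
  · obtain ⟨c, hc⟩ := h
    have hn := RBox.isNeg_of_shift hc (Or.inr ⟨hy, hb⟩)
    have hnot : ¬ b < c := fun hlt => by
      have := RBox.lt_shift hlt hc
      omega
    rw [← hc, filled_pt, hn, hb]
    simp [hnot]
  · push Not at h
    rwa [filled_of_not_box h _ ∅]

theorem not_filled_shift_filter' {s : Finset RBox} {b : RBox} {x y : ℤ}
    (hx : 0 < x ∧ 0 ≤ y ∨ 0 ≤ x ∧ 0 < y) (h0 : ¬ filled s (b.pt.shift x y)) :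
    ¬ filled (s.filter (b < ·)) (b.pt.shift x y) := by
  by_cases h : ∃ c : RBox, c.pt = b.pt.shift x y
  · obtain ⟨c, hc⟩ := h
    have hlt : b < c := by
      rcases lt_trichotomy b c with h | h | h
      · exact h
      · rw [← h, ← Pt.shift_zero b.pt, Pt.shift_shift, Pt.shift_inj] at hc; omega
      · have := RBox.lt_shift' h hc; omega
    rw [← hc, filled_pt] at h0 ⊢
    simpa [hlt] using h0
  · push Not at h
    rwa [filled_of_not_box h _ s]

/-- The truncation agrees with s just below b and with the empty state just above b. Hence b is a
corner of it, whether or not b can still be added or removed in s. -/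
theorem cornerOrd_filter_lt {s : Finset RBox} {b : RBox} (hb : b.isNeg = false)
    (h : LowFull s b.pt) : cornerOrd (s.filter (· < b)) b.pt = -1 := by
  have h0 : ¬ filled ∅ b.pt := by rw [filled_pt, hb]; simp
  have hu := lower_empty.upFree_of_not_filled h0
  exact cornerOrd_of_corner
    ⟨filled_shift_filter (by omega) h.1, filled_shift_filter (by omega) h.2.1,
      filled_shift_filter (by omega) h.2.2⟩
    ⟨not_filled_shift_filter hb (by omega) (by omega) hu.1,
      not_filled_shift_filter hb (by omega) (by omega) hu.2.1,
      not_filled_shift_filter hb (by omega) (by omega) hu.2.2⟩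

theorem cornerOrd_filter_gt {s : Finset RBox} {b : RBox} (hb : b.isNeg = true)
    (h : UpFree s b.pt) : cornerOrd (s.filter (b < ·)) b.pt = -1 := by
  have h0 : filled ∅ b.pt := by rw [filled_pt, hb]; simp
  have hl := lower_empty.lowFull_of_filled h0
  exact cornerOrd_of_corner
    ⟨filled_shift_filter' hb (by omega) (by omega) hl.1,
      filled_shift_filter' hb (by omega) (by omega) hl.2.1,
      filled_shift_filter' hb (by omega) (by omega) hl.2.2⟩
    ⟨not_filled_shift_filter' (by omega) h.1, not_filled_shift_filter' (by omega) h.2.1,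
      not_filled_shift_filter' (by omega) h.2.2⟩

/-- The lattice points below and above `a` are distinct from `p`. -/
theorem ordA_eq_zero {p a : Pt} (h1 : p ≠ a.shift 0 (-1)) (h2 : p ≠ a.shift 0 1)
    (h3 : p ≠ a.shift (-1) 0) (h4 : p ≠ a.shift 1 1) (h5 : p ≠ a.shift 1 0)
    (h6 : p ≠ a.shift (-1) (-1)) : ordA p a = 0 := by
  simp [ordA, h1, h2, h3, h4, h5, h6]

/-- A later box can only meet the upper neighbours of b; these are empty in s, and being positive
they are absent from s. -/
theorem ordA_of_gt {s : Finset RBox} {b c : RBox} (hb : b.isNeg = false) (h : UpFree s b.pt)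
    (hc : c ∈ s) (hlt : b < c) : ordA c.pt b.pt = 0 := by
  have up : ∀ x y : ℤ, 0 ≤ y → ¬ filled s (b.pt.shift x y) → c.pt ≠ b.pt.shift x y := by
    intro x y hy hf he
    rw [← he, filled_pt, RBox.isNeg_of_shift he (Or.inl ⟨hy, hb⟩), hb] at hf
    exact hf (by simp [hc])
  have down : ∀ x y : ℤ, ¬ (0 < y ∨ (y = 0 ∧ 0 < x)) → c.pt ≠ b.pt.shift x y :=
    fun x y hxy he => hxy (RBox.lt_shift hlt he)
  exact ordA_eq_zero (down _ _ (by omega)) (up _ _ (by omega) h.2.1) (down _ _ (by omega))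
    (up _ _ (by omega) h.2.2) (up _ _ (by omega) h.1) (down _ _ (by omega))

theorem ordA_of_lt {s : Finset RBox} {b c : RBox} (hb : b.isNeg = true) (h : LowFull s b.pt)
    (hc : c ∈ s) (hlt : c < b) : ordA c.pt b.pt = 0 := by
  have down : ∀ x y : ℤ, y ≤ 0 → filled s (b.pt.shift x y) → c.pt ≠ b.pt.shift x y := by
    intro x y hy hf he
    rw [← he, filled_pt, RBox.isNeg_of_shift he (Or.inr ⟨hy, hb⟩), hb] at hf
    simp [hc] at hf
  have up : ∀ x y : ℤ, ¬ (y < 0 ∨ (y = 0 ∧ x < 0)) → c.pt ≠ b.pt.shift x y :=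
    fun x y hxy he => hxy (RBox.lt_shift' hlt he)
  exact ordA_eq_zero (down _ _ (by omega) h.2.1) (up _ _ (by omega)) (down _ _ (by omega) h.1)
    (up _ _ (by omega)) (up _ _ (by omega)) (down _ _ (by omega) h.2.2)

variable {lq ld μ ν : ℂ}

/-- With Ψ included, this side is the weight of a truncated set of boxes, so `ordAt_phi` applies to
it. -/
theorem phiLT_of_pos {s : Finset RBox} {b : RBox} (hb : b.isNeg = false) (i : ZMod 2) :
    (relaxedData lq ld μ ν).phiLT lq ld s b i =
      (relaxedData lq ld μ ν).phi lq ld (s.filter (· < b)) i := by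
  rw [CombinatorialData.phiLT, neg_eq, hb, CombinatorialData.phi]
  simp

theorem phiGT_of_neg {s : Finset RBox} {b : RBox} (hb : b.isNeg = true) (i : ZMod 2) :
    (relaxedData lq ld μ ν).phiGT lq ld s b i =
      (relaxedData lq ld μ ν).phi lq ld (s.filter (b < ·)) i := by
  rw [CombinatorialData.phiGT, neg_eq, hb, CombinatorialData.phi]
  simp

theorem phiGT_of_pos {s : Finset RBox} {b : RBox} (hb : b.isNeg = false) (i : ZMod 2) :
    (relaxedData lq ld μ ν).phiGT lq ld s b i =
      ∏ c ∈ s with b < c, (relaxedData lq ld μ ν).factor lq ld c i := by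
  rw [CombinatorialData.phiGT, neg_eq, hb]
  simp

theorem phiLT_of_neg {s : Finset RBox} {b : RBox} (hb : b.isNeg = true) (i : ZMod 2) :
    (relaxedData lq ld μ ν).phiLT lq ld s b i =
      ∏ c ∈ s with c < b, (relaxedData lq ld μ ν).factor lq ld c i := by
  rw [CombinatorialData.phiLT, neg_eq, hb]
  simp

theorem phiLT_ne_zero (s : Finset RBox) (b : RBox) (i : ZMod 2) :
    (relaxedData lq ld μ ν).phiLT lq ld s b i ≠ 0 := by
  refine mul_ne_zero ?_ (Finset.prod_ne_zero_iff.2 fun c _ => factor_ne_zero _ _ _ _ _ _)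
  split_ifs
  · exact one_ne_zero
  · exact psi_ne_zero lq ld μ ν i

theorem phiGT_ne_zero (s : Finset RBox) (b : RBox) (i : ZMod 2) :
    (relaxedData lq ld μ ν).phiGT lq ld s b i ≠ 0 := by
  refine mul_ne_zero ?_ (Finset.prod_ne_zero_iff.2 fun c _ => factor_ne_zero _ _ _ _ _ _)
  split_ifs
  · exact psi_ne_zero lq ld μ ν i
  · exact one_ne_zero

namespace GenericData

variable (h : GenericData lq ld μ ν)
include h

theorem ordAt_phiLT_of_pos {s : Finset RBox} {b : RBox} (hb : b.isNeg = false)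
    (hl : LowFull s b.pt) : ordAt (posPt lq ld μ ν b.pt)
      ((relaxedData lq ld μ ν).phiLT lq ld s b b.pt.col) = -1 := by
  rw [phiLT_of_pos hb, h.ordAt_phi, if_pos rfl, cornerOrd_filter_lt hb hl]

theorem ordAt_phiGT_of_neg {s : Finset RBox} {b : RBox} (hb : b.isNeg = true)
    (hu : UpFree s b.pt) : ordAt (posPt lq ld μ ν b.pt)
      ((relaxedData lq ld μ ν).phiGT lq ld s b b.pt.col) = -1 := by
  rw [phiGT_of_neg hb, h.ordAt_phi, if_pos rfl, cornerOrd_filter_gt hb hu]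

theorem ordAt_phiGT_of_pos {s : Finset RBox} {b : RBox} (hb : b.isNeg = false)
    (hu : UpFree s b.pt) : ordAt (posPt lq ld μ ν b.pt)
      ((relaxedData lq ld μ ν).phiGT lq ld s b b.pt.col) = 0 := by
  rw [phiGT_of_pos hb, ordAt_prod _ _ _ fun c _ => factor_ne_zero _ _ _ _ _ _]
  refine Finset.sum_eq_zero fun c hc => ?_
  rw [Finset.mem_filter] at hc
  rw [h.ordAt_factor, if_pos rfl, ordA_of_gt hb hu hc.1 hc.2]
  simp

theorem ordAt_phiLT_of_neg {s : Finset RBox} {b : RBox} (hb : b.isNeg = true)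
    (hl : LowFull s b.pt) : ordAt (posPt lq ld μ ν b.pt)
      ((relaxedData lq ld μ ν).phiLT lq ld s b b.pt.col) = 0 := by
  rw [phiLT_of_neg hb, ordAt_prod _ _ _ fun c _ => factor_ne_zero _ _ _ _ _ _]
  refine Finset.sum_eq_zero fun c hc => ?_
  rw [Finset.mem_filter] at hc
  rw [h.ordAt_factor, if_pos rfl, ordA_of_lt hb hl hc.1 hc.2]
  simp

end GenericData

theorem ordAt_mul_lin {a : ℂ} {f : RatFunc ℂ} (hf : f ≠ 0) :
    ordAt a (f * lin a) = ordAt a f + 1 := by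
  rw [ordAt_mul _ hf (lin_ne_zero a), ordAt_lin, if_pos rfl]

variable (lq ld μ ν)

/-- An empty positive box is absent and gets inserted, an empty negative box is present and gets
erased; both are the same symmetric difference. -/
theorem addBox_eq {s : Finset RBox} {b : RBox} (hb : ¬ filled s b.pt) :
    (relaxedData lq ld μ ν).addBox s b = toggle s b := by
  rw [filled_pt] at hb
  ext c
  rw [CombinatorialData.addBox, neg_eq, mem_toggle]
  cases hn : b.isNeg
  · simp only [Bool.false_eq_true, if_false, Finset.mem_insert]
    by_cases hc : c = b
    · subst hc; simp_all
    · simp [hc]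
  · simp only [if_true, Finset.mem_erase]
    by_cases hc : c = b
    · subst hc; simp_all
    · simp [hc]

theorem removeBox_eq {s : Finset RBox} {b : RBox} (hb : filled s b.pt) :
    (relaxedData lq ld μ ν).removeBox s b = toggle s b := by
  rw [filled_pt] at hb
  ext c
  rw [CombinatorialData.removeBox, neg_eq, mem_toggle]
  cases hn : b.isNeg
  · simp only [Bool.false_eq_true, if_false, Finset.mem_erase]
    by_cases hc : c = b
    · subst hc; simp_all
    · simp [hc]
  · simp only [if_true, Finset.mem_insert]
    by_cases hc : c = b
    · subst hc; simp_all
    · simp [hc]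

theorem mem_concave_iff (s : Finset RBox) (i : ZMod 2) (b : RBox) :
    b ∈ (relaxedData lq ld μ ν).concave s i ↔
      b.pt.col = i ∧ ¬ filled s b.pt ∧ Lower (toggle s b) := by
  have e : (b ∈ s ↔ b.isNeg = true) ↔ ¬ filled s b.pt := by
    rw [filled_pt]; cases b.isNeg <;> simp
  simp only [CombinatorialData.concave, Set.mem_ofPred_eq, color_eq, neg_eq, e]
  refine and_congr_right fun _ => and_congr_right fun hf => ?_
  rw [addBox_eq _ _ _ _ hf, mem_states_iff]

theorem mem_convex_iff (s : Finset RBox) (i : ZMod 2) (b : RBox) :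
    b ∈ (relaxedData lq ld μ ν).convex s i ↔
      b.pt.col = i ∧ filled s b.pt ∧ Lower (toggle s b) := by
  have e : (b ∈ s ↔ b.isNeg = false) ↔ filled s b.pt := by
    rw [filled_pt]
  simp only [CombinatorialData.convex, Set.mem_ofPred_eq, color_eq, neg_eq, e]
  refine and_congr_right fun _ => and_congr_right fun hf => ?_
  rw [removeBox_eq _ _ _ _ hf, mem_states_iff]

/-- The box `b` can be added or removed. -/
def IsCorner (s : Finset RBox) (b : RBox) : Prop := LowFull s b.pt ∧ UpFree s b.pt

theorem Lower.isCorner_iff {s : Finset RBox} (hs : Lower s) (b : RBox) :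
    IsCorner s b ↔ Lower (toggle s b) := by
  by_cases hb : filled s b.pt
  · rw [hs.toggle_iff_of_filled hb]
    exact ⟨fun h => h.2, fun h => ⟨hs.lowFull_of_filled hb, h⟩⟩
  · rw [hs.toggle_iff_of_not_filled hb]
    exact ⟨fun h => h.1, fun h => ⟨h, hs.upFree_of_not_filled hb⟩⟩

theorem mem_concave_union_convex_iff {s : Finset RBox} (hs : Lower s) (i : ZMod 2) (b : RBox) :
    b ∈ (relaxedData lq ld μ ν).concave s i ∪ (relaxedData lq ld μ ν).convex s i ↔
      b.pt.col = i ∧ IsCorner s b := by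
  rw [Set.mem_union, mem_concave_iff, mem_convex_iff, hs.isCorner_iff]
  tauto

variable {lq ld μ ν}

/-- Corners of colour i are poles of one rational function, at distinct positions. -/
theorem GenericData.finite_corners (h : GenericData lq ld μ ν) (s : Finset RBox) (i : ZMod 2) :
    {b : RBox | b.pt.col = i ∧ IsCorner s b}.Finite := by
  have hfin : {z : ℂ | ((relaxedData lq ld μ ν).phi lq ld s i).denom.IsRoot z}.Finite :=
    Polynomial.finite_setOfPred_isRoot (RatFunc.denom_ne_zero _)
  refine (hfin.preimage (f := fun b : RBox => posPt lq ld μ ν b.pt)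
    (h.posPt_injective.comp RBox.pt_injective).injOn).subset ?_
  rintro b ⟨hc, hb⟩
  refine eval_denom_eq_zero_of_ordAt ?_
  rw [h.ordAt_phi, if_pos hc, cornerOrd_of_corner hb.1 hb.2]
  norm_num

theorem GenericData.wellDefined (h : GenericData lq ld μ ν) :
    (relaxedData lq ld μ ν).WellDefined lq ld where
  finite_concave s hs i := (h.finite_corners s i).subset fun b hb => by
    rw [mem_states_iff] at hs
    exact (mem_concave_union_convex_iff lq ld μ ν hs i b).1 (Or.inl hb)
  finite_convex s hs i := (h.finite_corners s i).subset fun b hb => by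
    rw [mem_states_iff] at hs
    exact (mem_concave_union_convex_iff lq ld μ ν hs i b).1 (Or.inr hb)
  balanced s hs i := by
    obtain ⟨u, hu, h1⟩ := exists_balancedData_phi lq ld μ ν s
    refine (h1 i).balanced (inv_mul_cancel₀ (mul_ne_zero (psiInfty_ne_zero _ _ _ _ _) ?_))
    split_ifs
    · exact hu
    · exact inv_ne_zero hu
  regular_pos s hs i b hb hn := by
    rw [mem_states_iff] at hs
    obtain ⟨rfl, hc⟩ := (mem_concave_union_convex_iff lq ld μ ν hs i b).1 hb
    rw [neg_eq] at hn
    rw [pos_eq]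
    exact regularAt_of_ordAt (h.ordAt_phiGT_of_pos hn hc.2).ge
  regular_neg s hs i b hb hn := by
    rw [mem_states_iff] at hs
    obtain ⟨rfl, hc⟩ := (mem_concave_union_convex_iff lq ld μ ν hs i b).1 hb
    rw [neg_eq] at hn
    rw [pos_eq]
    exact regularAt_of_ordAt (h.ordAt_phiLT_of_neg hn hc.1).ge

/-! Structure of the coefficients -/

variable (lq ld μ ν)

/-- The exchange function: `exch u v / exch v u` is the factor relating the two orders in which
boxes at `u` and `v` can be added. -/
def exch (u v : Pt) : ℂ :=
  if u.col = v.col then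
    (posPt lq ld μ ν u - q2 lq * posPt lq ld μ ν v) / (posPt lq ld μ ν u - posPt lq ld μ ν v)
  else (posPt lq ld μ ν u - q1 lq ld * posPt lq ld μ ν v) *
    (posPt lq ld μ ν u - q3 lq ld * posPt lq ld μ ν v)

theorem value_C_mul_lin_div {z c u v : ℂ} (hv : z ≠ v) :
    RegularAt (RatFunc.C c * (lin u / lin v)) z ∧
      value (RatFunc.C c * (lin u / lin v)) z = c * ((z - u) / (z - v)) := by
  have h1 := regularAt_lin_inv hv
  have h2 := (regularAt_lin z u).mul h1
  rw [div_eq_mul_inv]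
  exact ⟨(regularAt_C z c).mul h2, by
    rw [value_mul (regularAt_C z c) h2, value_mul (regularAt_lin z u) h1, value_C, value_lin,
      value_lin_inv hv, div_eq_mul_inv]⟩

theorem value_C_mul_lin_div_mul {z c u v u' v' : ℂ} (hv : z ≠ v) (hv' : z ≠ v') :
    RegularAt (RatFunc.C c * ((lin u / lin v) * (lin u' / lin v'))) z ∧
      value (RatFunc.C c * ((lin u / lin v) * (lin u' / lin v'))) z =
        c * (((z - u) / (z - v)) * ((z - u') / (z - v'))) := by
  obtain ⟨h1, h2⟩ := value_C_mul_lin_div (c := c) (u := u) hv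
  obtain ⟨h3, h4⟩ := value_C_mul_lin_div (c := 1) (u := u') hv'
  rw [map_one, one_mul] at h3 h4
  rw [← mul_assoc]
  exact ⟨h1.mul h3, by rw [value_mul h1 h3, h2, h4]; ring⟩

variable {lq ld μ ν}

namespace GenericData

variable (h : GenericData lq ld μ ν)
include h

theorem posPt_ne {a b : Pt} (hab : a ≠ b) : posPt lq ld μ ν a ≠ posPt lq ld μ ν b :=
  fun he => hab (h.posPt_injective he)

theorem exch_eq_zero_iff {u v : Pt} (huv : u ≠ v) : exch lq ld μ ν u v = 0 ↔
    v = u.shift 0 1 ∨ v = u.shift 1 0 ∨ v = u.shift (-1) (-1) := by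
  have hne := sub_ne_zero.2 (h.posPt_ne huv)
  have e2 : posPt lq ld μ ν u - q2 lq * posPt lq ld μ ν v = 0 ↔ v = u.shift 0 1 := by
    rw [q2_mul_posPt, sub_eq_zero, h.posPt_injective.eq_iff, Pt.eq_shift_iff]; simp
  have e1 : posPt lq ld μ ν u - q1 lq ld * posPt lq ld μ ν v = 0 ↔ v = u.shift 1 0 := by
    rw [q1_mul_posPt, sub_eq_zero, h.posPt_injective.eq_iff, Pt.eq_shift_iff]; simp
  have e3 : posPt lq ld μ ν u - q3 lq ld * posPt lq ld μ ν v = 0 ↔ v = u.shift (-1) (-1) := by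
    rw [q3_mul_posPt, sub_eq_zero, h.posPt_injective.eq_iff, Pt.eq_shift_iff]
  rw [exch]
  split_ifs with hc
  · have n1 : v ≠ u.shift 1 0 := by
      rintro rfl; rw [Pt.col_shift_one] at hc; exact ZMod.two_add_one_ne _ hc.symm
    have n2 : v ≠ u.shift (-1) (-1) := by
      rintro rfl; rw [Pt.col_shift_neg_one] at hc; exact ZMod.two_add_one_ne _ hc.symm
    rw [div_eq_zero_iff, e2]
    simp [n1, n2, hne]
  · have n1 : v ≠ u.shift 0 1 := by
      rintro rfl; rw [Pt.col_shift_even] at hc; exact hc rfl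
    rw [mul_eq_zero, e1, e3]
    simp [n1]

theorem value_rootA {p a : Pt} (hpa : p ≠ a) (hne : exch lq ld μ ν a p ≠ 0) :
    RegularAt (rootA lq ld p.col (posPt lq ld μ ν p) a.col) (posPt lq ld μ ν a) ∧
    value (rootA lq ld p.col (posPt lq ld μ ν p) a.col) (posPt lq ld μ ν a) =
      exch lq ld μ ν p a / exch lq ld μ ν a p := by
  have h2 := q2_ne_zero lq
  have h1 := q1_ne_zero lq ld
  have h3 := q3_ne_zero lq ld
  rw [Ne, h.exch_eq_zero_iff hpa.symm] at hne
  push Not at hne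
  have hd := sub_ne_zero.2 (h.posPt_ne hpa)
  have hd' := sub_ne_zero.2 (h.posPt_ne hpa.symm)
  by_cases hc : a.col = p.col
  · have hz : posPt lq ld μ ν a ≠ posPt lq ld μ ν (p.shift 0 (-1)) := by
      rw [Ne, h.posPt_injective.eq_iff, Pt.eq_shift_iff]; simpa using hne.1
    rw [hc, rootA_same]
    obtain ⟨r1, r2⟩ := value_C_mul_lin_div (c := q2 lq)
      (u := posPt lq ld μ ν (p.shift 0 1)) hz
    refine ⟨r1, ?_⟩
    rw [r2, exch, exch, if_pos hc, if_pos hc.symm, ← posPt_div_q2]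
    rw [← q2_mul_posPt] at hz ⊢
    have := sub_ne_zero.2 hz
    field_simp
    ring
  · have hz1 : posPt lq ld μ ν a ≠ posPt lq ld μ ν (p.shift (-1) 0) := by
      rw [Ne, h.posPt_injective.eq_iff, Pt.eq_shift_iff]; simpa using hne.2.1
    have hz2 : posPt lq ld μ ν a ≠ posPt lq ld μ ν (p.shift 1 1) := by
      rw [Ne, h.posPt_injective.eq_iff, Pt.eq_shift_iff]; exact hne.2.2
    rw [rootA_diff _ _ _ _ hc]
    obtain ⟨r1, r2⟩ := value_C_mul_lin_div_mul (c := q1 lq ld * q3 lq ld)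
      (u := posPt lq ld μ ν (p.shift 1 0)) (u' := posPt lq ld μ ν (p.shift (-1) (-1))) hz1 hz2
    refine ⟨r1, ?_⟩
    rw [r2, exch, exch, if_neg hc, if_neg (Ne.symm hc), ← posPt_div_q1, ← posPt_div_q3]
    rw [← q1_mul_posPt] at hz1 ⊢
    rw [← q3_mul_posPt] at hz2 ⊢
    have := sub_ne_zero.2 hz1
    have := sub_ne_zero.2 hz2
    field_simp
    ring

theorem value_rootA_inv {p a : Pt} (hpa : p ≠ a) (hne : exch lq ld μ ν p a ≠ 0) :
    RegularAt (rootA lq ld p.col (posPt lq ld μ ν p) a.col)⁻¹ (posPt lq ld μ ν a) ∧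
    value (rootA lq ld p.col (posPt lq ld μ ν p) a.col)⁻¹ (posPt lq ld μ ν a) =
      exch lq ld μ ν a p / exch lq ld μ ν p a := by
  have h2 := q2_ne_zero lq
  have h1 := q1_ne_zero lq ld
  have h3 := q3_ne_zero lq ld
  rw [Ne, h.exch_eq_zero_iff hpa] at hne
  push Not at hne
  have hd := sub_ne_zero.2 (h.posPt_ne hpa)
  have hd' := sub_ne_zero.2 (h.posPt_ne hpa.symm)
  by_cases hc : a.col = p.col
  · have hz : posPt lq ld μ ν a ≠ posPt lq ld μ ν (p.shift 0 1) := by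
      rw [Ne, h.posPt_injective.eq_iff]; exact hne.1
    rw [hc, rootA_same, mul_inv, ← map_inv₀, inv_div]
    obtain ⟨r1, r2⟩ := value_C_mul_lin_div (c := (q2 lq)⁻¹)
      (u := posPt lq ld μ ν (p.shift 0 (-1))) hz
    refine ⟨r1, ?_⟩
    rw [r2, exch, exch, if_pos hc, if_pos hc.symm, ← q2_mul_posPt]
    rw [← posPt_div_q2] at hz ⊢
    have h4 : posPt lq ld μ ν p - q2 lq * posPt lq ld μ ν a ≠ 0 := by
      intro h5; apply hz; field_simp; linear_combination -h5
    have h6 : posPt lq ld μ ν a - posPt lq ld μ ν p / q2 lq =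
        -(posPt lq ld μ ν p - q2 lq * posPt lq ld μ ν a) / q2 lq := by field_simp; ring
    rw [h6]
    field_simp
    ring
  · have hz1 : posPt lq ld μ ν a ≠ posPt lq ld μ ν (p.shift 1 0) := by
      rw [Ne, h.posPt_injective.eq_iff]; exact hne.2.1
    have hz2 : posPt lq ld μ ν a ≠ posPt lq ld μ ν (p.shift (-1) (-1)) := by
      rw [Ne, h.posPt_injective.eq_iff]; exact hne.2.2
    rw [rootA_diff _ _ _ _ hc, mul_inv, mul_inv, ← map_inv₀, inv_div, inv_div]
    obtain ⟨r1, r2⟩ := value_C_mul_lin_div_mul (c := (q1 lq ld * q3 lq ld)⁻¹)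
      (u := posPt lq ld μ ν (p.shift (-1) 0)) (u' := posPt lq ld μ ν (p.shift 1 1)) hz1 hz2
    refine ⟨r1, ?_⟩
    rw [r2, exch, exch, if_neg hc, if_neg (Ne.symm hc), ← q1_mul_posPt, ← q3_mul_posPt]
    rw [← posPt_div_q1] at hz1 ⊢
    rw [← posPt_div_q3] at hz2 ⊢
    have h4 : posPt lq ld μ ν p - q1 lq ld * posPt lq ld μ ν a ≠ 0 := by
      intro h5; apply hz1; field_simp; linear_combination -h5
    have h5 : posPt lq ld μ ν p - q3 lq ld * posPt lq ld μ ν a ≠ 0 := by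
      intro h5; apply hz2; field_simp; linear_combination -h5
    have h6 : posPt lq ld μ ν a - posPt lq ld μ ν p / q1 lq ld =
        -(posPt lq ld μ ν p - q1 lq ld * posPt lq ld μ ν a) / q1 lq ld := by field_simp; ring
    have h7 : posPt lq ld μ ν a - posPt lq ld μ ν p / q3 lq ld =
        -(posPt lq ld μ ν p - q3 lq ld * posPt lq ld μ ν a) / q3 lq ld := by field_simp; ring
    rw [h6, h7]
    field_simp

end GenericData

end Coefficients

end ToroidalGl2

namespace ToroidalGl2

/-! ### How the matrix coefficient of one box depends on the others. -/

noncomputable section Exchange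

instance (s : Finset RBox) (a : Pt) : Decidable (filled s a) := Classical.dec _

instance (s : Finset RBox) : Decidable (Lower s) := Classical.dec _

/-- The boxes which can possibly be added to (`e = true`) or removed from (`e = false`) a state. -/
def Avail (e : Bool) (s : Finset RBox) (b : RBox) : Prop := filled s b.pt ↔ e = false

instance (e : Bool) (s : Finset RBox) (b : RBox) : Decidable (Avail e s b) := Classical.dec _

/-- The boxes which come after `b` when boxes are added (`e = true`) or removed (`e = false`). -/
def After (e : Bool) (b c : RBox) : Prop := if e then b < c else c < b

instance (e : Bool) (b : RBox) : DecidablePred (After e b) := fun _ => Classical.dec _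

variable (lq ld μ ν : ℂ)

/-- `φ_{s,>b}` for `e = true` and `φ_{s,<b}` for `e = false`. -/
def phiSide (e : Bool) (s : Finset RBox) (b : RBox) (i : ZMod 2) : RatFunc ℂ :=
  if e then (relaxedData lq ld μ ν).phiGT lq ld s b i else (relaxedData lq ld μ ν).phiLT lq ld s b i

/-- The matrix coefficient of the box `b` in the action of `F` (`e = true`) or `E` (`e = false`). -/
def opCoeff (e : Bool) (s : Finset RBox) (b : RBox) : ℂ :=
  if e then (relaxedData lq ld μ ν).coeffF lq ld s b b.pt.col
  else (relaxedData lq ld μ ν).coeffE lq ld s b b.pt.col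

/-- The sign of the residues in the matrix coefficients. -/
def opSign (e : Bool) : ℂ := if e then -1 else 1

theorem opCoeff_eq (e : Bool) (s : Finset RBox) (b : RBox) : opCoeff lq ld μ ν e s b =
    if b.isNeg = e then opSign e / (q lq - (q lq)⁻¹) *
      residue (phiSide lq ld μ ν e s b b.pt.col / RatFunc.X) (posPt lq ld μ ν b.pt)
    else value (phiSide lq ld μ ν e s b b.pt.col) (posPt lq ld μ ν b.pt) := by
  cases e
  · cases hb : b.isNeg <;>
      simp [opCoeff, CombinatorialData.coeffE, phiSide, opSign, pos_eq, neg_eq, hb]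
  · cases hb : b.isNeg <;>
      simp [opCoeff, CombinatorialData.coeffF, phiSide, opSign, pos_eq, neg_eq, hb]

theorem phiSide_eq (e : Bool) (s : Finset RBox) (b : RBox) (i : ZMod 2) : phiSide lq ld μ ν e s b i =
    (if b.isNeg = e then relaxedPsi lq ld μ ν i else 1) *
      ∏ c ∈ s with After e b c, (relaxedData lq ld μ ν).factor lq ld c i := by
  have hPsi : (relaxedData lq ld μ ν).Psi i = relaxedPsi lq ld μ ν i := rfl
  have hs : s.filter (After e b) = s.filter (fun c => if e then b < c else c < b) := by
    ext c
    simp [After]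
  rw [hs]
  cases e
  · cases hb : b.isNeg <;> simp [CombinatorialData.phiLT, phiSide, neg_eq, hb, hPsi]
  · cases hb : b.isNeg <;> simp [CombinatorialData.phiGT, phiSide, neg_eq, hb, hPsi]

theorem phiSide_ne_zero (e : Bool) (s : Finset RBox) (b : RBox) (i : ZMod 2) :
    phiSide lq ld μ ν e s b i ≠ 0 := by
  unfold phiSide
  split_ifs
  · exact phiGT_ne_zero s b i
  · exact phiLT_ne_zero s b i

/-- The effect of adding or removing a box on a product of factors. -/
theorem prod_factor_toggle (P : RBox → Prop) [DecidablePred P] (s : Finset RBox) (b : RBox)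
    (i : ZMod 2) :
    ∏ c ∈ toggle s b with P c, (relaxedData lq ld μ ν).factor lq ld c i =
      (∏ c ∈ s with P c, (relaxedData lq ld μ ν).factor lq ld c i) *
        if P b then (if filled s b.pt then rootA lq ld b.pt.col (posPt lq ld μ ν b.pt) i
          else (rootA lq ld b.pt.col (posPt lq ld μ ν b.pt) i)⁻¹) else 1 := by
  have hne := factor_ne_zero lq ld μ ν b i
  by_cases hP : P b
  · have hv : (if filled s b.pt then rootA lq ld b.pt.col (posPt lq ld μ ν b.pt) i
          else (rootA lq ld b.pt.col (posPt lq ld μ ν b.pt) i)⁻¹) =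
        if b ∈ s then ((relaxedData lq ld μ ν).factor lq ld b i)⁻¹
        else (relaxedData lq ld μ ν).factor lq ld b i := by
      rw [factor_eq]
      simp only [filled_pt]
      by_cases h1 : b ∈ s <;> cases h2 : b.isNeg <;> simp [h1]
    rw [if_pos hP, hv]
    split_ifs with hb
    · have e1 : s.filter P = insert b ((toggle s b).filter P) := by
        ext c
        simp only [Finset.mem_filter, Finset.mem_insert, mem_toggle]
        by_cases hc : c = b
        · subst hc; simp [hb, hP]
        · simp [hc]
      rw [e1, Finset.prod_insert (by simp [mem_toggle, hb])]
      field_simp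
    · have e1 : (toggle s b).filter P = insert b (s.filter P) := by
        ext c
        simp only [Finset.mem_filter, Finset.mem_insert, mem_toggle]
        by_cases hc : c = b
        · subst hc; simp [hb, hP]
        · simp [hc]
      rw [e1, Finset.prod_insert (by simp [hb]), mul_comm]
  · rw [if_neg hP, mul_one]
    congr 1
    ext c
    simp only [Finset.mem_filter, mem_toggle]
    by_cases hc : c = b
    · subst hc; simp [hP]
    · simp [hc]

theorem phiSide_toggle (e : Bool) (s : Finset RBox) (b c : RBox) (i : ZMod 2) :
    phiSide lq ld μ ν e (toggle s c) b i = phiSide lq ld μ ν e s b i *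
      if After e b c then (if filled s c.pt then rootA lq ld c.pt.col (posPt lq ld μ ν c.pt) i
        else (rootA lq ld c.pt.col (posPt lq ld μ ν c.pt) i)⁻¹) else 1 := by
  rw [phiSide_eq, phiSide_eq, prod_factor_toggle, mul_assoc]

theorem phi_toggle (s : Finset RBox) (b : RBox) (i : ZMod 2) :
    (relaxedData lq ld μ ν).phi lq ld (toggle s b) i = (relaxedData lq ld μ ν).phi lq ld s i *
      if filled s b.pt then rootA lq ld b.pt.col (posPt lq ld μ ν b.pt) i
        else (rootA lq ld b.pt.col (posPt lq ld μ ν b.pt) i)⁻¹ := by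
  have := prod_factor_toggle lq ld μ ν (fun _ => True) s b i
  simp only [Finset.filter_true, if_true] at this
  rw [phi_eq, phi_eq, this, mul_assoc]

theorem not_after_self (e : Bool) (b : RBox) : ¬ After e b b := by
  cases e <;> simp [After]

/-- The coefficient of b only involves boxes strictly on one side of b. -/
theorem opCoeff_toggle_self (e : Bool) (s : Finset RBox) (b : RBox) :
    opCoeff lq ld μ ν e (toggle s b) b = opCoeff lq ld μ ν e s b := by
  rw [opCoeff_eq, opCoeff_eq, phiSide_toggle, if_neg (not_after_self e b), mul_one]

/-- The value is (q₂p − p)/(p − q₂p). This −1 accounts for the sign between filling and emptying a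
corner. -/
theorem value_rootA_self (hq : q2 lq ≠ 1) (p : Pt) :
    ordAt (posPt lq ld μ ν p) (rootA lq ld p.col (posPt lq ld μ ν p) p.col) = 0 ∧
    value (rootA lq ld p.col (posPt lq ld μ ν p) p.col) (posPt lq ld μ ν p) = -1 := by
  have hp := posPt_ne_zero lq ld μ ν p
  have h2 := q2_ne_zero lq
  have e1 : posPt lq ld μ ν p ≠ posPt lq ld μ ν (p.shift 0 (-1)) := by
    rw [← q2_mul_posPt]
    intro h
    exact hq (mul_right_cancel₀ hp (by rw [one_mul]; exact h.symm))
  have e2 : posPt lq ld μ ν p ≠ posPt lq ld μ ν (p.shift 0 1) := by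
    rw [← posPt_div_q2]
    intro h
    rw [eq_div_iff h2] at h
    exact hq (mul_left_cancel₀ hp (by rw [mul_one]; exact h))
  rw [rootA_same]
  obtain ⟨-, r2⟩ := value_C_mul_lin_div (c := q2 lq) (u := posPt lq ld μ ν (p.shift 0 1)) e1
  refine ⟨?_, ?_⟩
  · rw [ordAt_mul _ (C_ne_zero h2) (lin_div_ne_zero _ _), ordAt_C, ordAt_div', if_neg e1, if_neg e2]
    simp
  · rw [r2, ← q2_mul_posPt, ← posPt_div_q2]
    rw [← q2_mul_posPt] at e1
    have := sub_ne_zero.2 e1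
    field_simp
    ring

variable {lq ld μ ν}

theorem GenericParameters.q_sq_ne_one (h : GenericParameters lq ld) : q2 lq ≠ 1 := by
  intro h2
  rw [q2_eq] at h2
  have := (h 2 0 (by simpa using h2)).1
  norm_num at this

theorem GenericParameters.q_sub_ne_zero (h : GenericParameters lq ld) : q lq - (q lq)⁻¹ ≠ 0 := by
  intro h2
  apply h.q_sq_ne_one
  have hq : q lq ≠ 0 := Complex.exp_ne_zero _
  field_simp at h2
  rw [q2]
  linear_combination h2

theorem Lower.clear {s : Finset RBox} (hs : Lower s) {e : Bool} {b : RBox} (hb : Avail e s b) :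
    if e then UpFree s b.pt else LowFull s b.pt := by
  cases e
  · simpa using hs.lowFull_of_filled (by simpa [Avail] using hb)
  · simpa using hs.upFree_of_not_filled (by simpa [Avail] using hb)

namespace GenericData

variable (h : GenericData lq ld μ ν)
include h

theorem ordAt_phiSide {e : Bool} {s : Finset RBox} {b : RBox}
    (hc : if e then UpFree s b.pt else LowFull s b.pt) :
    ordAt (posPt lq ld μ ν b.pt) (phiSide lq ld μ ν e s b b.pt.col) =
      if b.isNeg = e then -1 else 0 := by
  unfold phiSide
  cases e
  · simp only [Bool.false_eq_true, if_false] at hc ⊢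
    cases hb : b.isNeg
    · simpa using h.ordAt_phiLT_of_pos hb hc
    · simpa using h.ordAt_phiLT_of_neg hb hc
  · simp only [if_true] at hc ⊢
    cases hb : b.isNeg
    · simpa using h.ordAt_phiGT_of_pos hb hc
    · simpa using h.ordAt_phiGT_of_neg hb hc

theorem opCoeff_ne_zero {e : Bool} {s : Finset RBox} {b : RBox}
    (hc : if e then UpFree s b.pt else LowFull s b.pt) : opCoeff lq ld μ ν e s b ≠ 0 := by
  have hord := h.ordAt_phiSide hc
  have hne := phiSide_ne_zero lq ld μ ν e s b b.pt.col
  have hp := posPt_ne_zero lq ld μ ν b.pt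
  rw [opCoeff_eq]
  split_ifs at hord ⊢ with hb
  · have h0 := ordAt_mul_lin (a := posPt lq ld μ ν b.pt) hne
    rw [hord, neg_add_cancel] at h0
    rw [residue_div_X hp (regularAt_of_ordAt h0.ge)]
    refine mul_ne_zero (div_ne_zero ?_ h.params.q_sub_ne_zero) (div_ne_zero
      (value_ne_zero (mul_ne_zero hne (lin_ne_zero _)) h0) hp)
    cases e <;> simp [opSign]
  · exact value_ne_zero hne hord

/-- The factor by which a matrix coefficient changes. -/
theorem opCoeff_mul {e : Bool} {s t : Finset RBox} {b : RBox}
    (hc : if e then UpFree s b.pt else LowFull s b.pt) {g : RatFunc ℂ}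
    (hg : RegularAt g (posPt lq ld μ ν b.pt))
    (ht : phiSide lq ld μ ν e t b b.pt.col = phiSide lq ld μ ν e s b b.pt.col * g) :
    opCoeff lq ld μ ν e t b = opCoeff lq ld μ ν e s b * value g (posPt lq ld μ ν b.pt) := by
  have hord := h.ordAt_phiSide hc
  have hne := phiSide_ne_zero lq ld μ ν e s b b.pt.col
  have hp := posPt_ne_zero lq ld μ ν b.pt
  rw [opCoeff_eq, opCoeff_eq, ht]
  split_ifs at hord ⊢ with hb
  · have h0 := ordAt_mul_lin (a := posPt lq ld μ ν b.pt) hne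
    rw [hord, neg_add_cancel] at h0
    have hr := regularAt_of_ordAt h0.ge
    have e1 : phiSide lq ld μ ν e s b b.pt.col * g * lin (posPt lq ld μ ν b.pt) =
      phiSide lq ld μ ν e s b b.pt.col * lin (posPt lq ld μ ν b.pt) * g := by ring
    rw [residue_div_X hp hr, residue_div_X hp (by rw [e1]; exact hr.mul hg), e1, value_mul hr hg]
    ring
  · rw [value_mul (regularAt_of_ordAt hord.ge) hg]

end GenericData

variable (lq ld μ ν)

/-- The exchange function of the operators `F` (`e = true`) or `E` (`e = false`). -/
def exchN (e : Bool) (b c : RBox) : ℂ :=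
  if e then exch lq ld μ ν b.pt c.pt else exch lq ld μ ν c.pt b.pt

/-- The symmetric part of the exchange function. -/
def exchM (e : Bool) (b c : RBox) : ℂ :=
  if After e b c then exchN lq ld μ ν e c b else exchN lq ld μ ν e b c

/-- The ratio of matrix coefficients. -/
def exchTheta (e : Bool) (b c : RBox) : ℂ :=
  if After e b c then exchN lq ld μ ν e b c / exchN lq ld μ ν e c b else 1

theorem After.asymm {e : Bool} {b c : RBox} (h : After e b c) : ¬ After e c b := by
  cases e
  · simp only [After, Bool.false_eq_true, if_false] at h ⊢; exact h.not_gt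
  · simp only [After, if_true] at h ⊢; exact h.not_gt

theorem after_or {e : Bool} {b c : RBox} (hbc : b ≠ c) : After e b c ∨ After e c b := by
  cases e
  · simp only [After, Bool.false_eq_true, if_false]; exact hbc.symm.lt_or_gt
  · simp only [After, if_true]; exact hbc.lt_or_gt

theorem exchM_symm (e : Bool) (b c : RBox) : exchM lq ld μ ν e b c = exchM lq ld μ ν e c b := by
  by_cases hbc : b = c
  · rw [hbc]
  unfold exchM
  rcases after_or (e := e) hbc with h | h
  · rw [if_pos h, if_neg h.asymm]
  · rw [if_neg h.asymm, if_pos h]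

variable {lq ld μ ν}

/-- `b` and `c` are diagonal neighbours. -/
def Diagonal (b c : RBox) : Prop := c.pt = b.pt.shift 1 1 ∨ b.pt = c.pt.shift 1 1

namespace GenericData

variable (h : GenericData lq ld μ ν)
include h

theorem exchN_ne_zero {e : Bool} {b c : RBox} (hcb : After e c b) (hd : ¬ Diagonal b c) :
    exchN lq ld μ ν e b c ≠ 0 := by
  have hbc : b ≠ c := by rintro rfl; exact not_after_self _ _ hcb
  unfold Diagonal at hd
  push Not at hd
  unfold exchN
  cases e
  · simp only [After, Bool.false_eq_true, if_false] at hcb ⊢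
    rw [Ne, h.exch_eq_zero_iff (fun he => hbc (RBox.pt_injective he.symm))]
    rintro (h1 | h1 | h1)
    · have := RBox.lt_shift' hcb h1; omega
    · have := RBox.lt_shift' hcb h1; omega
    · exact hd.1 (by rw [Pt.eq_shift_iff]; exact h1)
  · simp only [After, if_true] at hcb ⊢
    rw [Ne, h.exch_eq_zero_iff (fun he => hbc (RBox.pt_injective he))]
    rintro (h1 | h1 | h1)
    · have := RBox.lt_shift' hcb h1; omega
    · have := RBox.lt_shift' hcb h1; omega
    · exact hd.2 (by rw [Pt.eq_shift_iff]; exact h1)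

theorem exchM_ne_zero {e : Bool} {b c : RBox} (hbc : b ≠ c) (hd : ¬ Diagonal b c) :
    exchM lq ld μ ν e b c ≠ 0 := by
  unfold exchM
  split_ifs with h1
  · exact h.exchN_ne_zero h1 (fun h2 => hd h2.symm)
  · exact h.exchN_ne_zero ((after_or hbc).resolve_left h1) hd

theorem exchN_eq {e : Bool} {b c : RBox} (hd : ¬ Diagonal b c) :
    exchN lq ld μ ν e b c = exchTheta lq ld μ ν e b c * exchM lq ld μ ν e b c := by
  unfold exchTheta exchM
  split_ifs with h1
  · rw [div_mul_cancel₀ _ (h.exchN_ne_zero h1 (fun h2 => hd h2.symm))]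
  · rw [one_mul]

/-- The exchange relation of the matrix coefficients. -/
theorem opCoeff_toggle {e : Bool} {s : Finset RBox} {b c : RBox} (hs : Lower s)
    (ht : Lower (toggle s c)) (hb : Avail e s b) (hc : Avail e s c) (hbc : b ≠ c) :
    opCoeff lq ld μ ν e (toggle s c) b =
      opCoeff lq ld μ ν e s b * exchTheta lq ld μ ν e b c := by
  have hpt : c.pt ≠ b.pt := fun he => hbc (RBox.pt_injective he.symm)
  have hcl := hs.clear hb
  have hside := phiSide_toggle lq ld μ ν e s b c b.pt.col
  unfold exchTheta
  split_ifs at hside ⊢ with ha hf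
  · obtain rfl : e = false := hc.1 hf
    simp only [After, Bool.false_eq_true, if_false] at ha
    have hne : exch lq ld μ ν b.pt c.pt ≠ 0 := by
      rw [Ne, h.exch_eq_zero_iff hpt.symm]
      -- The order excludes the covering zeros. At the diagonal zero, emptying c would leave b
      -- filled above an empty point, so the new set would not be an ideal.
      rintro (h1 | h1 | h1)
      · have := RBox.lt_shift' ha h1; omega
      · have := RBox.lt_shift' ha h1; omega
      · have h2 := (ht.lowFull_of_filled ((filled_toggle_of_ne s hpt.symm).2
          (by simpa [Avail] using hb))).2.2
        rw [← h1, filled_toggle_self] at h2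
        exact h2 hf
    obtain ⟨r1, r2⟩ := h.value_rootA hpt hne
    rw [h.opCoeff_mul hcl r1 hside, r2]
    simp [exchN]
  · obtain rfl : e = true := by
      cases e
      · exact absurd (hc.2 rfl) hf
      · rfl
    simp only [After, if_true] at ha
    have hne : exch lq ld μ ν c.pt b.pt ≠ 0 := by
      rw [Ne, h.exch_eq_zero_iff hpt]
      -- As before; at the diagonal zero, filling c would leave the empty point b below it.
      rintro (h1 | h1 | h1)
      · rw [Pt.eq_shift_iff] at h1
        have := RBox.lt_shift ha h1; omega
      · rw [Pt.eq_shift_iff] at h1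
        have := RBox.lt_shift ha h1; omega
      · rw [Pt.eq_shift_iff] at h1
        have h2 := (ht.upFree_of_not_filled (mt (filled_toggle_of_ne s hpt.symm).1
          (by simpa [Avail] using hb))).2.2
        rw [neg_neg] at h1
        rw [← h1, filled_toggle_self, not_not] at h2
        exact hf h2
    obtain ⟨r1, r2⟩ := h.value_rootA_inv hpt hne
    rw [h.opCoeff_mul hcl r1 hside, r2]
    simp [exchN]
  · have := h.opCoeff_mul hcl (regularAt_C _ 1) (by rw [hside, map_one])
    rw [this, value_C]

/-- At a corner, the matrix coefficients of `F` and `E` multiply to the residue of the weight. -/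
theorem opCoeff_mul_opCoeff {s : Finset RBox} {b : RBox} (hc : IsCorner s b) :
    (if filled s b.pt then -1 else 1) * (opCoeff lq ld μ ν true s b * opCoeff lq ld μ ν false s b) =
      1 / (q lq - (q lq)⁻¹) * residue ((relaxedData lq ld μ ν).phi lq ld s b.pt.col / RatFunc.X)
        (posPt lq ld μ ν b.pt) := by
  have hp := posPt_ne_zero lq ld μ ν b.pt
  have hordP := h.ordAt_phiSide (e := b.isNeg) (s := s) (b := b)
    (by split_ifs <;> [exact hc.2; exact hc.1])
  have hordR := h.ordAt_phiSide (e := !b.isNeg) (s := s) (b := b)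
    (by split_ifs <;> [exact hc.2; exact hc.1])
  rw [if_pos rfl] at hordP
  rw [if_neg (by cases b.isNeg <;> simp)] at hordR
  -- φ_s is the product of the two sides of b and of the factor f of b itself, present only if b ∈
  -- s; by `value_rootA_self` that factor takes the value −1 for either sign of b.
  obtain ⟨f, hf, hfv, hphi⟩ : ∃ f, RegularAt f (posPt lq ld μ ν b.pt) ∧
      value f (posPt lq ld μ ν b.pt) = (if b ∈ s then -1 else 1) ∧
      (relaxedData lq ld μ ν).phi lq ld s b.pt.col =
        phiSide lq ld μ ν b.isNeg s b b.pt.col * (phiSide lq ld μ ν (!b.isNeg) s b b.pt.col * f) := by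
    obtain ⟨h1, h2⟩ := value_rootA_self lq ld μ ν h.params.q_sq_ne_one b.pt
    have h3 : RegularAt ((relaxedData lq ld μ ν).factor lq ld b b.pt.col) (posPt lq ld μ ν b.pt) ∧
        value ((relaxedData lq ld μ ν).factor lq ld b b.pt.col) (posPt lq ld μ ν b.pt) = -1 := by
      rw [factor_eq]
      split_ifs
      · exact ⟨regularAt_of_ordAt h1.ge, h2⟩
      · exact ⟨regularAt_inv h1, by rw [value_inv h1, h2]; norm_num⟩
    have hprod : ∏ c ∈ s, (relaxedData lq ld μ ν).factor lq ld c b.pt.col =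
        (∏ c ∈ s with After b.isNeg b c, (relaxedData lq ld μ ν).factor lq ld c b.pt.col) *
        ((∏ c ∈ s with After (!b.isNeg) b c, (relaxedData lq ld μ ν).factor lq ld c b.pt.col) *
          if b ∈ s then (relaxedData lq ld μ ν).factor lq ld b b.pt.col else 1) := by
      rw [← Finset.prod_filter_mul_prod_filter_not s (After b.isNeg b)]
      congr 1
      have hsub : (s.filter (¬ After b.isNeg b ·)).filter (· ≠ b) =
          s.filter (After (!b.isNeg) b) := by
        ext c
        simp only [Finset.mem_filter, and_assoc]
        refine and_congr_right fun _ => ?_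
        cases b.isNeg
        · simp only [After, Bool.not_false, Bool.false_eq_true, if_false, if_true, not_lt]
          exact ⟨fun h => lt_of_le_of_ne h.1 h.2.symm, fun h => ⟨h.le, h.ne'⟩⟩
        · simp only [After, Bool.not_true, Bool.false_eq_true, if_false, if_true, not_lt]
          exact ⟨fun h => lt_of_le_of_ne h.1 h.2, fun h => ⟨h.le, h.ne⟩⟩
      rw [← Finset.prod_filter_mul_prod_filter_not (s.filter (¬ After b.isNeg b ·)) (· ≠ b), hsub]
      congr 1
      have hsub' : (s.filter (¬ After b.isNeg b ·)).filter (fun c => ¬ c ≠ b) =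
          if b ∈ s then {b} else ∅ := by
        ext c
        simp only [Finset.mem_filter, not_not]
        split_ifs with hb
        · rw [Finset.mem_singleton]
          exact ⟨fun h => h.2, by rintro rfl; exact ⟨⟨hb, not_after_self _ _⟩, rfl⟩⟩
        · simp only [Finset.notMem_empty, iff_false]
          rintro ⟨⟨h4, -⟩, rfl⟩
          exact hb h4
      rw [hsub']
      split_ifs <;> simp
    refine ⟨if b ∈ s then (relaxedData lq ld μ ν).factor lq ld b b.pt.col else 1, ?_, ?_, ?_⟩
    · split_ifs
      · exact h3.1
      · simpa using regularAt_C _ 1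
    · split_ifs
      · exact h3.2
      · simp
    · rw [phi_eq, hprod, phiSide_eq, phiSide_eq, if_pos rfl,
        if_neg (show ¬ b.isNeg = !b.isNeg by cases b.isNeg <;> simp)]
      ring
  have h0 := ordAt_mul_lin (a := posPt lq ld μ ν b.pt)
    (phiSide_ne_zero lq ld μ ν b.isNeg s b b.pt.col)
  rw [hordP, neg_add_cancel] at h0
  have hr := regularAt_of_ordAt h0.ge
  have hr' := regularAt_of_ordAt hordR.ge
  have e1 : (relaxedData lq ld μ ν).phi lq ld s b.pt.col * lin (posPt lq ld μ ν b.pt) =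
      phiSide lq ld μ ν b.isNeg s b b.pt.col * lin (posPt lq ld μ ν b.pt) *
        (phiSide lq ld μ ν (!b.isNeg) s b b.pt.col * f) := by rw [hphi]; ring
  have hA : opCoeff lq ld μ ν true s b * opCoeff lq ld μ ν false s b =
      opCoeff lq ld μ ν b.isNeg s b * opCoeff lq ld μ ν (!b.isNeg) s b := by
    cases b.isNeg
    · exact mul_comm _ _
    · rfl
  rw [hA, opCoeff_eq, opCoeff_eq, if_pos rfl,
    if_neg (show ¬ b.isNeg = !b.isNeg by cases b.isNeg <;> simp), residue_div_X hp hr,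
    residue_div_X hp (by rw [e1]; exact hr.mul (hr'.mul hf)), e1, value_mul hr (hr'.mul hf),
    value_mul hr' hf, hfv]
  -- Three signs meet: from b being filled, from the residue convention for negative boxes, and from
  -- f. They agree in all four cases.
  simp only [filled_pt, opSign]
  cases b.isNeg <;> by_cases hb : b ∈ s <;> simp [hb] <;> ring

end GenericData

end Exchange

end ToroidalGl2

namespace ToroidalGl2

/-! ### Products over the pairs of a list. -/

section PairProd

/-- The product of the values of `g` at the pairs of entries of a list. -/
def pairProd {α : Type*} (g : α → α → ℂ) : List α → ℂ
  | [] => 1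
  | a :: l => (l.map (g a)).prod * pairProd g l

variable {α : Type*} {g : α → α → ℂ}

theorem pairProd_perm (hg : ∀ a b, g a b = g b a) {l l' : List α} (h : l.Perm l') :
    pairProd g l = pairProd g l' := by
  induction h with
  | nil => rfl
  | cons a h ih => rw [pairProd, pairProd, ih, (h.map (g a)).prod_eq]
  | swap a b l => simp only [pairProd, List.map_cons, List.prod_cons, hg b a]; ring
  | trans _ _ h1 h2 => exact h1.trans h2

theorem pairProd_ne_zero {l : List α} (h : l.Pairwise fun a b => g a b ≠ 0) : pairProd g l ≠ 0 := by
  induction l with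
  | nil => exact one_ne_zero
  | cons a l ih =>
    rw [List.pairwise_cons] at h
    refine mul_ne_zero ?_ (ih h.2)
    rw [Ne, List.prod_eq_zero_iff, List.mem_map]
    rintro ⟨b, hb, h0⟩
    exact h.1 b hb h0

theorem pairProd_mul {g₁ g₂ : α → α → ℂ} {l : List α}
    (h : l.Pairwise fun a b => g a b = g₁ a b * g₂ a b) :
    pairProd g l = pairProd g₁ l * pairProd g₂ l := by
  induction l with
  | nil => simp [pairProd]
  | cons a l ih =>
    rw [List.pairwise_cons] at h
    rw [pairProd, pairProd, pairProd, ih h.2, List.map_congr_left h.1, List.prod_map_mul]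
    ring

theorem pairProd_append_eq_zero {l₁ l₂ : List α} {a b : α} (ha : a ∈ l₁) (hb : b ∈ l₂)
    (h : g a b = 0) : pairProd g (l₁ ++ l₂) = 0 := by
  induction l₁ with
  | nil => simp at ha
  | cons c l ih =>
    rw [List.cons_append, pairProd]
    rcases List.mem_cons.1 ha with rfl | ha
    · rw [List.prod_eq_zero, zero_mul]
      rw [List.mem_map]
      exact ⟨b, List.mem_append_right _ hb, h⟩
    · rw [ih ha, mul_zero]

end PairProd

/-! ### Products of one-box operators. -/

noncomputable section Words

/-- The result of adding or removing the boxes in a list, the last one first. -/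
def toggleList (s : Finset RBox) (L : List RBox) : Finset RBox := L.foldr (fun b t => toggle t b) s

theorem toggleList_cons (s : Finset RBox) (b : RBox) (L : List RBox) :
    toggleList s (b :: L) = toggle (toggleList s L) b := rfl

theorem toggleList_perm (s : Finset RBox) {L L' : List RBox} (h : L.Perm L') :
    toggleList s L = toggleList s L' := by
  induction h with
  | nil => rfl
  | cons a h ih => rw [toggleList_cons, toggleList_cons, ih]
  | swap a b l => simp only [toggleList_cons]; exact toggle_comm _ _ _
  | trans _ _ h1 h2 => exact h1.trans h2

theorem filled_toggleList {s : Finset RBox} {L : List RBox} (hL : L.Nodup) (a : Pt) :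
    filled (toggleList s L) a ↔ if ∃ b ∈ L, b.pt = a then ¬ filled s a else filled s a := by
  induction L with
  | nil => simp [toggleList]
  | cons b L ih =>
    rw [List.nodup_cons] at hL
    rw [toggleList_cons, filled_toggle]
    by_cases ha : a = b.pt
    · subst ha
      rw [if_pos rfl, ih hL.2, if_neg, if_pos ⟨b, List.mem_cons_self, rfl⟩]
      rintro ⟨c, hc, he⟩
      exact hL.1 (RBox.pt_injective he ▸ hc)
    · rw [if_neg ha, ih hL.2]
      have : (∃ c ∈ b :: L, c.pt = a) ↔ ∃ c ∈ L, c.pt = a := by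
        simp [List.mem_cons, Ne.symm ha]
      simp only [this]

theorem avail_toggle (e : Bool) (s : Finset RBox) (b c : RBox) :
    Avail e (toggle s c) b ↔ if b = c then ¬ Avail e s b else Avail e s b := by
  unfold Avail
  rw [filled_toggle]
  simp only [RBox.pt_inj]
  split_ifs <;> tauto

theorem avail_toggleList_of_notMem {e : Bool} {s : Finset RBox} {b : RBox} {L : List RBox}
    (hb : b ∉ L) : Avail e (toggleList s L) b ↔ Avail e s b := by
  induction L with
  | nil => rfl
  | cons c L ih =>
    rw [List.mem_cons, not_or] at hb
    rw [toggleList_cons, avail_toggle, if_neg hb.1, ih hb.2]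

theorem avail_toggleList_of_mem {e : Bool} {s : Finset RBox} {b : RBox} {L : List RBox}
    (hL : L.Nodup) (hb : b ∈ L) : Avail e (toggleList s L) b ↔ ¬ Avail e s b := by
  induction L with
  | nil => simp at hb
  | cons c L ih =>
    rw [List.nodup_cons] at hL
    rw [toggleList_cons, avail_toggle]
    by_cases hbc : b = c
    · subst hbc
      rw [if_pos rfl, avail_toggleList_of_notMem hL.1]
    · rw [if_neg hbc, ih hL.2 ((List.mem_cons.1 hb).resolve_left hbc)]

variable (lq ld μ ν : ℂ)

/-- The basis vector of a state, and zero for the finite sets which are not states. -/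
def ketOf (s : Finset RBox) : (relaxedData lq ld μ ν).Space :=
  if hs : Lower s then (relaxedData lq ld μ ν).ket ⟨s, (mem_states_iff lq ld μ ν s).2 hs⟩ else 0

/-- The part of the action of `F` (`e = true`) or `E` (`e = false`) involving the box `b`. -/
def boxOp (e : Bool) (b : RBox) : Module.End ℂ (relaxedData lq ld μ ν).Space :=
  Finsupp.linearCombination ℂ fun s =>
    if Avail e s b then opCoeff lq ld μ ν e s b • ketOf lq ld μ ν (toggle s b) else 0

theorem ketOf_eq_zero {s : Finset RBox} (hs : ¬ Lower s) : ketOf lq ld μ ν s = 0 := dif_neg hs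

theorem ket_eq (s : (relaxedData lq ld μ ν).states) :
    (relaxedData lq ld μ ν).ket s = ketOf lq ld μ ν s := by
  rw [ketOf, dif_pos ((mem_states_iff lq ld μ ν s).1 s.2)]

theorem boxOp_ketOf (e : Bool) (b : RBox) {s : Finset RBox} (hs : Lower s) :
    boxOp lq ld μ ν e b (ketOf lq ld μ ν s) =
      if Avail e s b then opCoeff lq ld μ ν e s b • ketOf lq ld μ ν (toggle s b) else 0 := by
  rw [ketOf, dif_pos hs, CombinatorialData.ket, boxOp, Finsupp.linearCombination_single, one_smul]

/-- Linear maps which agree on the basis vectors are equal. -/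
theorem linearMap_ext {M : Type*} [AddCommGroup M] [Module ℂ M]
    {f g : (relaxedData lq ld μ ν).Space →ₗ[ℂ] M}
    (hfg : ∀ s, Lower s → f (ketOf lq ld μ ν s) = g (ketOf lq ld μ ν s)) : f = g := by
  refine Finsupp.lhom_ext' fun s => LinearMap.ext_ring ?_
  have := hfg s ((mem_states_iff lq ld μ ν s).1 s.2)
  rwa [← ket_eq] at this

/-- The matrix coefficient of a product of the operators of several boxes. -/
def wordCoeff (e : Bool) (s : Finset RBox) : List RBox → ℂ
  | [] => 1
  | b :: L => if Avail e (toggleList s L) b ∧ Lower (toggleList s (b :: L)) then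
      wordCoeff e s L * opCoeff lq ld μ ν e (toggleList s L) b else 0

/-- Each step is guarded by the condition that the new set is a state. A box cannot recur, since
once changed it is no longer available to the same kind of operator. -/
theorem wordCoeff_ne_zero {e : Bool} {s : Finset RBox} (hs : Lower s) {L : List RBox}
    (hL : wordCoeff lq ld μ ν e s L ≠ 0) :
    L.Nodup ∧ (∀ b ∈ L, Avail e s b) ∧ ∀ L' : List RBox, L' <:+ L → Lower (toggleList s L') := by
  induction L with
  | nil =>
    refine ⟨List.nodup_nil, by simp, fun L' hL' => ?_⟩
    rw [List.suffix_nil.1 hL']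
    exact hs
  | cons b L ih =>
    rw [wordCoeff] at hL
    split_ifs at hL with hb
    · obtain ⟨h1, h2, h3⟩ := ih (left_ne_zero_of_mul hL)
      have hbL : b ∉ L := fun hm => ((avail_toggleList_of_mem h1 hm).1 hb.1) (h2 b hm)
      have hb' := (avail_toggleList_of_notMem hbL).1 hb.1
      refine ⟨List.nodup_cons.2 ⟨hbL, h1⟩, ?_, ?_⟩
      · intro c hc
        rcases List.mem_cons.1 hc with rfl | hc
        · exact hb'
        · exact h2 c hc
      · intro L' hL'
        rcases List.suffix_cons_iff.1 hL' with rfl | hL'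
        · exact hb.2
        · exact h3 L' hL'
    · exact absurd rfl hL

theorem prod_boxOp_ketOf (e : Bool) {s : Finset RBox} (hs : Lower s) (L : List RBox) :
    (L.map (boxOp lq ld μ ν e)).prod (ketOf lq ld μ ν s) =
      wordCoeff lq ld μ ν e s L • ketOf lq ld μ ν (toggleList s L) := by
  induction L with
  | nil => simp [wordCoeff, toggleList]
  | cons b L ih =>
    rw [List.map_cons, List.prod_cons, Module.End.mul_apply, ih, map_smul, wordCoeff]
    -- If the coefficient is already zero, the set reached may fail to be a state and `boxOp_ketOf`
    -- need not apply.
    by_cases hW : wordCoeff lq ld μ ν e s L = 0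
    · simp [hW]
    · rw [boxOp_ketOf _ _ _ _ _ _ ((wordCoeff_ne_zero lq ld μ ν hs hW).2.2 L (List.suffix_refl L)), toggleList_cons]
      by_cases hA : Avail e (toggleList s L) b
      · by_cases hl : Lower (toggle (toggleList s L) b)
        · rw [if_pos hA, if_pos ⟨hA, hl⟩, smul_smul]
        · rw [ketOf_eq_zero _ _ _ _ hl]; simp
      · rw [if_neg hA, if_neg (fun h => hA h.1)]; simp

variable {lq ld μ ν}

/-- Along a list of available boxes, the filled points change monotonically. -/
theorem filled_toggleList_of_avail {e : Bool} {s : Finset RBox} {L : List RBox} (hL : L.Nodup)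
    (hA : ∀ b ∈ L, Avail e s b) (a : Pt) : filled (toggleList s L) a ↔
      if e then filled s a ∨ ∃ b ∈ L, b.pt = a else filled s a ∧ ¬ ∃ b ∈ L, b.pt = a := by
  rw [filled_toggleList hL]
  by_cases hb : ∃ b ∈ L, b.pt = a
  · obtain ⟨b, hb, rfl⟩ := hb
    have h1 := hA b hb
    have h2 : ∃ c ∈ L, c.pt = b.pt := ⟨b, hb, rfl⟩
    unfold Avail at h1
    cases e <;> simp_all
  · cases e <;> simp [hb]

/-- A list leading from a state to a state, such that the boxes in the list cannot be added or
removed in this order, contains a pair for which the exchange function vanishes. -/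
theorem GenericData.pairProd_exchN_eq_zero (h : GenericData lq ld μ ν) {e : Bool} {s : Finset RBox}
    (hs : Lower s) {L₁ L₂ : List RBox} (hL : (L₁ ++ L₂).Nodup) (hA : ∀ b ∈ L₁ ++ L₂, Avail e s b)
    (ht : Lower (toggleList s (L₁ ++ L₂))) (hn : ¬ Lower (toggleList s L₂)) :
    pairProd (exchN lq ld μ ν e) (L₁ ++ L₂) = 0 := by
  have hL₂ := (List.nodup_append.1 hL).2.1
  have hA₂ : ∀ b ∈ L₂, Avail e s b := fun b hb => hA b (List.mem_append_right _ hb)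
  -- After L₂ some covering relation is violated, while it holds at the start and at the end. So one
  -- end of this pair is changed in L₂ and the other in L₁, in the order for which the exchange
  -- function vanishes.
  obtain ⟨a, x, y, hxy, h1, h2⟩ : ∃ (a : Pt) (x y : ℤ), (x = 1 ∧ y = 0 ∨ x = 0 ∧ y = 1) ∧
      filled (toggleList s L₂) (a.shift x y) ∧ ¬ filled (toggleList s L₂) a := by
    unfold Lower at hn
    push Not at hn
    obtain ⟨c, x, y, hn⟩ := hn
    by_cases h1 : filled (toggleList s L₂) (c, x + 1, y) ∧ ¬ filled (toggleList s L₂) (c, x, y)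
    · exact ⟨(c, x, y), 1, 0, by simp, by simpa [Pt.shift] using h1.1, h1.2⟩
    · have := hn (fun h3 => by tauto)
      exact ⟨(c, x, y), 0, 1, by simp, by simpa [Pt.shift] using this.1, this.2⟩
  have hlow : ∀ t : Finset RBox, Lower t → filled t (a.shift x y) → filled t a := by
    intro t ht hf
    rcases hxy with ⟨rfl, rfl⟩ | ⟨rfl, rfl⟩
    · simpa using ht.shift_x a 0 0 hf
    · simpa using ht.shift_y a 0 0 hf
  have hne : ∀ b c : RBox, b.pt = a → c.pt = a.shift x y → exch lq ld μ ν b.pt c.pt = 0 := by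
    intro b c hb hc
    rw [h.exch_eq_zero_iff, hb, hc]
    · rcases hxy with ⟨rfl, rfl⟩ | ⟨rfl, rfl⟩ <;> simp
    · rw [hb, hc, Ne, ← Pt.shift_zero a, Pt.shift_shift, Pt.shift_inj]; omega
  rw [filled_toggleList_of_avail hL₂ hA₂] at h1 h2
  have h3 := hlow s hs
  have h4 := hlow _ ht
  rw [filled_toggleList_of_avail hL hA, filled_toggleList_of_avail hL hA] at h4
  simp only [List.mem_append, or_and_right, exists_or] at h4
  cases e
  · simp only [Bool.false_eq_true, if_false] at h1 h2 h4
    obtain ⟨b, hb, hb'⟩ : ∃ b ∈ L₂, b.pt = a := by tauto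
    obtain ⟨c, hc, hc'⟩ : ∃ b ∈ L₁, b.pt = a.shift x y := by
      by_contra hc
      have h5 : ¬ ∃ c ∈ L₂, c.pt = a.shift x y := h1.2
      exact (h4 ⟨h1.1, not_or.2 ⟨hc, h5⟩⟩).2 (Or.inr ⟨b, hb, hb'⟩)
    exact pairProd_append_eq_zero hc hb (by simpa [exchN] using hne b c hb' hc')
  · simp only [if_true] at h1 h2 h4
    push Not at h2
    obtain ⟨c, hc, hc'⟩ : ∃ b ∈ L₂, b.pt = a.shift x y := h1.resolve_left fun h5 => h2.1 (h3 h5)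
    obtain ⟨b, hb, hb'⟩ : ∃ b ∈ L₁, b.pt = a := by
      rcases h4 (Or.inr (Or.inr ⟨c, hc, hc'⟩)) with h5 | h5 | ⟨b, hb, hb'⟩
      · exact absurd h5 h2.1
      · exact h5
      · exact absurd hb' (h2.2 b hb)
    exact pairProd_append_eq_zero hb hc (by simpa [exchN] using hne b c hb' hc')

/-- The matrix coefficient of a product of operators, if all intermediate sets are states. -/
theorem GenericData.wordCoeff_eq (h : GenericData lq ld μ ν) {e : Bool} {s : Finset RBox}
    {L : List RBox} (hL : L.Nodup) (hA : ∀ b ∈ L, Avail e s b)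
    (hc : ∀ L' : List RBox, L' <:+ L → Lower (toggleList s L')) :
    wordCoeff lq ld μ ν e s L =
      pairProd (exchTheta lq ld μ ν e) L * (L.map (opCoeff lq ld μ ν e s)).prod := by
  have key : ∀ (b : RBox) (L : List RBox), (b :: L).Nodup → (∀ c ∈ b :: L, Avail e s c) →
      (∀ L' : List RBox, L' <:+ L → Lower (toggleList s L')) →
      opCoeff lq ld μ ν e (toggleList s L) b =
        opCoeff lq ld μ ν e s b * (L.map (exchTheta lq ld μ ν e b)).prod := by
    intro b L
    induction L with
    | nil => intros; simp [toggleList]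
    | cons c L ih =>
      intro h1 h2 h3
      simp only [List.nodup_cons, List.mem_cons, not_or] at h1
      have h4 := ih (List.nodup_cons.2 ⟨h1.1.2, h1.2.2⟩)
        (fun d hd => h2 d (by rcases List.mem_cons.1 hd with rfl | hd <;> simp [*]))
        (fun L' hL' => h3 L' (hL'.trans (List.suffix_cons _ _)))
      rw [toggleList_cons, h.opCoeff_toggle (h3 L (List.suffix_cons _ _)) (h3 _ (List.suffix_refl _))
        ((avail_toggleList_of_notMem h1.1.2).2 (h2 b (by simp)))
        ((avail_toggleList_of_notMem h1.2.1).2 (h2 c (by simp))) h1.1.1, h4]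
      simp only [List.map_cons, List.prod_cons]
      ring
  induction L with
  | nil => simp [wordCoeff, pairProd]
  | cons b L ih =>
    have h1 := List.nodup_cons.1 hL
    have hc' : ∀ L' : List RBox, L' <:+ L → Lower (toggleList s L') :=
      fun L' hL' => hc L' (hL'.trans (List.suffix_cons _ _))
    rw [wordCoeff, if_pos ⟨(avail_toggleList_of_notMem h1.1).2 (hA b (by simp)),
      hc _ (List.suffix_refl _)⟩, ih h1.2 (fun c hc => hA c (by simp [hc])) hc',
      key b L hL hA hc', pairProd, List.map_cons, List.prod_cons]
    ring

/-- A list leading from a state to a state contains diagonal neighbours only if it contains two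
boxes of each colour. -/
theorem not_diagonal {e : Bool} {s : Finset RBox} (hs : Lower s) {L : List RBox} (hL : L.Nodup)
    (hA : ∀ b ∈ L, Avail e s b) (ht : Lower (toggleList s L)) {i : ZMod 2}
    (hi : ∀ b ∈ L, ∀ c ∈ L, b.pt.col = i → c.pt.col = i → b = c) {b c : RBox} (hb : b ∈ L)
    (hc : c ∈ L) : ¬ Diagonal b c := by
  have key : ∀ b ∈ L, ∀ c ∈ L, c.pt ≠ b.pt.shift 1 1 := by
    intro b hb c hc hbc
    have h1 := filled_toggleList_of_avail hL hA
    have hlow : ∀ t : Finset RBox, Lower t → (filled t (b.pt.shift 1 1) →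
        filled t (b.pt.shift 1 0) ∧ filled t (b.pt.shift 0 1)) ∧ (filled t (b.pt.shift 1 0) →
        filled t b.pt) ∧ (filled t (b.pt.shift 0 1) → filled t b.pt) := fun t ht =>
      ⟨fun h => ⟨ht.shift_y b.pt 1 0 h, ht.shift_x b.pt 0 1 h⟩,
        fun h => by simpa using ht.shift_x b.pt 0 0 h, fun h => by simpa using ht.shift_y b.pt 0 0 h⟩
    have h2 := hlow s hs
    have h3 := hlow _ ht
    have hbA := hA b hb
    have hcA := hA c hc
    have hb' : ∃ x ∈ L, x.pt = b.pt := ⟨b, hb, rfl⟩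
    have hc' : ∃ x ∈ L, x.pt = b.pt.shift 1 1 := ⟨c, hc, hbc⟩
    -- Both ends of a diagonal change between two ideals, so the two points in between change too.
    -- The four boxes form two pairs of equal colour, one for each colour.
    obtain ⟨⟨x, hx, hx'⟩, ⟨y, hy, hy'⟩⟩ : (∃ x ∈ L, x.pt = b.pt.shift 1 0) ∧
        ∃ y ∈ L, y.pt = b.pt.shift 0 1 := by
      unfold Avail at hbA hcA
      rw [hbc] at hcA
      rw [h1, h1, h1, h1] at h3
      cases e
      · simp only [Bool.false_eq_true, if_false, iff_true] at h3 hbA hcA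
        exact ⟨by_contra fun hn => (h3.2.1 ⟨(h2.1 hcA).1, hn⟩).2 hb',
          by_contra fun hn => (h3.2.2 ⟨(h2.1 hcA).2, hn⟩).2 hb'⟩
      · simp only [if_true, Bool.true_eq_false, iff_false] at h3 hbA hcA
        have h4 := h3.1 (Or.inr hc')
        exact ⟨h4.1.resolve_left fun h => hbA (h2.2.1 h),
          h4.2.resolve_left fun h => hbA (h2.2.2 h)⟩
    by_cases hib : b.pt.col = i
    · have := hi b hb y hy hib (by rw [hy', Pt.col_shift_even, hib])
      rw [← this, ← Pt.shift_zero b.pt, Pt.shift_shift, Pt.shift_inj] at hy'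
      omega
    · have hib' := (ZMod.two_ne_iff i b.pt.col).1 (Ne.symm hib)
      have := hi c hc x hx (by rw [hbc, Pt.col_shift_one, hib']) (by rw [hx', Pt.col_shift_one, hib'])
      rw [← this, hbc, Pt.shift_inj] at hx'
      omega
  rintro (h1 | h1)
  · exact key b hb c hc h1
  · exact key c hc b hb h1

/-- Up to the exchange functions, the product of the operators of several boxes does not depend on
their order. -/
theorem GenericData.exists_word (h : GenericData lq ld μ ν) (e : Bool) {s : Finset RBox}
    (hs : Lower s) (L : List RBox) {i : ZMod 2}
    (hi : ∀ b ∈ L, ∀ c ∈ L, b.pt.col = i → c.pt.col = i → b = c) :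
    ∃ X, ∀ L' : List RBox, L'.Perm L →
      (L'.map (boxOp lq ld μ ν e)).prod (ketOf lq ld μ ν s) =
        pairProd (exchN lq ld μ ν e) L' • X := by
  by_cases hL : L.Nodup ∧ (∀ b ∈ L, Avail e s b) ∧ Lower (toggleList s L)
  -- The common vector uses the coefficients at the initial state, divided by the symmetric part of
  -- the pair product, which is non-zero in the absence of diagonal neighbours. The remaining part,
  -- from `exchTheta`, is what an admissible word produces.
  · refine ⟨((pairProd (exchM lq ld μ ν e) L)⁻¹ * (L.map (opCoeff lq ld μ ν e s)).prod) •
      ketOf lq ld μ ν (toggleList s L), fun L' hp => ?_⟩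
    have h1 : L'.Nodup := hp.nodup_iff.2 hL.1
    have h2 : ∀ b ∈ L', Avail e s b := fun b hb => hL.2.1 b (hp.mem_iff.1 hb)
    have h3 : Lower (toggleList s L') := by rw [toggleList_perm s hp]; exact hL.2.2
    have hd : ∀ b ∈ L', ∀ c ∈ L', ¬ Diagonal b c := fun b hb c hc =>
      not_diagonal hs hL.1 hL.2.1 hL.2.2 hi (hp.mem_iff.1 hb) (hp.mem_iff.1 hc)
    rw [prod_boxOp_ketOf _ _ _ _ _ hs, toggleList_perm s hp, smul_smul]
    congr 1
    have hM : pairProd (exchM lq ld μ ν e) L' ≠ 0 := by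
      refine pairProd_ne_zero (List.Pairwise.imp_of_mem ?_ h1)
      intro b c hb hc hbc
      exact h.exchM_ne_zero hbc (hd b hb c hc)
    have hN : pairProd (exchN lq ld μ ν e) L' =
        pairProd (exchTheta lq ld μ ν e) L' * pairProd (exchM lq ld μ ν e) L' := by
      refine pairProd_mul (List.Pairwise.imp_of_mem ?_ h1)
      intro b c hb hc hbc
      exact h.exchN_eq (hd b hb c hc)
    rw [← pairProd_perm (exchM_symm lq ld μ ν e) hp]
    by_cases hc : ∀ L₂ : List RBox, L₂ <:+ L' → Lower (toggleList s L₂)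
    · rw [h.wordCoeff_eq h1 h2 hc, hN, (hp.map (opCoeff lq ld μ ν e s)).prod_eq]
      field_simp
    -- If the word passes through a non-state, its coefficient and its pair product both vanish.
    · have hW : wordCoeff lq ld μ ν e s L' = 0 :=
        by_contra fun hW => hc (wordCoeff_ne_zero lq ld μ ν hs hW).2.2
      push Not at hc
      obtain ⟨L₂, ⟨L₁, rfl⟩, hn⟩ := hc
      rw [h.pairProd_exchN_eq_zero hs h1 h2 h3 hn, zero_mul, hW]
  · refine ⟨0, fun L' hp => ?_⟩
    rw [prod_boxOp_ketOf _ _ _ _ _ hs, smul_zero]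
    by_cases hW : wordCoeff lq ld μ ν e s L' = 0
    · rw [hW, zero_smul]
    · obtain ⟨h1, h2, h3⟩ := wordCoeff_ne_zero lq ld μ ν hs hW
      exact absurd ⟨hp.nodup_iff.1 h1, fun b hb => h2 b (hp.mem_iff.2 hb),
        by rw [← toggleList_perm s hp]; exact h3 L' (List.suffix_refl L')⟩ hL

end Words

end ToroidalGl2

namespace ToroidalGl2

/-! ### The Serre expression and its scalar identity. -/

noncomputable section SerreAlgebra

variable {A : Type*} [Ring A] [Algebra ℂ A]

/-- The iterated commutator `[x, [y, [z, d]_p]]_{p⁻¹}`. -/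
def nestedComm (p : ℂ) (x y z d : A) : A :=
  x * (y * (z * d - p • (d * z)) - (1 : ℂ) • ((z * d - p • (d * z)) * y)) -
    p⁻¹ • ((y * (z * d - p • (d * z)) - (1 : ℂ) • ((z * d - p • (d * z)) * y)) * x)

/-- The symmetrization of the iterated commutator. -/
def symComm (p : ℂ) (x y z d : A) : A :=
  nestedComm p x y z d + nestedComm p x z y d + nestedComm p y x z d + nestedComm p y z x d
    + nestedComm p z x y d + nestedComm p z y x d

/-- The cubic expression whose symmetrization is the quantum Serre relation. -/
def serreCubic (p : ℂ) (x y z d : A) : A :=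
  p • (x * y * z * d) - (p ^ 2 + p + 1) • (x * y * d * z) + (p ^ 2 + p + 1) • (x * d * y * z)
    - p • (d * x * y * z)

/-- After symmetrization only the place of d in a word matters; collecting the terms gives p + 1 +
p⁻¹ in the middle, and the factor p clears the inverse. -/
theorem smul_symComm {p : ℂ} (hp : p ≠ 0) (x y z d : A) : p • symComm p x y z d =
    serreCubic p x y z d + serreCubic p x z y d + serreCubic p y x z d + serreCubic p y z x d
      + serreCubic p z x y d + serreCubic p z y x d := by
  simp only [symComm, nestedComm, serreCubic, mul_sub, sub_mul, smul_sub, mul_smul_comm,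
    smul_mul_assoc, smul_smul, smul_add, ← mul_assoc, mul_inv_cancel₀ hp, one_smul, one_mul]
  match_scalars <;> field_simp <;> ring

theorem nestedComm_add₁ (p : ℂ) (x x' y z d : A) :
    nestedComm p (x + x') y z d = nestedComm p x y z d + nestedComm p x' y z d := by
  simp only [nestedComm, add_mul, mul_add, smul_add]; abel

theorem nestedComm_add₂ (p : ℂ) (x y y' z d : A) :
    nestedComm p x (y + y') z d = nestedComm p x y z d + nestedComm p x y' z d := by
  simp only [nestedComm, add_mul, mul_add, mul_sub, sub_mul, smul_add, smul_sub]; abel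

theorem nestedComm_add₃ (p : ℂ) (x y z z' d : A) :
    nestedComm p x y (z + z') d = nestedComm p x y z d + nestedComm p x y z' d := by
  simp only [nestedComm, add_mul, mul_add, mul_sub, sub_mul, smul_add, smul_sub]; abel

theorem nestedComm_add₄ (p : ℂ) (x y z d d' : A) :
    nestedComm p x y z (d + d') = nestedComm p x y z d + nestedComm p x y z d' := by
  simp only [nestedComm, add_mul, mul_add, mul_sub, sub_mul, smul_add, smul_sub]; abel

theorem nestedComm_smul (p : ℂ) (x y z d : A) (c : ℂ) :
    nestedComm p (c • x) y z d = c • nestedComm p x y z d ∧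
    nestedComm p x (c • y) z d = c • nestedComm p x y z d ∧
    nestedComm p x y (c • z) d = c • nestedComm p x y z d ∧
    nestedComm p x y z (c • d) = c • nestedComm p x y z d := by
  simp only [nestedComm, mul_sub, sub_mul, smul_sub, mul_smul_comm, smul_mul_assoc, smul_smul,
    mul_comm c, one_mul, mul_one, mul_assoc, and_self]

theorem symComm_swap₁ (p : ℂ) (x y z d : A) : symComm p x y z d = symComm p y x z d := by
  simp only [symComm]; abel

theorem symComm_swap₂ (p : ℂ) (x y z d : A) : symComm p x y z d = symComm p z y x d := by
  simp only [symComm]; abel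

theorem symComm_eq_zero_of_span_left {p : ℂ} {S : Set A} {y z d : A}
    (h : ∀ x ∈ S, symComm p x y z d = 0) {x : A} (hx : x ∈ Submodule.span ℂ S) :
    symComm p x y z d = 0 := by
  induction hx using Submodule.span_induction with
  | mem x hx => exact h x hx
  | zero => simp [symComm, nestedComm]
  | add x x' _ _ h1 h2 =>
    have : symComm p (x + x') y z d = symComm p x y z d + symComm p x' y z d := by
      simp only [symComm, nestedComm_add₁, nestedComm_add₂, nestedComm_add₃]; abel
    rw [this, h1, h2, add_zero]
  | smul c x _ h1 =>
    have : symComm p (c • x) y z d = c • symComm p x y z d := by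
      simp only [symComm, nestedComm_smul, smul_add]
    rw [this, h1, smul_zero]

theorem symComm_eq_zero_of_span_right {p : ℂ} {S : Set A} {x y z : A}
    (h : ∀ d ∈ S, symComm p x y z d = 0) {d : A} (hd : d ∈ Submodule.span ℂ S) :
    symComm p x y z d = 0 := by
  induction hd using Submodule.span_induction with
  | mem x hx => exact h x hx
  | zero => simp [symComm, nestedComm]
  | add d d' _ _ h1 h2 =>
    have : symComm p x y z (d + d') = symComm p x y z d + symComm p x y z d' := by
      simp only [symComm, nestedComm_add₄]; abel
    rw [this, h1, h2, add_zero]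
  | smul c d _ h1 =>
    have : symComm p x y z (c • d) = c • symComm p x y z d := by
      simp only [symComm, nestedComm_smul, smul_add]
    rw [this, h1, smul_zero]

/-- The quantum Serre relation holds on linear spans. -/
theorem symComm_eq_zero_of_span {p : ℂ} {S T : Set A}
    (h : ∀ x ∈ S, ∀ y ∈ S, ∀ z ∈ S, ∀ d ∈ T, symComm p x y z d = 0) {x y z d : A}
    (hx : x ∈ Submodule.span ℂ S) (hy : y ∈ Submodule.span ℂ S) (hz : z ∈ Submodule.span ℂ S)
    (hd : d ∈ Submodule.span ℂ T) : symComm p x y z d = 0 := by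
  refine symComm_eq_zero_of_span_right (fun d hd => ?_) hd
  rw [symComm_swap₂]
  refine symComm_eq_zero_of_span_left (fun z hz => ?_) hz
  rw [symComm_swap₂, symComm_swap₁]
  refine symComm_eq_zero_of_span_left (fun y hy => ?_) hy
  rw [symComm_swap₁]
  exact symComm_eq_zero_of_span_left (fun x hx => h x hx y hy z hz d hd) hx

/-- The Serre relation with every word replaced by its pair product: N is the exchange function for
equal colours, G for different ones. Eliminating q₂ by q₁q₂q₃ = 1 and clearing denominators leaves a
polynomial identity. -/
theorem serre_identity {q1 q2 q3 w a b c : ℂ} (h : q1 * q2 * q3 = 1) (hab : a ≠ b) (hac : a ≠ c)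
    (hbc : b ≠ c) :
    let N : ℂ → ℂ → ℂ := fun u v => (u - q2 * v) / (u - v)
    let G : ℂ → ℂ → ℂ := fun u v => (u - q1 * v) * (u - q3 * v)
    let T : ℂ → ℂ → ℂ → ℂ := fun x y z => N x y * N x z * N y z *
      (q2 * (G x w * G y w * G z w) - (q2 ^ 2 + q2 + 1) * (G x w * G y w * G w z)
        + (q2 ^ 2 + q2 + 1) * (G x w * G w y * G w z) - q2 * (G w x * G w y * G w z))
    T a b c + T a c b + T b a c + T b c a + T c a b + T c b a = 0 := by
  intro N G T
  have h1 : a - b ≠ 0 := sub_ne_zero.2 hab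
  have h2 : a - c ≠ 0 := sub_ne_zero.2 hac
  have h3 : b - c ≠ 0 := sub_ne_zero.2 hbc
  have hq3 : q3 ≠ 0 := by rintro rfl; simp at h
  have hq1 : q1 ≠ 0 := by rintro rfl; simp at h
  obtain rfl : q2 = 1 / (q1 * q3) := by field_simp; linear_combination h
  simp only [T, N, G]
  rw [← neg_sub a b, ← neg_sub a c, ← neg_sub b c]
  field_simp
  ring

end SerreAlgebra

/-! ### Quadratic and Serre relations of one-box operators. -/

noncomputable section BoxRelations

variable (lq ld μ ν : ℂ)

/-- The polynomial `g_{i,j}(z, w)`. -/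
def gPoly (i j : ZMod 2) (z w : ℂ) : ℂ :=
  if i = j then z - q2 lq * w else (z - q1 lq ld * w) * (z - q3 lq ld * w)

variable {lq ld μ ν}

theorem exch_same {b c : RBox} (hbc : b.pt.col = c.pt.col) : exch lq ld μ ν b.pt c.pt =
    gPoly lq ld b.pt.col c.pt.col (posPt lq ld μ ν b.pt) (posPt lq ld μ ν c.pt) /
      (posPt lq ld μ ν b.pt - posPt lq ld μ ν c.pt) := by
  rw [exch, gPoly, if_pos hbc, if_pos hbc]

theorem exch_diff {b c : RBox} (hbc : b.pt.col ≠ c.pt.col) : exch lq ld μ ν b.pt c.pt =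
    gPoly lq ld b.pt.col c.pt.col (posPt lq ld μ ν b.pt) (posPt lq ld μ ν c.pt) := by
  rw [exch, gPoly, if_neg hbc, if_neg hbc]

/-- For equal colours the denominators of the two exchange functions are opposite; for different
colours the sign is −1. Either way the two terms cancel. -/
theorem gPoly_exch (b c : RBox) :
    sgn b.pt.col c.pt.col *
      gPoly lq ld c.pt.col b.pt.col (posPt lq ld μ ν c.pt) (posPt lq ld μ ν b.pt) *
        exch lq ld μ ν b.pt c.pt +
    gPoly lq ld b.pt.col c.pt.col (posPt lq ld μ ν b.pt) (posPt lq ld μ ν c.pt) *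
        exch lq ld μ ν c.pt b.pt = 0 := by
  by_cases hc : b.pt.col = c.pt.col
  · rw [exch_same hc, exch_same hc.symm, sgn, if_pos hc,
      ← neg_sub (posPt lq ld μ ν b.pt) (posPt lq ld μ ν c.pt), div_neg]
    ring
  · rw [exch_diff hc, exch_diff (Ne.symm hc), sgn, if_neg hc]
    ring

namespace GenericData

variable (h : GenericData lq ld μ ν)
include h

theorem exists_word_two (e : Bool) {s : Finset RBox} (hs : Lower s) (b c : RBox) :
    ∃ X, boxOp lq ld μ ν e b (boxOp lq ld μ ν e c (ketOf lq ld μ ν s)) =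
        exchN lq ld μ ν e b c • X ∧
      boxOp lq ld μ ν e c (boxOp lq ld μ ν e b (ketOf lq ld μ ν s)) =
        exchN lq ld μ ν e c b • X := by
  have hi : ∃ i : ZMod 2, ∀ x ∈ [b, c], ∀ y ∈ [b, c], x.pt.col = i → y.pt.col = i → x = y := by
    by_cases hbc : b.pt.col = c.pt.col
    -- For equal colours the uniqueness condition is vacuous for the other colour.
    · refine ⟨b.pt.col + 1, fun x hx y hy hx' hy' => ?_⟩
      have : x.pt.col = b.pt.col := by
        rcases List.mem_pair.1 hx with rfl | rfl
        · rfl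
        · exact hbc.symm
      rw [this] at hx'
      exact absurd hx'.symm (ZMod.two_add_one_ne _)
    · refine ⟨b.pt.col, fun x hx y hy hx' hy' => ?_⟩
      have : ∀ x ∈ [b, c], x.pt.col = b.pt.col → x = b := by
        intro x hx hx'
        rcases List.mem_pair.1 hx with rfl | rfl
        · rfl
        · exact absurd hx'.symm hbc
      rw [this x hx hx', this y hy hy']
  obtain ⟨i, hi⟩ := hi
  obtain ⟨X, hX⟩ := h.exists_word e hs [b, c] hi
  refine ⟨X, ?_, ?_⟩
  · simpa [pairProd] using hX [b, c] (List.Perm.refl _)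
  · simpa [pairProd] using hX [c, b] (List.Perm.swap _ _ _)

/-- The quadratic relations of `E`. -/
theorem boxOp_quadE (b c : RBox) :
    (sgn b.pt.col c.pt.col *
      gPoly lq ld b.pt.col c.pt.col (posPt lq ld μ ν b.pt) (posPt lq ld μ ν c.pt)) •
        (boxOp lq ld μ ν false b * boxOp lq ld μ ν false c) +
    gPoly lq ld c.pt.col b.pt.col (posPt lq ld μ ν c.pt) (posPt lq ld μ ν b.pt) •
        (boxOp lq ld μ ν false c * boxOp lq ld μ ν false b) = 0 := by
  refine linearMap_ext _ _ _ _ fun s hs => ?_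
  obtain ⟨X, h1, h2⟩ := h.exists_word_two false hs b c
  simp only [LinearMap.add_apply, LinearMap.smul_apply, Module.End.mul_apply, LinearMap.zero_apply,
    h1, h2, smul_smul, ← add_smul]
  have hg := gPoly_exch (lq := lq) (ld := ld) (μ := μ) (ν := ν) c b
  have hs : sgn c.pt.col b.pt.col = sgn b.pt.col c.pt.col := by simp [sgn, eq_comm]
  have hs2 : sgn b.pt.col c.pt.col * sgn b.pt.col c.pt.col = 1 := by unfold sgn; split_ifs <;> ring
  rw [hs] at hg
  have : sgn b.pt.col c.pt.col * gPoly lq ld b.pt.col c.pt.col (posPt lq ld μ ν b.pt)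
      (posPt lq ld μ ν c.pt) * exchN lq ld μ ν false b c +
      gPoly lq ld c.pt.col b.pt.col (posPt lq ld μ ν c.pt) (posPt lq ld μ ν b.pt) *
      exchN lq ld μ ν false c b = 0 := by
    simp only [exchN, Bool.false_eq_true, if_false]
    linear_combination hg
  rw [this, zero_smul]

/-- The quadratic relations of `F`. -/
theorem boxOp_quadF (b c : RBox) :
    (sgn b.pt.col c.pt.col *
      gPoly lq ld c.pt.col b.pt.col (posPt lq ld μ ν c.pt) (posPt lq ld μ ν b.pt)) •
        (boxOp lq ld μ ν true b * boxOp lq ld μ ν true c) +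
    gPoly lq ld b.pt.col c.pt.col (posPt lq ld μ ν b.pt) (posPt lq ld μ ν c.pt) •
        (boxOp lq ld μ ν true c * boxOp lq ld μ ν true b) = 0 := by
  refine linearMap_ext _ _ _ _ fun s hs => ?_
  obtain ⟨X, h1, h2⟩ := h.exists_word_two true hs b c
  simp only [LinearMap.add_apply, LinearMap.smul_apply, Module.End.mul_apply, LinearMap.zero_apply,
    h1, h2, smul_smul, ← add_smul]
  have hg := gPoly_exch (lq := lq) (ld := ld) (μ := μ) (ν := ν) b c
  simp only [exchN, if_true]
  rw [hg, zero_smul]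

/-- The Serre relations. -/
theorem boxOp_serre (e : Bool) {x y z d : RBox} (hxy : x.pt.col = y.pt.col)
    (hxz : x.pt.col = z.pt.col) (hd : x.pt.col ≠ d.pt.col) :
    symComm (q2 lq) (boxOp lq ld μ ν e x) (boxOp lq ld μ ν e y) (boxOp lq ld μ ν e z)
      (boxOp lq ld μ ν e d) = 0 := by
  have h2 := q2_ne_zero lq
  suffices hsuff : q2 lq • symComm (q2 lq) (boxOp lq ld μ ν e x) (boxOp lq ld μ ν e y)
      (boxOp lq ld μ ν e z) (boxOp lq ld μ ν e d) = 0 from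
    (smul_eq_zero.1 hsuff).resolve_left h2
  rw [smul_symComm h2]
  refine linearMap_ext _ _ _ _ fun s hs => ?_
  have hcol : ∀ b ∈ [x, y, z, d], b.pt.col = d.pt.col → b = d := by
    intro b hb hb'
    simp only [List.mem_cons, List.not_mem_nil, or_false] at hb
    rcases hb with rfl | rfl | rfl | rfl
    · exact absurd hb' hd
    · exact absurd hb' (hxy ▸ hd)
    · exact absurd hb' (hxz ▸ hd)
    · rfl
  -- Only d has its colour among the four boxes, so diagonal neighbours cannot occur.
  obtain ⟨X, hX⟩ := h.exists_word e hs [x, y, z, d] (i := d.pt.col)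
    fun b hb c hc hb' hc' => by rw [hcol b hb hb', hcol c hc hc']
  have hw : ∀ a b c f : RBox, [a, b, c, f].Perm [x, y, z, d] →
      boxOp lq ld μ ν e a (boxOp lq ld μ ν e b (boxOp lq ld μ ν e c (boxOp lq ld μ ν e f
        (ketOf lq ld μ ν s)))) =
      (exchN lq ld μ ν e a b * exchN lq ld μ ν e a c * exchN lq ld μ ν e a f *
        (exchN lq ld μ ν e b c * exchN lq ld μ ν e b f) * exchN lq ld μ ν e c f) • X := by
    intro a b c f hp
    have := hX _ hp
    simpa [pairProd, mul_assoc] using this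
  have hcub : ∀ a b c : RBox, [a, b, c].Perm [x, y, z] →
      serreCubic (q2 lq) (boxOp lq ld μ ν e a) (boxOp lq ld μ ν e b) (boxOp lq ld μ ν e c)
        (boxOp lq ld μ ν e d) (ketOf lq ld μ ν s) =
      (exchN lq ld μ ν e a b * exchN lq ld μ ν e a c * exchN lq ld μ ν e b c *
        (q2 lq * (exchN lq ld μ ν e a d * exchN lq ld μ ν e b d * exchN lq ld μ ν e c d)
        - (q2 lq ^ 2 + q2 lq + 1) * (exchN lq ld μ ν e a d * exchN lq ld μ ν e b d * exchN lq ld μ ν e d c)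
        + (q2 lq ^ 2 + q2 lq + 1) * (exchN lq ld μ ν e a d * exchN lq ld μ ν e d b * exchN lq ld μ ν e d c)
        - q2 lq * (exchN lq ld μ ν e d a * exchN lq ld μ ν e d b * exchN lq ld μ ν e d c))) • X := by
    intro a b c hp
    have p0 : [a, b, c, d].Perm [x, y, z, d] := hp.append_right [d]
    have p1 : [a, b, d, c].Perm [x, y, z, d] :=
      (((List.Perm.swap c d []).cons b).cons a).trans p0
    have p2 : [a, d, b, c].Perm [x, y, z, d] := ((List.Perm.swap b d [c]).cons a).trans p1
    have p3 : [d, a, b, c].Perm [x, y, z, d] := (List.Perm.swap a d [b, c]).trans p2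
    simp only [serreCubic, LinearMap.add_apply, LinearMap.sub_apply, LinearMap.smul_apply,
      Module.End.mul_apply, hw _ _ _ _ p0, hw _ _ _ _ p1, hw _ _ _ _ p2, hw _ _ _ _ p3, smul_smul,
      ← sub_smul, ← add_smul]
    congr 1
    ring
  have q0 : [x, z, y].Perm [x, y, z] := (List.Perm.swap y z []).cons x
  have q1' : [y, x, z].Perm [x, y, z] := List.Perm.swap x y [z]
  have q2' : [y, z, x].Perm [x, y, z] := ((List.Perm.swap x z []).cons y).trans q1'
  have q3' : [z, x, y].Perm [x, y, z] := (List.Perm.swap x z [y]).trans q0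
  have q4 : [z, y, x].Perm [x, y, z] := ((List.Perm.swap x y []).cons z).trans q3'
  simp only [LinearMap.add_apply, LinearMap.zero_apply, hcub _ _ _ (List.Perm.refl _),
    hcub _ _ _ q0, hcub _ _ _ q1', hcub _ _ _ q2', hcub _ _ _ q3', hcub _ _ _ q4, ← add_smul]
  -- Division by zero has the default value 0. So the pair products vanish when two boxes coincide,
  -- in accordance with a box not being added twice.
  have hN0 : ∀ b : RBox, exchN lq ld μ ν e b b = 0 := by
    intro b; cases e <;> simp [exchN, exch]
  by_cases exy : x = y
  · subst exy; simp [hN0]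
  by_cases exz : x = z
  · subst exz; simp [hN0]
  by_cases eyz : y = z
  · subst eyz; simp [hN0]
  have hne : ∀ {b c : RBox}, b ≠ c → posPt lq ld μ ν b.pt ≠ posPt lq ld μ ν c.pt :=
    fun hbc => h.posPt_ne fun he => hbc (RBox.pt_injective he)
  have dx : ¬ x.pt.col = d.pt.col := hd
  have dy : ¬ y.pt.col = d.pt.col := hxy ▸ hd
  have dz : ¬ z.pt.col = d.pt.col := hxz ▸ hd
  have same : ∀ b c : RBox, b.pt.col = c.pt.col → exch lq ld μ ν b.pt c.pt =
      (posPt lq ld μ ν b.pt - q2 lq * posPt lq ld μ ν c.pt) /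
        (posPt lq ld μ ν b.pt - posPt lq ld μ ν c.pt) := fun b c hbc => if_pos hbc
  have diff : ∀ b c : RBox, ¬ b.pt.col = c.pt.col → exch lq ld μ ν b.pt c.pt =
      (posPt lq ld μ ν b.pt - q1 lq ld * posPt lq ld μ ν c.pt) *
        (posPt lq ld μ ν b.pt - q3 lq ld * posPt lq ld μ ν c.pt) := fun b c hbc => if_neg hbc
  have hs := serre_identity (w := posPt lq ld μ ν d.pt) (q1_mul_q2_mul_q3 lq ld) (hne exy) (hne exz)
    (hne eyz)
  simp only [← same x y hxy, ← same y x hxy.symm, ← same x z hxz, ← same z x hxz.symm,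
    ← same y z (hxy.symm.trans hxz), ← same z y (hxz.symm.trans hxy), ← diff x d dx, ← diff y d dy,
    ← diff z d dz, ← diff d x (Ne.symm dx), ← diff d y (Ne.symm dy), ← diff d z (Ne.symm dz)] at hs
  rw [← zero_smul ℂ X]
  congr 1
  cases e
  -- For E the arguments of the exchange function are interchanged, which amounts to reversing the
  -- words; the cubic coefficients are antisymmetric under reversal, hence the minus sign.
  · simp only [exchN, Bool.false_eq_true, if_false]
    generalize exch lq ld μ ν x.pt y.pt = xy, exch lq ld μ ν y.pt x.pt = yx,
      exch lq ld μ ν x.pt z.pt = xz, exch lq ld μ ν z.pt x.pt = zx,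
      exch lq ld μ ν y.pt z.pt = yz, exch lq ld μ ν z.pt y.pt = zy,
      exch lq ld μ ν x.pt d.pt = xd, exch lq ld μ ν y.pt d.pt = yd,
      exch lq ld μ ν z.pt d.pt = zd, exch lq ld μ ν d.pt x.pt = dx',
      exch lq ld μ ν d.pt y.pt = dy', exch lq ld μ ν d.pt z.pt = dz' at hs ⊢
    linear_combination -hs
  · exact hs

end GenericData

end BoxRelations

end ToroidalGl2

namespace ToroidalGl2

/-! ### Commutators of E and F, and expansions of the weights. -/

noncomputable section Commutator

variable {lq ld μ ν : ℂ}

theorem Lower.of_and {s t u : Finset RBox} (hs : Lower s) (ht : Lower t)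
    (hu : ∀ a, filled u a ↔ filled s a ∧ filled t a) : Lower u := by
  intro c x y
  simp only [hu]
  exact ⟨fun h => ⟨(hs c x y).1 h.1, (ht c x y).1 h.2⟩, fun h => ⟨(hs c x y).2 h.1, (ht c x y).2 h.2⟩⟩

theorem Lower.of_or {s t u : Finset RBox} (hs : Lower s) (ht : Lower t)
    (hu : ∀ a, filled u a ↔ filled s a ∨ filled t a) : Lower u := by
  intro c x y
  simp only [hu]
  exact ⟨fun h => h.imp (hs c x y).1 (ht c x y).1, fun h => h.imp (hs c x y).2 (ht c x y).2⟩

/-- Adding a box commutes with removing another one. -/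
theorem lower_toggle_iff {s : Finset RBox} {b c : RBox} (hs : Lower s) (hb : filled s b.pt)
    (hc : ¬ filled s c.pt) (ht : Lower (toggle (toggle s c) b)) :
    Lower (toggle s c) ↔ Lower (toggle s b) := by
  have hbc : b.pt ≠ c.pt := fun he => hc (he ▸ hb)
  constructor <;> intro _
  -- Removing b gives the intersection of s with the final ideal, and adding c gives their union.
  · refine hs.of_and ht fun a => ?_
    simp only [filled_toggle]
    split_ifs with h1 h2 <;> simp_all
  · refine hs.of_or ht fun a => ?_
    simp only [filled_toggle]
    split_ifs with h1 h2 <;> simp_all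

theorem boxOp_boxOp_ketOf (e e' : Bool) {b c : RBox} (hbc : b ≠ c) {s : Finset RBox}
    (hs : Lower s) :
    boxOp lq ld μ ν e b (boxOp lq ld μ ν e' c (ketOf lq ld μ ν s)) =
      if Avail e s b ∧ Avail e' s c ∧ Lower (toggle s c) then
        (opCoeff lq ld μ ν e' s c * opCoeff lq ld μ ν e (toggle s c) b) •
          ketOf lq ld μ ν (toggle (toggle s c) b) else 0 := by
  rw [boxOp_ketOf _ _ _ _ _ _ hs]
  by_cases h1 : Avail e' s c
  · by_cases h2 : Lower (toggle s c)
    · have hiff : Avail e (toggle s c) b ↔ Avail e s b := by rw [avail_toggle, if_neg hbc]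
      rw [if_pos h1, map_smul, boxOp_ketOf _ _ _ _ _ _ h2]
      simp only [hiff]
      by_cases h3 : Avail e s b <;> simp [h1, h2, h3, smul_smul]
    · rw [ketOf_eq_zero _ _ _ _ h2]; simp [h2]
  · simp [h1]

namespace GenericData

variable (h : GenericData lq ld μ ν)
include h

/-- The operators `E` and `F` of different boxes commute. -/
theorem boxOp_comm {b c : RBox} (hbc : b ≠ c) :
    boxOp lq ld μ ν false b * boxOp lq ld μ ν true c =
      boxOp lq ld μ ν true c * boxOp lq ld μ ν false b := by
  refine linearMap_ext _ _ _ _ fun s hs => ?_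
  rw [Module.End.mul_apply, Module.End.mul_apply, boxOp_boxOp_ketOf _ _ hbc hs,
    boxOp_boxOp_ketOf _ _ hbc.symm hs, toggle_comm s b c]
  by_cases ht : Lower (toggle (toggle s c) b)
  swap
  · rw [ketOf_eq_zero _ _ _ _ ht]; simp
  by_cases hA : Avail false s b ∧ Avail true s c
  swap
  · rw [if_neg (by tauto), if_neg (by tauto)]
  have hb : filled s b.pt := by simpa [Avail] using hA.1
  have hc : ¬ filled s c.pt := by simpa [Avail] using hA.2
  have hiff := lower_toggle_iff hs hb hc ht
  by_cases hl : Lower (toggle s c)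
  swap
  · rw [if_neg (by tauto), if_neg (by tauto)]
  have hl' := hiff.1 hl
  rw [if_pos ⟨hA.1, hA.2, hl⟩, if_pos ⟨hA.2, hA.1, hl'⟩]
  congr 1
  -- The exchange rule needs both boxes available to the same operator, so it is applied from the
  -- neighbouring state back to s; the two resulting ratios coincide.
  have e1 := h.opCoeff_toggle (e := false) (s := toggle s c) (b := b) (c := c) hl
    (by rw [toggle_toggle]; exact hs) (by rw [avail_toggle, if_neg hbc]; exact hA.1)
    (by rw [avail_toggle, if_pos rfl]; simpa [Avail] using hc) hbc
  have e2 := h.opCoeff_toggle (e := true) (s := toggle s b) (b := c) (c := b) hl'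
    (by rw [toggle_toggle]; exact hs) (by rw [avail_toggle, if_neg hbc.symm]; exact hA.2)
    (by rw [avail_toggle, if_pos rfl]; simpa [Avail] using hb) hbc.symm
  have e3 : exchTheta lq ld μ ν true c b = exchTheta lq ld μ ν false b c := by
    simp [exchTheta, After, exchN]
  rw [toggle_toggle] at e1 e2
  rw [e1, e2, e3]
  ring

/-- The commutator of the operators `E` and `F` of a box. -/
theorem boxOp_commutator (b : RBox) {s : Finset RBox} (hs : Lower s) :
    boxOp lq ld μ ν false b (boxOp lq ld μ ν true b (ketOf lq ld μ ν s)) -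
      boxOp lq ld μ ν true b (boxOp lq ld μ ν false b (ketOf lq ld μ ν s)) =
    (open Classical in if IsCorner s b then 1 / (q lq - (q lq)⁻¹) *
      residue ((relaxedData lq ld μ ν).phi lq ld s b.pt.col / RatFunc.X) (posPt lq ld μ ν b.pt)
      else 0) • ketOf lq ld μ ν s := by
  have key : ∀ e : Bool, boxOp lq ld μ ν (!e) b (boxOp lq ld μ ν e b (ketOf lq ld μ ν s)) =
      if Avail e s b ∧ Lower (toggle s b) then
        (opCoeff lq ld μ ν e s b * opCoeff lq ld μ ν (!e) s b) • ketOf lq ld μ ν s else 0 := by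
    intro e
    rw [boxOp_ketOf _ _ _ _ _ _ hs]
    by_cases h1 : Avail e s b
    · by_cases h2 : Lower (toggle s b)
      · have h3 : Avail (!e) (toggle s b) b := by
          rw [avail_toggle, if_pos rfl]
          unfold Avail at h1 ⊢
          cases e <;> simp_all
        rw [if_pos h1, map_smul, boxOp_ketOf _ _ _ _ _ _ h2, if_pos h3, if_pos ⟨h1, h2⟩, smul_smul,
          toggle_toggle, opCoeff_toggle_self]
      · rw [ketOf_eq_zero _ _ _ _ h2]; simp [h2]
    · simp [h1]
  have k1 := key true
  have k2 := key false
  simp only [Bool.not_true, Bool.not_false] at k1 k2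
  rw [k1, k2]
  by_cases hc : IsCorner s b
  · have hl := (hs.isCorner_iff b).1 hc
    rw [if_pos hc, ← h.opCoeff_mul_opCoeff hc]
    by_cases hf : filled s b.pt
    · simp [Avail, hf, hl, mul_comm]
    · simp [Avail, hf, hl]
  · have hl : ¬ Lower (toggle s b) := fun h' => hc ((hs.isCorner_iff b).2 h')
    simp [hc, hl]

/-- The finite set of corners of colour `i`. -/
def corners (s : Finset RBox) (i : ZMod 2) : Finset RBox := (h.finite_corners s i).toFinset

theorem mem_corners {s : Finset RBox} {i : ZMod 2} {b : RBox} :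
    b ∈ h.corners s i ↔ b.pt.col = i ∧ IsCorner s b := by
  rw [corners, Set.Finite.mem_toFinset]; rfl

/-- The difference of the two expansions of the weight of a state. -/
theorem coeff_phi_sub {s : Finset RBox} (hs : Lower s) (i : ZMod 2) (n : ℤ) :
    coeffInfty ((relaxedData lq ld μ ν).phi lq ld s i) n -
      coeffZero ((relaxedData lq ld μ ν).phi lq ld s i) (-n) =
    ∑ b ∈ h.corners s i, residue ((relaxedData lq ld μ ν).phi lq ld s i / RatFunc.X)
      (posPt lq ld μ ν b.pt) * posPt lq ld μ ν b.pt ^ n := by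
  classical
  obtain ⟨u, hu, hB⟩ := exists_balancedData_phi lq ld μ ν s
  have hne := phi_ne_zero lq ld μ ν s i
  have hinj : Function.Injective fun b : RBox => posPt lq ld μ ν b.pt :=
    h.posPt_injective.comp RBox.pt_injective
  have hord : ∀ a, -1 ≤ ordAt a ((relaxedData lq ld μ ν).phi lq ld s i) ∧
      (a ∉ (h.corners s i).image (fun b : RBox => posPt lq ld μ ν b.pt) →
        0 ≤ ordAt a ((relaxedData lq ld μ ν).phi lq ld s i)) := by
    intro a
    by_cases ha : ∃ p, posPt lq ld μ ν p = a
    · obtain ⟨p, rfl⟩ := ha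
      rw [h.ordAt_phi]
      obtain ⟨h1, h2⟩ := hs.cornerOrd p
      split_ifs with hp
      · refine ⟨h1, fun hn => ?_⟩
        by_contra h3
        obtain ⟨h4, h5⟩ := h2 (by omega)
        obtain ⟨b, rfl⟩ := exists_box_of_corner h4 h5
        exact hn (Finset.mem_image.2 ⟨b, h.mem_corners.2 ⟨hp, h4, h5⟩, rfl⟩)
      · simp
    · push Not at ha
      rw [ordAt_phi_not a ha]
      simp
  rw [coeffInfty_sub_coeffZero ((h.corners s i).image fun b : RBox => posPt lq ld μ ν b.pt) _
    (hB i).degree.le ?_ ?_ ?_ n, Finset.sum_image fun _ _ _ _ he => hinj he]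
  · intro h0
    obtain ⟨b, -, hb⟩ := Finset.mem_image.1 h0
    exact posPt_ne_zero _ _ _ _ _ hb
  · intro a _
    refine regularAt_of_ordAt ?_
    rw [ordAt_mul_lin hne]
    linarith [(hord a).1]
  · intro a ha
    exact regularAt_of_ordAt ((hord a).2 ha)

end GenericData

end Commutator

/-! ### The action of the free algebra with finitely many boxes. -/

noncomputable section Representation

variable (lq ld μ ν : ℂ)

/-- The coefficient of `z ^ (-k)` in the action of `F_i(z)` (`e = true`) or `E_i(z)`
(`e = false`), restricted to the boxes in `R`. -/
def fieldOn (R : Finset RBox) (e : Bool) (i : ZMod 2) (k : ℤ) :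
    Module.End ℂ (relaxedData lq ld μ ν).Space :=
  ∑ b ∈ R with b.pt.col = i, posPt lq ld μ ν b.pt ^ k • boxOp lq ld μ ν e b

/-- The diagonal operator with the given eigenvalues. -/
def diagOp (f : Finset RBox → ℂ) : Module.End ℂ (relaxedData lq ld μ ν).Space :=
  Finsupp.linearCombination ℂ fun s => f s • (relaxedData lq ld μ ν).ket s

theorem diagOp_ketOf (f : Finset RBox → ℂ) (s : Finset RBox) :
    diagOp lq ld μ ν f (ketOf lq ld μ ν s) = f s • ketOf lq ld μ ν s := by
  by_cases hs : Lower s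
  · rw [ketOf, dif_pos hs]
    simp [diagOp, CombinatorialData.ket]
  · rw [ketOf_eq_zero _ _ _ _ hs]; simp

/-- The action of the generators, given the operators for `F` and `E`. -/
def genAction (τ : ℂ) (X : Bool → ZMod 2 → ℤ → Module.End ℂ (relaxedData lq ld μ ν).Space) :
    Gen → Module.End ℂ (relaxedData lq ld μ ν).Space
  | .E i k => X false i k
  | .F i k => X true i k
  | .Kplus i r => diagOp lq ld μ ν fun s => coeffInfty ((relaxedData lq ld μ ν).phi lq ld s i) r
  | .Kminus i r => diagOp lq ld μ ν fun s => coeffZero ((relaxedData lq ld μ ν).phi lq ld s i) r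
  | .t => algebraMap ℂ _ τ
  | .tInv => algebraMap ℂ _ τ⁻¹

/-- The representation of the free algebra, restricted to the boxes in `R`. -/
def repOn (τ : ℂ) (R : Finset RBox) : FreeGen →ₐ[ℂ] Module.End ℂ (relaxedData lq ld μ ν).Space :=
  FreeAlgebra.lift ℂ (genAction lq ld μ ν τ (fieldOn lq ld μ ν R))

theorem repOn_Kplus (τ : ℂ) (R : Finset RBox) (i : ZMod 2) (k : ℤ) :
    repOn lq ld μ ν τ R (FreeGen.Kplus i k) =
      diagOp lq ld μ ν fun s => coeffInfty ((relaxedData lq ld μ ν).phi lq ld s i) k := by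
  unfold FreeGen.Kplus
  split_ifs with hk
  · rw [repOn, FreeAlgebra.lift_ι_apply, genAction]
    simp [hk]
  · refine linearMap_ext _ _ _ _ fun s _ => ?_
    obtain ⟨u, -, hB⟩ := exists_balancedData_phi lq ld μ ν s
    rw [diagOp_ketOf, (hB i).coeffInfty_neg (by omega)]
    simp

theorem repOn_Kminus (τ : ℂ) (R : Finset RBox) (i : ZMod 2) (k : ℤ) :
    repOn lq ld μ ν τ R (FreeGen.Kminus i k) =
      diagOp lq ld μ ν fun s => coeffZero ((relaxedData lq ld μ ν).phi lq ld s i) (-k) := by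
  unfold FreeGen.Kminus
  split_ifs with hk
  · rw [repOn, FreeAlgebra.lift_ι_apply, genAction]
    simp [hk]
  · refine linearMap_ext _ _ _ _ fun s _ => ?_
    obtain ⟨u, -, hB⟩ := exists_balancedData_phi lq ld μ ν s
    rw [diagOp_ketOf, (hB i).coeffZero_neg (by omega)]
    simp

theorem repOn_E (τ : ℂ) (R : Finset RBox) (i : ZMod 2) (k : ℤ) :
    repOn lq ld μ ν τ R (FreeGen.E i k) = fieldOn lq ld μ ν R false i k :=
  FreeAlgebra.lift_ι_apply _ _

theorem repOn_F (τ : ℂ) (R : Finset RBox) (i : ZMod 2) (k : ℤ) :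
    repOn lq ld μ ν τ R (FreeGen.F i k) = fieldOn lq ld μ ν R true i k :=
  FreeAlgebra.lift_ι_apply _ _

end Representation

/-! ### From one-box relations to relations of currents. -/

noncomputable section FieldRelations

/-- The coefficients of `g_{i,j}(z,w) M(z,w)` in an algebra. -/
theorem map_gMul {A : Type*} [Ring A] [Algebra ℂ A] (ψ : FreeGen →ₐ[ℂ] A) (lq ld : ℂ)
    (i j : ZMod 2) (M : ℤ → ℤ → FreeGen) (k l : ℤ) : ψ (gMul lq ld i j M k l) =
      if i = j then ψ (M (k + 1) l) - q2 lq • ψ (M k (l + 1))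
      else ψ (M (k + 2) l) - (q1 lq ld + q3 lq ld) • ψ (M (k + 1) (l + 1))
        + (q1 lq ld * q3 lq ld) • ψ (M k (l + 2)) := by
  unfold gMul
  split_ifs <;> simp

/-- The coefficients of `g_{i,j}(z,w) M(z,w)`, where `M` is a combination of delta functions. -/
theorem map_gMul_sum {A : Type*} [Ring A] [Algebra ℂ A] (ψ : FreeGen →ₐ[ℂ] A) (lq ld : ℂ)
    (i j : ZMod 2) (M : ℤ → ℤ → FreeGen) {ι : Type*} (S : Finset ι) (u v : ι → ℂ) (a : ι → A)
    (hu : ∀ x ∈ S, u x ≠ 0) (hv : ∀ x ∈ S, v x ≠ 0)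
    (hM : ∀ k l, ψ (M k l) = ∑ x ∈ S, (u x ^ k * v x ^ l) • a x) (k l : ℤ) :
    ψ (gMul lq ld i j M k l) =
      ∑ x ∈ S, (u x ^ k * v x ^ l * gPoly lq ld i j (u x) (v x)) • a x := by
  rw [map_gMul]
  simp only [hM, Finset.smul_sum, ← Finset.sum_sub_distrib, ← Finset.sum_add_distrib, smul_smul,
    ← sub_smul, ← add_smul, gPoly]
  split_ifs
  · refine Finset.sum_congr rfl fun x hx => ?_
    congr 1
    rw [zpow_add₀ (hu x hx), zpow_add₀ (hv x hx), zpow_one, zpow_one]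
    ring
  · refine Finset.sum_congr rfl fun x hx => ?_
    congr 1
    rw [zpow_add₀ (hu x hx), zpow_add₀ (hv x hx), zpow_add₀ (hu x hx), zpow_add₀ (hv x hx), zpow_one,
      zpow_one, zpow_ofNat, zpow_ofNat]
    ring

theorem map_serre {A : Type*} [Ring A] [Algebra ℂ A] (ψ : FreeGen →ₐ[ℂ] A) (lq : ℂ) (X Y : ℤ → FreeGen)
    (k : Fin 3 → ℤ) (l : ℤ) : ψ (serre lq X Y k l) =
      (1 / 6 : ℂ) • symComm (q2 lq) (ψ (X (k 0))) (ψ (X (k 1))) (ψ (X (k 2))) (ψ (Y l)) := by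
  have huniv : (Finset.univ : Finset (Equiv.Perm (Fin 3))) =
      {1, Equiv.swap 1 2, Equiv.swap 0 1, finRotate 3, (finRotate 3)⁻¹, Equiv.swap 0 2} := by decide
  have hq : ∀ (p : ℂ) (A B : FreeGen), ψ (qComm p A B) = ψ A * ψ B - p • (ψ B * ψ A) := by
    intro p A B
    simp [qComm]
  rw [serre, map_smul, map_sum, huniv]
  congr 1
  rw [Finset.sum_insert (by decide), Finset.sum_insert (by decide), Finset.sum_insert (by decide),
    Finset.sum_insert (by decide), Finset.sum_insert (by decide), Finset.sum_singleton]
  have v1 : (∀ i, (Equiv.swap 1 2 : Equiv.Perm (Fin 3)) i = ![0, 2, 1] i) ∧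
      (∀ i, (Equiv.swap 0 1 : Equiv.Perm (Fin 3)) i = ![1, 0, 2] i) ∧
      (∀ i, (finRotate 3 : Equiv.Perm (Fin 3)) i = ![1, 2, 0] i) ∧
      (∀ i, ((finRotate 3)⁻¹ : Equiv.Perm (Fin 3)) i = ![2, 0, 1] i) ∧
      (∀ i, (Equiv.swap 0 2 : Equiv.Perm (Fin 3)) i = ![2, 1, 0] i) := by decide
  simp only [hq, v1.1, v1.2.1, v1.2.2.1, v1.2.2.2.1, v1.2.2.2.2, Matrix.cons_val, Equiv.Perm.coe_one, id_eq, symComm, nestedComm, q2]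
  abel

variable {lq ld μ ν : ℂ}

theorem fieldOn_mul_fieldOn (R : Finset RBox) (e e' : Bool) (i j : ZMod 2) (k l : ℤ) :
    fieldOn lq ld μ ν R e i k * fieldOn lq ld μ ν R e' j l =
      ∑ x ∈ (R.filter (·.pt.col = i)) ×ˢ (R.filter (·.pt.col = j)),
        (posPt lq ld μ ν x.1.pt ^ k * posPt lq ld μ ν x.2.pt ^ l) •
          (boxOp lq ld μ ν e x.1 * boxOp lq ld μ ν e' x.2) := by
  rw [fieldOn, fieldOn, Finset.sum_mul_sum, Finset.sum_product]
  simp only [smul_mul_smul_comm]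

theorem fieldOn_mul_fieldOn' (R : Finset RBox) (e e' : Bool) (i j : ZMod 2) (k l : ℤ) :
    fieldOn lq ld μ ν R e' j l * fieldOn lq ld μ ν R e i k =
      ∑ x ∈ (R.filter (·.pt.col = i)) ×ˢ (R.filter (·.pt.col = j)),
        (posPt lq ld μ ν x.1.pt ^ k * posPt lq ld μ ν x.2.pt ^ l) •
          (boxOp lq ld μ ν e' x.2 * boxOp lq ld μ ν e x.1) := by
  rw [fieldOn, fieldOn, Finset.sum_mul_sum, Finset.sum_product_right]
  simp only [smul_mul_smul_comm, mul_comm]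

namespace GenericData

variable (h : GenericData lq ld μ ν) (τ : ℂ) (R : Finset RBox)
include h

theorem repOn_EE (i j : ZMod 2) (k l : ℤ) :
    repOn lq ld μ ν τ R (quadE lq ld i j (FreeGen.E i) (FreeGen.E j) k l) = 0 := by
  have hp := posPt_ne_zero lq ld μ ν
  rw [quadE, map_add, map_smul,
    map_gMul_sum _ _ _ _ _ _ ((R.filter (·.pt.col = i)) ×ˢ (R.filter (·.pt.col = j)))
      (fun x => posPt lq ld μ ν x.1.pt) (fun x => posPt lq ld μ ν x.2.pt)
      (fun x => boxOp lq ld μ ν false x.1 * boxOp lq ld μ ν false x.2)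
      (fun x _ => hp _) (fun x _ => hp _)
      (fun k l => by rw [map_mul, repOn_E, repOn_E, fieldOn_mul_fieldOn]),
    map_gMul_sum _ _ _ _ _ _ ((R.filter (·.pt.col = i)) ×ˢ (R.filter (·.pt.col = j)))
      (fun x => posPt lq ld μ ν x.2.pt) (fun x => posPt lq ld μ ν x.1.pt)
      (fun x => boxOp lq ld μ ν false x.2 * boxOp lq ld μ ν false x.1)
      (fun x _ => hp _) (fun x _ => hp _)
      (fun k l => by
        rw [map_mul, repOn_E, repOn_E, fieldOn_mul_fieldOn']; simp only [mul_comm]),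
    Finset.smul_sum, ← Finset.sum_add_distrib]
  refine Finset.sum_eq_zero fun x hx => ?_
  simp only [Finset.mem_product, Finset.mem_filter] at hx
  obtain ⟨⟨-, rfl⟩, -, rfl⟩ := hx
  have := congrArg (fun y => (posPt lq ld μ ν x.1.pt ^ k * posPt lq ld μ ν x.2.pt ^ l) • y)
    (h.boxOp_quadE x.1 x.2)
  simp only [smul_add, smul_smul, smul_zero] at this
  rw [← this, smul_smul]
  congr 2 <;> ring

theorem repOn_FF (i j : ZMod 2) (k l : ℤ) :
    repOn lq ld μ ν τ R (quadF lq ld i j (FreeGen.F i) (FreeGen.F j) k l) = 0 := by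
  have hp := posPt_ne_zero lq ld μ ν
  rw [quadF, map_add, map_smul,
    map_gMul_sum _ _ _ _ _ _ ((R.filter (·.pt.col = i)) ×ˢ (R.filter (·.pt.col = j)))
      (fun x => posPt lq ld μ ν x.2.pt) (fun x => posPt lq ld μ ν x.1.pt)
      (fun x => boxOp lq ld μ ν true x.1 * boxOp lq ld μ ν true x.2)
      (fun x _ => hp _) (fun x _ => hp _)
      (fun k l => by
        rw [map_mul, repOn_F, repOn_F, fieldOn_mul_fieldOn]; simp only [mul_comm]),
    map_gMul_sum _ _ _ _ _ _ ((R.filter (·.pt.col = i)) ×ˢ (R.filter (·.pt.col = j)))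
      (fun x => posPt lq ld μ ν x.1.pt) (fun x => posPt lq ld μ ν x.2.pt)
      (fun x => boxOp lq ld μ ν true x.2 * boxOp lq ld μ ν true x.1)
      (fun x _ => hp _) (fun x _ => hp _)
      (fun k l => by rw [map_mul, repOn_F, repOn_F, fieldOn_mul_fieldOn']),
    Finset.smul_sum, ← Finset.sum_add_distrib]
  refine Finset.sum_eq_zero fun x hx => ?_
  simp only [Finset.mem_product, Finset.mem_filter] at hx
  obtain ⟨⟨-, rfl⟩, -, rfl⟩ := hx
  have := congrArg (fun y => (posPt lq ld μ ν x.1.pt ^ k * posPt lq ld μ ν x.2.pt ^ l) • y)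
    (h.boxOp_quadF x.1 x.2)
  simp only [smul_add, smul_smul, smul_zero] at this
  rw [← this, smul_smul]
  congr 2
  ring

theorem symComm_fieldOn (e : Bool) (i : ZMod 2) (k₀ k₁ k₂ l : ℤ) :
    symComm (q2 lq) (fieldOn lq ld μ ν R e i k₀) (fieldOn lq ld μ ν R e i k₁)
      (fieldOn lq ld μ ν R e i k₂) (fieldOn lq ld μ ν R e (i + 1) l) = 0 := by
  have hmem : ∀ i k, fieldOn lq ld μ ν R e i k ∈
      Submodule.span ℂ (boxOp lq ld μ ν e '' {b | b.pt.col = i}) := fun i k =>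
    Submodule.sum_mem _ fun b hb => Submodule.smul_mem _ _
      (Submodule.subset_span ⟨b, (Finset.mem_filter.1 hb).2, rfl⟩)
  refine symComm_eq_zero_of_span ?_ (hmem i k₀) (hmem i k₁) (hmem i k₂) (hmem (i + 1) l)
  rintro _ ⟨x, rfl, rfl⟩ _ ⟨y, hy, rfl⟩ _ ⟨z, hz, rfl⟩ _ ⟨d, hd, rfl⟩
  refine h.boxOp_serre e (Eq.symm hy) (Eq.symm hz) ?_
  rw [show d.pt.col = x.pt.col + 1 from hd]
  exact (ZMod.two_add_one_ne _).symm

theorem repOn_serreE (i : ZMod 2) (k : Fin 3 → ℤ) (l : ℤ) :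
    repOn lq ld μ ν τ R (serre lq (FreeGen.E i) (FreeGen.E (i + 1)) k l) = 0 := by
  refine (map_serre (A := Module.End ℂ (relaxedData lq ld μ ν).Space) (repOn lq ld μ ν τ R) lq _ _ k l).trans ?_
  rw [repOn_E, repOn_E, repOn_E, repOn_E, h.symComm_fieldOn, smul_zero]

theorem repOn_serreF (i : ZMod 2) (k : Fin 3 → ℤ) (l : ℤ) :
    repOn lq ld μ ν τ R (serre lq (FreeGen.F i) (FreeGen.F (i + 1)) k l) = 0 := by
  refine (map_serre (A := Module.End ℂ (relaxedData lq ld μ ν).Space) (repOn lq ld μ ν τ R) lq _ _ k l).trans ?_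
  rw [repOn_F, repOn_F, repOn_F, repOn_F, h.symComm_fieldOn, smul_zero]

end GenericData

end FieldRelations

end ToroidalGl2

namespace ToroidalGl2

/-! ### Relations of K with E and F. -/

noncomputable section DiagonalRelations

/-- The common properties of the expansions of rational functions at `0` and at `∞`. -/
structure IsExpansion (κ : RatFunc ℂ → ℤ → ℂ) : Prop where
  add : ∀ f g k, κ (f + g) k = κ f k + κ g k
  C_mul : ∀ c f k, κ (RatFunc.C c * f) k = c * κ f k
  X_mul : ∀ f k, κ (RatFunc.X * f) k = κ f (k + 1)

theorem isExpansion_infty : IsExpansion coeffInfty :=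
  ⟨coeffInfty_add, coeffInfty_C_mul, coeffInfty_X_mul⟩

theorem isExpansion_zero : IsExpansion fun f k => coeffZero f (-k) :=
  ⟨fun f g k => coeffZero_add f g (-k), fun c f k => coeffZero_C_mul c f (-k),
    fun f k => by rw [coeffZero_X_mul, neg_add, sub_eq_add_neg]⟩

/-- The polynomial `g_{i,j}(z, w)` for rational functions. -/
def gRat (lq ld : ℂ) (i j : ZMod 2) (z w : RatFunc ℂ) : RatFunc ℂ :=
  if i = j then z - RatFunc.C (q2 lq) * w
  else (z - RatFunc.C (q1 lq ld) * w) * (z - RatFunc.C (q3 lq ld) * w)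

/-- A is, up to the sign, the ratio of the two structure polynomials with its second variable set to
p; this clears the denominator. -/
theorem gRat_rootA (lq ld : ℂ) (i j : ZMod 2) (p : ℂ) :
    RatFunc.C (sgn i j) * (gRat lq ld i j RatFunc.X (RatFunc.C p) * rootA lq ld j p i) +
      gRat lq ld j i (RatFunc.C p) RatFunc.X = 0 := by
  have hdiv : ∀ D N : RatFunc ℂ, D ≠ 0 → D * (N / D) = N := fun D N hD => by field_simp
  have hne : ∀ c : ℂ, RatFunc.X - RatFunc.C c * RatFunc.C p ≠ 0 := fun c => by
    rw [← map_mul]; exact lin_ne_zero _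
  by_cases hij : i = j
  · subst hij
    simp only [sgn, gRat, rootA, if_true, map_mul, map_one]
    rw [hdiv _ _ (hne _)]
    ring
  · simp only [sgn, gRat, rootA, hij, Ne.symm hij, if_false, map_mul, map_neg, map_one]
    rw [hdiv _ _ (mul_ne_zero (hne _) (hne _))]
    ring

namespace IsExpansion

variable {κ : RatFunc ℂ → ℤ → ℂ} (hκ : IsExpansion κ)
include hκ

theorem zero (k : ℤ) : κ 0 k = 0 := by
  have := hκ.C_mul 0 0 k
  rwa [map_zero, zero_mul, zero_mul] at this

theorem gRat_left (lq ld : ℂ) (i j : ZMod 2) (p : ℂ) (f : RatFunc ℂ) (k : ℤ) :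
    κ (gRat lq ld i j RatFunc.X (RatFunc.C p) * f) k =
      if i = j then κ f (k + 1) - q2 lq * p * κ f k
      else κ f (k + 2) - (q1 lq ld + q3 lq ld) * p * κ f (k + 1)
        + q1 lq ld * q3 lq ld * p ^ 2 * κ f k := by
  unfold gRat
  split_ifs
  · have e : (RatFunc.X - RatFunc.C (q2 lq) * RatFunc.C p) * f =
        RatFunc.X * f + RatFunc.C (-(q2 lq * p)) * f := by
      simp only [map_neg, map_mul]; ring
    rw [e, hκ.add, hκ.X_mul, hκ.C_mul]
    ring
  · have e : (RatFunc.X - RatFunc.C (q1 lq ld) * RatFunc.C p) *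
        (RatFunc.X - RatFunc.C (q3 lq ld) * RatFunc.C p) * f =
        RatFunc.X * (RatFunc.X * f) + (RatFunc.C (-((q1 lq ld + q3 lq ld) * p)) * (RatFunc.X * f) +
          RatFunc.C (q1 lq ld * q3 lq ld * p ^ 2) * f) := by
      simp only [map_neg, map_mul, map_add, map_pow]; ring
    rw [e, hκ.add, hκ.add, hκ.X_mul, hκ.X_mul, hκ.C_mul, hκ.C_mul, hκ.X_mul,
      show k + 1 + 1 = k + 2 by ring]
    ring

theorem gRat_right (lq ld : ℂ) (i j : ZMod 2) (p : ℂ) (f : RatFunc ℂ) (k : ℤ) :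
    κ (gRat lq ld i j (RatFunc.C p) RatFunc.X * f) k =
      if i = j then p * κ f k - q2 lq * κ f (k + 1)
      else p ^ 2 * κ f k - (q1 lq ld + q3 lq ld) * p * κ f (k + 1)
        + q1 lq ld * q3 lq ld * κ f (k + 2) := by
  unfold gRat
  split_ifs
  · have e : (RatFunc.C p - RatFunc.C (q2 lq) * RatFunc.X) * f =
        RatFunc.C p * f + RatFunc.C (-q2 lq) * (RatFunc.X * f) := by
      simp only [map_neg]; ring
    rw [e, hκ.add, hκ.C_mul, hκ.C_mul, hκ.X_mul]
    ring
  · have e : (RatFunc.C p - RatFunc.C (q1 lq ld) * RatFunc.X) *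
        (RatFunc.C p - RatFunc.C (q3 lq ld) * RatFunc.X) * f =
        RatFunc.C (p ^ 2) * f + (RatFunc.C (-((q1 lq ld + q3 lq ld) * p)) * (RatFunc.X * f) +
          RatFunc.C (q1 lq ld * q3 lq ld) * (RatFunc.X * (RatFunc.X * f))) := by
      simp only [map_neg, map_mul, map_add, map_pow]; ring
    rw [e, hκ.add, hκ.add, hκ.C_mul, hκ.C_mul, hκ.C_mul, hκ.X_mul, hκ.X_mul, hκ.X_mul,
      show k + 1 + 1 = k + 2 by ring]
    ring

variable {V : Type*} [AddCommGroup V] [Module ℂ V] (ψ : FreeGen →ₐ[ℂ] Module.End ℂ V)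
  (lq ld : ℂ) (i j : ZMod 2) (M : ℤ → ℤ → FreeGen) {ι : Type*} (S : Finset ι) (u : ι → ℂ)
  (f : ι → RatFunc ℂ) (w : ι → V) (v : V)

theorem map_gMul_left (hu : ∀ x ∈ S, u x ≠ 0)
    (hM : ∀ k l, ψ (M k l) v = ∑ x ∈ S, (κ (f x) k * u x ^ l) • w x) (k l : ℤ) :
    ψ (gMul lq ld i j M k l) v = ∑ x ∈ S,
      (κ (gRat lq ld i j RatFunc.X (RatFunc.C (u x)) * f x) k * u x ^ l) • w x := by
  simp only [hκ.gRat_left]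
  rw [map_gMul]
  split_ifs
  · simp only [LinearMap.sub_apply, LinearMap.smul_apply, hM, Finset.smul_sum,
      ← Finset.sum_sub_distrib, smul_smul, ← sub_smul]
    refine Finset.sum_congr rfl fun x hx => ?_
    congr 1
    rw [zpow_add₀ (hu x hx), zpow_one]
    ring
  · simp only [LinearMap.sub_apply, LinearMap.add_apply, LinearMap.smul_apply, hM, Finset.smul_sum,
      ← Finset.sum_sub_distrib, ← Finset.sum_add_distrib, smul_smul, ← sub_smul, ← add_smul]
    refine Finset.sum_congr rfl fun x hx => ?_
    congr 1
    rw [zpow_add₀ (hu x hx), zpow_add₀ (hu x hx), zpow_one, zpow_ofNat]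
    ring

theorem map_gMul_right (hu : ∀ x ∈ S, u x ≠ 0)
    (hM : ∀ k l, ψ (M l k) v = ∑ x ∈ S, (κ (f x) k * u x ^ l) • w x) (k l : ℤ) :
    ψ (gMul lq ld i j M l k) v = ∑ x ∈ S,
      (κ (gRat lq ld i j (RatFunc.C (u x)) RatFunc.X * f x) k * u x ^ l) • w x := by
  simp only [hκ.gRat_right]
  rw [map_gMul]
  split_ifs
  · simp only [LinearMap.sub_apply, LinearMap.smul_apply, hM, Finset.smul_sum,
      ← Finset.sum_sub_distrib, smul_smul, ← sub_smul]
    refine Finset.sum_congr rfl fun x hx => ?_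
    congr 1
    rw [zpow_add₀ (hu x hx), zpow_one]
    ring
  · simp only [LinearMap.sub_apply, LinearMap.add_apply, LinearMap.smul_apply, hM, Finset.smul_sum,
      ← Finset.sum_sub_distrib, ← Finset.sum_add_distrib, smul_smul, ← sub_smul, ← add_smul]
    refine Finset.sum_congr rfl fun x hx => ?_
    congr 1
    rw [zpow_add₀ (hu x hx), zpow_add₀ (hu x hx), zpow_one, zpow_ofNat]
    ring

end IsExpansion

variable {lq ld μ ν : ℂ}

/-- The relation between the weights of a state before and after changing a box. -/
theorem gRat_phi_toggle (s : Finset RBox) (b : RBox) (hb : filled s b.pt) (i : ZMod 2) :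
    RatFunc.C (sgn i b.pt.col) * (gRat lq ld i b.pt.col RatFunc.X (RatFunc.C (posPt lq ld μ ν b.pt)) *
        (relaxedData lq ld μ ν).phi lq ld (toggle s b) i) +
      gRat lq ld b.pt.col i (RatFunc.C (posPt lq ld μ ν b.pt)) RatFunc.X *
        (relaxedData lq ld μ ν).phi lq ld s i = 0 := by
  rw [phi_toggle, if_pos hb]
  linear_combination (relaxedData lq ld μ ν).phi lq ld s i *
    gRat_rootA lq ld i b.pt.col (posPt lq ld μ ν b.pt)

theorem boxOp_ketOf_eq_smul (e : Bool) (b : RBox) {s : Finset RBox} (hs : Lower s) :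
    ∃ c : ℂ, boxOp lq ld μ ν e b (ketOf lq ld μ ν s) = c • ketOf lq ld μ ν (toggle s b) := by
  rw [boxOp_ketOf _ _ _ _ _ _ hs]
  split_ifs
  · exact ⟨_, rfl⟩
  · exact ⟨0, by simp⟩

section

variable (τ : ℂ) (R : Finset RBox) {κ : RatFunc ℂ → ℤ → ℂ} (hκ : IsExpansion κ) {i : ZMod 2}
  {A : ℤ → FreeGen} (hA : ∀ k, repOn lq ld μ ν τ R (A k) =
    diagOp lq ld μ ν fun s => κ ((relaxedData lq ld μ ν).phi lq ld s i) k)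
include hA

theorem repOn_diag_mul {e : Bool} {j : ZMod 2} {B : ℤ → FreeGen}
    (hB : ∀ l, repOn lq ld μ ν τ R (B l) = fieldOn lq ld μ ν R e j l) {s : Finset RBox}
    (hs : Lower s) (k l : ℤ) :
    repOn lq ld μ ν τ R (A k * B l) (ketOf lq ld μ ν s) = ∑ b ∈ R with b.pt.col = j,
      (κ ((relaxedData lq ld μ ν).phi lq ld (toggle s b) i) k * posPt lq ld μ ν b.pt ^ l) •
        boxOp lq ld μ ν e b (ketOf lq ld μ ν s) := by
  rw [map_mul, hA, hB, Module.End.mul_apply, fieldOn, LinearMap.sum_apply, map_sum]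
  refine Finset.sum_congr rfl fun b _ => ?_
  obtain ⟨c, hc⟩ := boxOp_ketOf_eq_smul (lq := lq) (ld := ld) (μ := μ) (ν := ν) e b hs
  rw [LinearMap.smul_apply, hc, map_smul, map_smul, diagOp_ketOf]
  simp only [smul_smul]
  congr 1
  ring

theorem repOn_mul_diag {e : Bool} {j : ZMod 2} {B : ℤ → FreeGen}
    (hB : ∀ l, repOn lq ld μ ν τ R (B l) = fieldOn lq ld μ ν R e j l) (s : Finset RBox) (k l : ℤ) :
    repOn lq ld μ ν τ R (B l * A k) (ketOf lq ld μ ν s) = ∑ b ∈ R with b.pt.col = j,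
      (κ ((relaxedData lq ld μ ν).phi lq ld s i) k * posPt lq ld μ ν b.pt ^ l) •
        boxOp lq ld μ ν e b (ketOf lq ld μ ν s) := by
  rw [map_mul, hA, hB, Module.End.mul_apply, diagOp_ketOf, map_smul, fieldOn, LinearMap.sum_apply,
    Finset.smul_sum]
  simp only [LinearMap.smul_apply, smul_smul]

include hκ

/-- The eigenvalue of K before and after E acts at a filled b differs by the factor A of b, so
`gRat_phi_toggle` applies to each box; an empty b is killed by E. -/
theorem repOn_quadE_diag (j : ZMod 2) (k l : ℤ) :
    repOn lq ld μ ν τ R (quadE lq ld i j A (FreeGen.E j) k l) = 0 := by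
  refine linearMap_ext _ _ _ _ fun s hs => ?_
  have hp := posPt_ne_zero lq ld μ ν
  have hB := repOn_E lq ld μ ν τ R j
  rw [quadE, map_add, map_smul, LinearMap.add_apply, LinearMap.smul_apply,
    hκ.map_gMul_left _ _ _ _ _ _ _ _ _ _ _ (fun b _ => hp b.pt)
      (fun k l => repOn_diag_mul τ R hA hB hs k l),
    hκ.map_gMul_right _ _ _ _ _ _ _ _ _ _ _ (fun b _ => hp b.pt)
      (fun k l => repOn_mul_diag τ R hA hB s k l),
    Finset.smul_sum, ← Finset.sum_add_distrib]
  refine Finset.sum_eq_zero fun b hb => ?_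
  obtain rfl := (Finset.mem_filter.1 hb).2
  by_cases hf : filled s b.pt
  · rw [smul_smul, ← add_smul]
    have := congrArg (fun f => κ f k) (gRat_phi_toggle (lq := lq) (ld := ld) (μ := μ) (ν := ν) s b hf i)
    simp only [hκ.add, hκ.C_mul, hκ.zero] at this
    rw [← zero_smul ℂ (boxOp lq ld μ ν false b (ketOf lq ld μ ν s))]
    congr 1
    linear_combination posPt lq ld μ ν b.pt ^ l * this
  · rw [boxOp_ketOf _ _ _ _ _ _ hs, if_neg (by simpa [Avail] using hf)]
    simp

theorem repOn_quadF_diag (j : ZMod 2) (k l : ℤ) :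
    repOn lq ld μ ν τ R (quadF lq ld i j A (FreeGen.F j) k l) = 0 := by
  refine linearMap_ext _ _ _ _ fun s hs => ?_
  have hp := posPt_ne_zero lq ld μ ν
  have hB := repOn_F lq ld μ ν τ R j
  rw [quadF, map_add, map_smul, LinearMap.add_apply, LinearMap.smul_apply,
    hκ.map_gMul_right _ _ _ _ _ _ _ _ _ _ _ (fun b _ => hp b.pt)
      (fun k l => repOn_diag_mul τ R hA hB hs k l),
    hκ.map_gMul_left _ _ _ _ _ _ _ _ _ _ _ (fun b _ => hp b.pt)
      (fun k l => repOn_mul_diag τ R hA hB s k l),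
    Finset.smul_sum, ← Finset.sum_add_distrib]
  refine Finset.sum_eq_zero fun b hb => ?_
  obtain rfl := (Finset.mem_filter.1 hb).2
  by_cases hf : filled s b.pt
  · rw [boxOp_ketOf _ _ _ _ _ _ hs, if_neg (by simpa [Avail] using hf)]
    simp
  · rw [smul_smul, ← add_smul]
    -- F fills b, so the relation is applied at the set reached, where b is filled; the sign moves
    -- to the other term because its square is 1.
    have := congrArg (fun f => κ f k) (gRat_phi_toggle (lq := lq) (ld := ld) (μ := μ) (ν := ν)
      (toggle s b) b ((filled_toggle_self s b).2 hf) i)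
    simp only [toggle_toggle, hκ.add, hκ.C_mul, hκ.zero] at this
    have hsgn : sgn i b.pt.col * sgn i b.pt.col = 1 := by unfold sgn; split_ifs <;> ring
    rw [← zero_smul ℂ (boxOp lq ld μ ν true b (ketOf lq ld μ ν s))]
    congr 1
    linear_combination posPt lq ld μ ν b.pt ^ l * sgn i b.pt.col * this -
      posPt lq ld μ ν b.pt ^ l * κ (gRat lq ld i b.pt.col RatFunc.X
        (RatFunc.C (posPt lq ld μ ν b.pt)) * (relaxedData lq ld μ ν).phi lq ld s i) k * hsgn

end

end DiagonalRelations

/-! ### Passage to all boxes. -/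

noncomputable section Limit

open Filter

variable {lq ld μ ν : ℂ}

theorem boxOp_ketOf_of_not_corner (e : Bool) {b : RBox} {s : Finset RBox} (hs : Lower s)
    (hb : ¬ IsCorner s b) : boxOp lq ld μ ν e b (ketOf lq ld μ ν s) = 0 := by
  rw [boxOp_ketOf _ _ _ _ _ _ hs, ketOf_eq_zero _ _ _ _ fun h => hb ((hs.isCorner_iff b).2 h)]
  simp

namespace GenericData

variable (h : GenericData lq ld μ ν)

/-- The coefficient of `z ^ (-k)` in the action of `F_i(z)` (`e = true`) or `E_i(z)`
(`e = false`). -/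
def field (e : Bool) (i : ZMod 2) (k : ℤ) : Module.End ℂ (relaxedData lq ld μ ν).Space :=
  Finsupp.linearCombination ℂ fun s => fieldOn lq ld μ ν (h.corners s i) e i k (ketOf lq ld μ ν s)

/-- The representation of the free algebra. -/
def rep (τ : ℂ) : FreeGen →ₐ[ℂ] Module.End ℂ (relaxedData lq ld μ ν).Space :=
  FreeAlgebra.lift ℂ (genAction lq ld μ ν τ h.field)

theorem fieldOn_ketOf {e : Bool} {i : ZMod 2} {k : ℤ} {s R : Finset RBox} (hs : Lower s)
    (hR : h.corners s i ⊆ R) :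
    fieldOn lq ld μ ν R e i k (ketOf lq ld μ ν s) =
      ∑ b ∈ h.corners s i, posPt lq ld μ ν b.pt ^ k • boxOp lq ld μ ν e b (ketOf lq ld μ ν s) := by
  rw [fieldOn, LinearMap.sum_apply]
  refine (Finset.sum_subset (fun b hb => ?_) fun b hb hb' => ?_).symm
  · exact Finset.mem_filter.2 ⟨hR hb, (h.mem_corners.1 hb).1⟩
  · rw [LinearMap.smul_apply, boxOp_ketOf_of_not_corner e hs, smul_zero]
    exact fun hc => hb' (h.mem_corners.2 ⟨(Finset.mem_filter.1 hb).2, hc⟩)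

theorem field_ketOf (e : Bool) (i : ZMod 2) (k : ℤ) {s : Finset RBox} (hs : Lower s) :
    h.field e i k (ketOf lq ld μ ν s) =
      ∑ b ∈ h.corners s i, posPt lq ld μ ν b.pt ^ k • boxOp lq ld μ ν e b (ketOf lq ld μ ν s) := by
  rw [← h.fieldOn_ketOf hs (subset_refl _)]
  conv_lhs => rw [ketOf, dif_pos hs]
  rw [field, CombinatorialData.ket, Finsupp.linearCombination_single, one_smul]

theorem space_induction {P : (relaxedData lq ld μ ν).Space → Prop} (h0 : P 0)
    (hadd : ∀ v w, P v → P w → P (v + w)) (hsmul : ∀ (c : ℂ) v, P v → P (c • v))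
    (hket : ∀ s, Lower s → P (ketOf lq ld μ ν s)) (v : (relaxedData lq ld μ ν).Space) : P v := by
  induction v using Finsupp.induction_linear with
  | zero => exact h0
  | add v w hv hw => exact hadd v w hv hw
  | single s c =>
    have h1 := hsmul c _ (hket s ((mem_states_iff lq ld μ ν s).1 s.2))
    rw [← ket_eq, CombinatorialData.ket, Finsupp.smul_single, smul_eq_mul, mul_one] at h1
    exact h1

theorem eventually_fieldOn (e : Bool) (i : ZMod 2) (k : ℤ) (v : (relaxedData lq ld μ ν).Space) :
    ∀ᶠ R in atTop, fieldOn lq ld μ ν R e i k v = h.field e i k v := by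
  induction v using space_induction with
  | h0 => simp
  | hadd v w hv hw =>
    filter_upwards [hv, hw] with R h1 h2
    rw [map_add, map_add, h1, h2]
  | hsmul c v hv =>
    filter_upwards [hv] with R h1
    rw [map_smul, map_smul, h1]
  | hket s hs =>
    filter_upwards [eventually_ge_atTop (h.corners s i)] with R hR
    rw [h.fieldOn_ketOf hs hR, h.field_ketOf e i k hs]

/-- On every vector, the representation agrees with its restriction to a large set of boxes. -/
theorem eventually_repOn (τ : ℂ) (x : FreeGen) : ∀ v : (relaxedData lq ld μ ν).Space,
    ∀ᶠ R in atTop, repOn lq ld μ ν τ R x v = h.rep τ x v := by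
  induction x using FreeAlgebra.induction with
  | grade0 c => intro v; simp
  | grade1 g =>
    intro v
    simp only [repOn, rep, FreeAlgebra.lift_ι_apply]
    cases g with
    | E i k => exact h.eventually_fieldOn false i k v
    | F i k => exact h.eventually_fieldOn true i k v
    | _ => exact Eventually.of_forall fun _ => rfl
  | mul x y hx hy =>
    intro v
    filter_upwards [hy v, hx (h.rep τ y v)] with R h1 h2
    rw [map_mul, map_mul, Module.End.mul_apply, Module.End.mul_apply, h1, h2]
  | add x y hx hy =>
    intro v
    filter_upwards [hx v, hy v] with R h1 h2
    rw [map_add, map_add, LinearMap.add_apply, LinearMap.add_apply, h1, h2]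

theorem rep_eq_of_eventually (τ : ℂ) {x y : FreeGen} (hxy : ∀ s, Lower s → ∀ᶠ R in atTop,
    repOn lq ld μ ν τ R x (ketOf lq ld μ ν s) = repOn lq ld μ ν τ R y (ketOf lq ld μ ν s)) :
    h.rep τ x = h.rep τ y := by
  refine linearMap_ext _ _ _ _ fun s hs => ?_
  obtain ⟨R, h1, h2, h3⟩ := ((h.eventually_repOn τ x (ketOf lq ld μ ν s)).and
    ((h.eventually_repOn τ y (ketOf lq ld μ ν s)).and (hxy s hs))).exists
  rw [← h1, ← h2, h3]

theorem rep_eq (τ : ℂ) {x y : FreeGen}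
    (hxy : ∀ R, repOn lq ld μ ν τ R x = repOn lq ld μ ν τ R y) : h.rep τ x = h.rep τ y :=
  h.rep_eq_of_eventually τ fun s _ => Eventually.of_forall fun R => by rw [hxy]

/-- The commutation relation of `E` and `F`. -/
theorem repOn_EF (τ : ℂ) (i j : ZMod 2) (k l : ℤ) {s R : Finset RBox} (hs : Lower s)
    (hR : h.corners s i ⊆ R) :
    repOn lq ld μ ν τ R (FreeGen.E i k * FreeGen.F j l - FreeGen.F j l * FreeGen.E i k)
        (ketOf lq ld μ ν s) =
      repOn lq ld μ ν τ R (if i = j then (1 / (q lq - (q lq)⁻¹)) •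
        (FreeGen.Kplus i (k + l) - FreeGen.Kminus i (k + l)) else 0) (ketOf lq ld μ ν s) := by
  have hp := posPt_ne_zero lq ld μ ν
  have hcomm : ∀ b c : RBox, b ≠ c →
      boxOp lq ld μ ν false b (boxOp lq ld μ ν true c (ketOf lq ld μ ν s)) -
        boxOp lq ld μ ν true c (boxOp lq ld μ ν false b (ketOf lq ld μ ν s)) = 0 := by
    intro b c hbc
    rw [sub_eq_zero, ← Module.End.mul_apply, h.boxOp_comm hbc, Module.End.mul_apply]
  rw [map_sub, map_mul, map_mul, repOn_E, repOn_F, fieldOn_mul_fieldOn, fieldOn_mul_fieldOn',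
    LinearMap.sub_apply, LinearMap.sum_apply, LinearMap.sum_apply, ← Finset.sum_sub_distrib]
  simp only [LinearMap.smul_apply, Module.End.mul_apply, ← smul_sub]
  split_ifs with hij
  · subst hij
    rw [map_smul, map_sub, repOn_Kplus, repOn_Kminus, LinearMap.smul_apply, LinearMap.sub_apply,
      diagOp_ketOf, diagOp_ketOf, ← sub_smul, h.coeff_phi_sub hs, Finset.sum_product, smul_smul,
      Finset.mul_sum, Finset.sum_smul]
    -- Different boxes commute, so only the diagonal of the double sum survives; of it, only corners
    -- contribute.
    have hdiag : ∀ b ∈ R.filter (·.pt.col = i), ∑ c ∈ R.filter (·.pt.col = i),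
        (posPt lq ld μ ν b.pt ^ k * posPt lq ld μ ν c.pt ^ l) •
          (boxOp lq ld μ ν false b (boxOp lq ld μ ν true c (ketOf lq ld μ ν s)) -
            boxOp lq ld μ ν true c (boxOp lq ld μ ν false b (ketOf lq ld μ ν s))) =
        posPt lq ld μ ν b.pt ^ (k + l) •
          (boxOp lq ld μ ν false b (boxOp lq ld μ ν true b (ketOf lq ld μ ν s)) -
            boxOp lq ld μ ν true b (boxOp lq ld μ ν false b (ketOf lq ld μ ν s))) := by
      intro b hb
      rw [Finset.sum_eq_single_of_mem b hb fun c _ hc => by rw [hcomm b c hc.symm, smul_zero],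
        zpow_add₀ (hp _)]
    rw [Finset.sum_congr rfl hdiag]
    symm
    refine Finset.sum_subset_zero_on_sdiff (fun b hb => ?_) (fun b hb => ?_) fun b hb => ?_
    · exact Finset.mem_filter.2 ⟨hR hb, (h.mem_corners.1 hb).1⟩
    · rw [Finset.mem_sdiff, Finset.mem_filter, h.mem_corners] at hb
      rw [h.boxOp_commutator b hs, if_neg fun hc => hb.2 ⟨hb.1.2, hc⟩, zero_smul, smul_zero]
    · rw [h.mem_corners] at hb
      rw [h.boxOp_commutator b hs, if_pos hb.2, hb.1, smul_smul]
      congr 1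
      ring
  · rw [map_zero, LinearMap.zero_apply]
    refine Finset.sum_eq_zero fun x hx => ?_
    simp only [Finset.mem_product, Finset.mem_filter] at hx
    rw [hcomm _ _ (fun he => hij (by rw [← hx.1.2, ← hx.2.2, he])), smul_zero]

theorem rep_rel (τ : ℂ) (hτ : τ ≠ 0) {x y : FreeGen} (hxy : Rel lq ld x y) :
    h.rep τ x = h.rep τ y := by
  have hK : ∀ s i, coeffInfty ((relaxedData lq ld μ ν).phi lq ld s i) 0 *
      coeffZero ((relaxedData lq ld μ ν).phi lq ld s i) 0 = 1 := by
    intro s i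
    obtain ⟨u, hu, hB⟩ := exists_balancedData_phi lq ld μ ν s
    rw [(hB i).coeffInfty_zero, (hB i).coeffZero_zero]
    refine mul_inv_cancel₀ (mul_ne_zero (psiInfty_ne_zero _ _ _ _ _) ?_)
    split_ifs
    · exact hu
    · exact inv_ne_zero hu
  have hcomm : ∀ f g : Finset RBox → ℂ, diagOp lq ld μ ν f * diagOp lq ld μ ν g =
      diagOp lq ld μ ν g * diagOp lq ld μ ν f := by
    intro f g
    refine linearMap_ext _ _ _ _ fun s _ => ?_
    simp only [Module.End.mul_apply, diagOp_ketOf, map_smul]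
    exact smul_comm _ _ _
  have ht : ∀ R, repOn lq ld μ ν τ R FreeGen.t = algebraMap ℂ _ τ :=
    fun R => FreeAlgebra.lift_ι_apply _ _
  have ht' : ∀ R, repOn lq ld μ ν τ R FreeGen.tInv = algebraMap ℂ _ τ⁻¹ :=
    fun R => FreeAlgebra.lift_ι_apply _ _
  cases hxy with
  | K_mul_Kinv i =>
    refine h.rep_eq τ fun R => linearMap_ext _ _ _ _ fun s _ => ?_
    rw [map_mul, repOn_Kplus, repOn_Kminus, Module.End.mul_apply, diagOp_ketOf, map_smul,
      diagOp_ketOf, smul_smul, neg_zero, mul_comm, hK, one_smul, map_one, Module.End.one_apply]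
  | Kinv_mul_K i =>
    refine h.rep_eq τ fun R => linearMap_ext _ _ _ _ fun s _ => ?_
    rw [map_mul, repOn_Kplus, repOn_Kminus, Module.End.mul_apply, diagOp_ketOf, map_smul,
      diagOp_ketOf, smul_smul, neg_zero, hK, one_smul, map_one, Module.End.one_apply]
  | t_mul_tInv =>
    refine h.rep_eq τ fun R => ?_
    rw [map_mul, ht, ht', ← map_mul, mul_inv_cancel₀ hτ, map_one, map_one]
  | tInv_mul_t =>
    refine h.rep_eq τ fun R => ?_
    rw [map_mul, ht, ht', ← map_mul, inv_mul_cancel₀ hτ, map_one, map_one]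
  | t_central g =>
    refine h.rep_eq τ fun R => ?_
    rw [map_mul, map_mul, ht]
    exact Algebra.commutes _ _
  | KpKp i j k l =>
    refine h.rep_eq τ fun R => ?_
    simp only [map_mul, repOn_Kplus]
    exact hcomm _ _
  | KmKm i j k l =>
    refine h.rep_eq τ fun R => ?_
    simp only [map_mul, repOn_Kminus]
    exact hcomm _ _
  | KpKm i j k l =>
    refine h.rep_eq τ fun R => ?_
    simp only [map_mul, repOn_Kplus, repOn_Kminus]
    exact hcomm _ _
  | KpE i j k l =>
    refine h.rep_eq τ fun R => ?_
    rw [map_zero, repOn_quadE_diag τ R isExpansion_infty (repOn_Kplus lq ld μ ν τ R i)]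
  | KmE i j k l =>
    refine h.rep_eq τ fun R => ?_
    rw [map_zero, repOn_quadE_diag τ R isExpansion_zero (repOn_Kminus lq ld μ ν τ R i)]
  | KpF i j k l =>
    refine h.rep_eq τ fun R => ?_
    rw [map_zero, repOn_quadF_diag τ R isExpansion_infty (repOn_Kplus lq ld μ ν τ R i)]
  | KmF i j k l =>
    refine h.rep_eq τ fun R => ?_
    rw [map_zero, repOn_quadF_diag τ R isExpansion_zero (repOn_Kminus lq ld μ ν τ R i)]
  | EF i j k l =>
    refine h.rep_eq_of_eventually τ fun s hs => ?_
    filter_upwards [eventually_ge_atTop (h.corners s i)] with R hR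
    exact h.repOn_EF τ i j k l hs hR
  | EE i j k l =>
    refine h.rep_eq τ fun R => ?_
    rw [map_zero, h.repOn_EE]
  | FF i j k l =>
    refine h.rep_eq τ fun R => ?_
    rw [map_zero, h.repOn_FF]
  | serreE i k l =>
    refine h.rep_eq τ fun R => ?_
    rw [map_zero, h.repOn_serreE]
  | serreF i k l =>
    refine h.rep_eq τ fun R => ?_
    rw [map_zero, h.repOn_serreF]

/-- The representation of the quantum toroidal algebra. -/
def toroidalRep (τ : ℂ) (hτ : τ ≠ 0) :
    Toroidal lq ld →ₐ[ℂ] Module.End ℂ (relaxedData lq ld μ ν).Space :=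
  RingQuot.liftAlgHom ℂ ⟨h.rep τ, fun _ _ hxy => h.rep_rel τ hτ hxy⟩

theorem toroidalRep_gen (τ : ℂ) (hτ : τ ≠ 0) (g : Gen) :
    h.toroidalRep τ hτ (Toroidal.gen lq ld g) = genAction lq ld μ ν τ h.field g := by
  rw [toroidalRep, Toroidal.gen, RingQuot.liftAlgHom_mkAlgHom_apply, rep, FreeAlgebra.lift_ι_apply]

end GenericData

end Limit

end ToroidalGl2

namespace ToroidalGl2

/-! ### Paths between states and separation of weights. -/

noncomputable section Connectivity

/-- The size of a box: its distance from the corner of its family. -/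
def RBox.size (b : RBox) : ℤ := b.sign * (b.pt.2.1 + b.pt.2.2)

/-- From every nonempty state, one can pass to a state with fewer boxes. -/
theorem Lower.exists_toggle {s : Finset RBox} (hs : Lower s) (hne : s.Nonempty) :
    ∃ b ∈ s, Lower (toggle s b) := by
  -- Neighbours farther out than a box of maximal size are absent from s, so they have the same
  -- value as in the empty state and do not block its deletion.
  obtain ⟨b, hb, hmax⟩ := s.exists_max_image RBox.size hne
  refine ⟨b, hb, ?_⟩
  cases hn : b.isNeg
  · have hf : filled s b.pt := by rw [filled_pt, hn]; simp [hb]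
    have hu : UpFree ∅ b.pt := lower_empty.upFree_of_not_filled (by rw [filled_pt, hn]; simp)
    rw [hs.toggle_iff_of_filled hf]
    have key : ∀ x y : ℤ, 0 ≤ y → 0 < x + y → ¬ filled ∅ (b.pt.shift x y) →
        ¬ filled s (b.pt.shift x y) := by
      intro x y hy hxy h0
      by_cases hc : ∃ c : RBox, c.pt = b.pt.shift x y
      · obtain ⟨c, hc⟩ := hc
        have hcn := RBox.isNeg_of_shift hc (Or.inl ⟨hy, hn⟩)
        rw [← hc, filled_pt, hcn, hn]
        intro hcs
        have := hmax c (hcs.2 rfl)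
        simp only [RBox.size, RBox.sign, hcn, hn, hc, Pt.shift] at this
        simp at this
        omega
      · push Not at hc
        rwa [filled_of_not_box hc s ∅]
    exact ⟨key 1 0 le_rfl (by omega) hu.1, key 0 1 (by omega) (by omega) hu.2.1,
      key 1 1 (by omega) (by omega) hu.2.2⟩
  · have hf : ¬ filled s b.pt := by rw [filled_pt, hn]; simp [hb]
    have hu : LowFull ∅ b.pt := lower_empty.lowFull_of_filled (by rw [filled_pt, hn]; simp)
    rw [hs.toggle_iff_of_not_filled hf]
    have key : ∀ x y : ℤ, y ≤ 0 → x + y < 0 → filled ∅ (b.pt.shift x y) →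
        filled s (b.pt.shift x y) := by
      intro x y hy hxy h0
      by_cases hc : ∃ c : RBox, c.pt = b.pt.shift x y
      · obtain ⟨c, hc⟩ := hc
        have hcn := RBox.isNeg_of_shift hc (Or.inr ⟨hy, hn⟩)
        rw [← hc, filled_pt, hcn, hn]
        simp only [Bool.true_eq_false, iff_false]
        intro hcs
        have := hmax c hcs
        simp only [RBox.size, RBox.sign, hcn, hn, hc, Pt.shift] at this
        simp at this
        omega
      · push Not at hc
        rwa [filled_of_not_box hc s ∅]
    exact ⟨key (-1) 0 le_rfl (by omega) hu.1, key 0 (-1) (by omega) (by omega) hu.2.1,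
      key (-1) (-1) (by omega) (by omega) hu.2.2⟩

/-- Any two states are connected by adding and removing boxes. -/
theorem Lower.induction_to_empty {P : Finset RBox → Prop}
    (hP : ∀ s b, Lower s → Lower (toggle s b) → P s → P (toggle s b)) {s : Finset RBox}
    (hs : Lower s) : P s ↔ P ∅ := by
  induction hn : s.card using Nat.strong_induction_on generalizing s with
  | _ n ih =>
    rcases s.eq_empty_or_nonempty with rfl | hne
    · rfl
    · obtain ⟨b, hb, ht⟩ := hs.exists_toggle hne
      have hcard : (toggle s b).card < n := by
        have : toggle s b = s.erase b := by
          ext c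
          rw [mem_toggle, Finset.mem_erase]
          by_cases hc : c = b
          · subst hc; simp [hb]
          · simp [hc]
        rw [this, ← hn]
        exact Finset.card_erase_lt_of_mem hb
      rw [← ih _ hcard ht rfl]
      refine ⟨hP s b hs ht, fun h => ?_⟩
      have := hP _ b ht (by rwa [toggle_toggle]) h
      rwa [toggle_toggle] at this

variable {lq ld μ ν : ℂ}

/-- The weights of distinct states are distinct. -/
theorem GenericData.phi_injective (h : GenericData lq ld μ ν) :
    Function.Injective fun s : Finset RBox => (relaxedData lq ld μ ν).phi lq ld s := by
  intro s t hst
  by_contra hne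
  have hord : ∀ a, ToroidalGl2.cornerOrd s a = ToroidalGl2.cornerOrd t a := by
    intro a
    have h1 := h.ordAt_phi s a.col a
    have h2 := h.ordAt_phi t a.col a
    rw [if_pos rfl] at h1 h2
    rw [← h1, ← h2, show (relaxedData lq ld μ ν).phi lq ld s = (relaxedData lq ld μ ν).phi lq ld t from
      hst]
  have hne' : (symmDiff s t).Nonempty := by
    rw [Finset.nonempty_iff_ne_empty]
    intro h0
    exact hne (symmDiff_eq_bot.1 h0)
  -- The six neighbours of b + (1,1) are b itself and five points with larger coordinate sum, where
  -- s and t agree. The six-term sums there therefore differ.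
  obtain ⟨b, hb, hmax⟩ := (symmDiff s t).exists_max_image (fun b => b.pt.2.1 + b.pt.2.2) hne'
  have hfil : ∀ c : RBox, (filled s c.pt ↔ filled t c.pt) ↔ c ∉ symmDiff s t := by
    intro c
    rw [filled_pt, filled_pt, Finset.mem_symmDiff]
    cases c.isNeg <;> simp <;> tauto
  have hchi : ∀ x y : ℤ, 0 < x + y → chi s (b.pt.shift x y) = chi t (b.pt.shift x y) := by
    intro x y hxy
    have : filled s (b.pt.shift x y) ↔ filled t (b.pt.shift x y) := by
      by_cases hc : ∃ c : RBox, c.pt = b.pt.shift x y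
      · obtain ⟨c, hc⟩ := hc
        rw [← hc, hfil]
        intro hcs
        have := hmax c hcs
        rw [hc] at this
        simp only [Pt.shift] at this
        omega
      · push Not at hc
        exact filled_of_not_box hc s t
    unfold chi
    simp only [this]
  have hb' : chi s b.pt ≠ chi t b.pt := by
    have := mt (hfil b).1 (not_not.2 hb)
    unfold chi
    by_cases h1 : filled s b.pt <;> by_cases h2 : filled t b.pt <;> simp_all
  have := hord (b.pt.shift 1 1)
  simp only [ToroidalGl2.cornerOrd, Pt.shift_shift] at this
  have h1 := hchi 1 2 (by omega)
  have h2 := hchi 2 1 (by omega)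
  have h3 := hchi 1 0 (by omega)
  have h4 := hchi 0 1 (by omega)
  have h5 := hchi 2 2 (by omega)
  have h6 := hchi 1 1 (by omega)
  norm_num at this
  omega

end Connectivity

/-! ### Stable subspaces. -/

noncomputable section Irreducibility

variable {lq ld μ ν : ℂ}

namespace GenericData

variable (h : GenericData lq ld μ ν) (τ : ℂ) (hτ : τ ≠ 0)

theorem exists_coeffZero_ne {s t : Finset RBox} (hst : s ≠ t) (h : GenericData lq ld μ ν) :
    ∃ (i : ZMod 2) (r : ℕ), coeffZero ((relaxedData lq ld μ ν).phi lq ld s i) r ≠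
      coeffZero ((relaxedData lq ld μ ν).phi lq ld t i) r := by
  by_contra hc
  push Not at hc
  refine hst (h.phi_injective (funext fun i => coeffZero_injective fun n => ?_))
  obtain ⟨u, -, hu⟩ := exists_balancedData_phi lq ld μ ν s
  obtain ⟨u', -, hu'⟩ := exists_balancedData_phi lq ld μ ν t
  rcases lt_or_ge n 0 with hn | hn
  · rw [(hu i).coeffZero_neg hn, (hu' i).coeffZero_neg hn]
  · lift n to ℕ using hn
    exact hc i n

/-- A subspace stable under the operators `K` contains the components of its elements. -/
theorem ketOf_mem_of_mem {N : Submodule ℂ (relaxedData lq ld μ ν).Space}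
    (hN : ∀ (i : ZMod 2) (r : ℕ), ∀ v ∈ N,
      diagOp lq ld μ ν (fun s => coeffZero ((relaxedData lq ld μ ν).phi lq ld s i) r) v ∈ N)
    {v : (relaxedData lq ld μ ν).Space} (hv : v ∈ N) {s : (relaxedData lq ld μ ν).states}
    (hs : v s ≠ 0) (h : GenericData lq ld μ ν) : ketOf lq ld μ ν s ∈ N := by
  have happ : ∀ (f : Finset RBox → ℂ) (v : (relaxedData lq ld μ ν).Space)
      (t : (relaxedData lq ld μ ν).states), diagOp lq ld μ ν f v t = f t * v t := by
    intro f v t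
    induction v using Finsupp.induction_linear with
    | zero => simp
    | add v w hv hw => rw [map_add, Finsupp.add_apply, hv, hw, Finsupp.add_apply, mul_add]
    | single s c =>
      simp only [diagOp, Finsupp.linearCombination_single, CombinatorialData.ket,
        Finsupp.smul_single, smul_eq_mul, mul_one]
      by_cases hst : s = t
      · subst hst; simp [mul_comm]
      · simp [Finsupp.single_eq_of_ne, Ne.symm hst]
  induction hn : v.support.card using Nat.strong_induction_on generalizing v with
  | _ n ih =>
    by_cases hex : ∃ t ∈ v.support, t ≠ s
    · obtain ⟨t, ht, hts⟩ := hex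
      obtain ⟨i, r, hir⟩ := exists_coeffZero_ne (fun he => hts (Subtype.ext he)) h
      set κ : Finset RBox → ℂ := fun s => coeffZero ((relaxedData lq ld μ ν).phi lq ld s i) r with hκ
      have hw : ∀ x, (diagOp lq ld μ ν κ v - κ t • v) x = (κ x - κ t) * v x := by
        intro x
        rw [Finsupp.sub_apply, happ, Finsupp.smul_apply, smul_eq_mul, sub_mul]
      -- Subtracting the eigenvalue at t kills that component and keeps the one at s, because κ
      -- separates them; the support shrinks.
      refine ih (diagOp lq ld μ ν κ v - κ t • v).support.card ?_
        (N.sub_mem (hN i r v hv) (N.smul_mem _ hv)) ?_ rfl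
      · rw [← hn]
        refine Finset.card_lt_card ⟨fun x hx => ?_, fun hsub => ?_⟩
        · rw [Finsupp.mem_support_iff, hw] at hx
          exact Finsupp.mem_support_iff.2 (right_ne_zero_of_mul hx)
        · have := hsub ht
          rw [Finsupp.mem_support_iff, hw, sub_self, zero_mul] at this
          exact this rfl
      · rw [hw]
        exact mul_ne_zero (sub_ne_zero.2 hir.symm) hs
    · push Not at hex
      have : v = v s • ketOf lq ld μ ν s := by
        rw [← ket_eq, CombinatorialData.ket, Finsupp.smul_single, smul_eq_mul, mul_one]
        ext x
        by_cases hx : s = x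
        · subst hx; simp
        · rw [Finsupp.single_eq_of_ne (Ne.symm hx)]
          by_contra h0
          exact hx (hex x (Finsupp.mem_support_iff.2 h0)).symm
      rw [this] at hv
      exact (N.smul_mem_iff hs).1 hv

/-- A subspace stable under `K` and under `F`, `E` contains, with a state, the neighbouring states. -/
theorem ketOf_toggle_mem {N : Submodule ℂ (relaxedData lq ld μ ν).Space}
    (hN : ∀ (i : ZMod 2) (r : ℕ), ∀ v ∈ N,
      diagOp lq ld μ ν (fun s => coeffZero ((relaxedData lq ld μ ν).phi lq ld s i) r) v ∈ N)
    (hX : ∀ (e : Bool) (i : ZMod 2), ∀ v ∈ N, h.field e i 0 v ∈ N) {s : Finset RBox} {b : RBox}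
    (hs : Lower s) (ht : Lower (toggle s b)) (hv : ketOf lq ld μ ν s ∈ N) :
    ketOf lq ld μ ν (toggle s b) ∈ N := by
  obtain ⟨e, he⟩ : ∃ e : Bool, Avail e s b := by
    by_cases hf : filled s b.pt
    · exact ⟨false, by simpa [Avail] using hf⟩
    · exact ⟨true, by simpa [Avail] using hf⟩
  have hmem := hX e b.pt.col _ hv
  refine ketOf_mem_of_mem (s := ⟨toggle s b, (mem_states_iff lq ld μ ν _).2 ht⟩) hN hmem ?_ h
  have hket : ∀ c, Lower (toggle s c) → ketOf lq ld μ ν (toggle s c)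
      ⟨toggle s b, (mem_states_iff lq ld μ ν _).2 ht⟩ = if c = b then 1 else 0 := by
    intro c hc
    rw [ketOf, dif_pos hc, CombinatorialData.ket, Finsupp.single_apply]
    have : toggle s c = toggle s b ↔ c = b := by
      refine ⟨fun he => ?_, fun he => by rw [he]⟩
      exact Finset.singleton_injective (symmDiff_right_injective s he)
    simp only [Subtype.mk.injEq, this]
  -- Different corners lead to different states, so the component at the state reached through b is
  -- a single coefficient, which is non-zero.
  rw [h.field_ketOf e _ _ hs, Finsupp.finsetSum_apply, Finset.sum_eq_single_of_mem b]
  · rw [zpow_zero, one_smul, boxOp_ketOf _ _ _ _ _ _ hs, if_pos he, Finsupp.smul_apply,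
      hket b ht, if_pos rfl, smul_eq_mul, mul_one]
    exact h.opCoeff_ne_zero (hs.clear he)
  · exact h.mem_corners.2 ⟨rfl, (hs.isCorner_iff b).2 ht⟩
  · intro c hc hcb
    obtain ⟨a, ha⟩ := boxOp_ketOf_eq_smul (lq := lq) (ld := ld) (μ := μ) (ν := ν) e c hs
    rw [ha, Finsupp.smul_apply, Finsupp.smul_apply,
      hket c ((hs.isCorner_iff c).1 (h.mem_corners.1 hc).2), if_neg hcb]
    simp

/-- A non-zero subspace stable under `K` and under `F`, `E` is the whole space. -/
theorem eq_top_of_stable {N : Submodule ℂ (relaxedData lq ld μ ν).Space}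
    (hN : ∀ (i : ZMod 2) (r : ℕ), ∀ v ∈ N,
      diagOp lq ld μ ν (fun s => coeffZero ((relaxedData lq ld μ ν).phi lq ld s i) r) v ∈ N)
    (hX : ∀ (e : Bool) (i : ZMod 2), ∀ v ∈ N, h.field e i 0 v ∈ N) (hne : N ≠ ⊥) : N = ⊤ := by
  obtain ⟨v, hv, hv0⟩ := N.ne_bot_iff.1 hne
  obtain ⟨s, hs⟩ := Finsupp.ne_iff.1 hv0
  have hs' := ketOf_mem_of_mem hN hv hs h
  have hiff : ∀ {t}, Lower t → (ketOf lq ld μ ν t ∈ N ↔ ketOf lq ld μ ν ∅ ∈ N) := fun ht =>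
    ht.induction_to_empty (P := fun t => ketOf lq ld μ ν t ∈ N)
      (fun _ _ h1 h2 h3 => h.ketOf_toggle_mem hN hX h1 h2 h3)
  have hall : ∀ t, Lower t → ketOf lq ld μ ν t ∈ N := fun t ht =>
    (hiff ht).2 ((hiff ((mem_states_iff lq ld μ ν s).1 s.2)).1 hs')
  rw [eq_top_iff]
  rintro w -
  exact space_induction N.zero_mem (fun _ _ => N.add_mem) (fun c _ => N.smul_mem c) hall w

end GenericData

end Irreducibility

/-! ### The module over the toroidal algebra. -/

noncomputable section Module

variable {lq ld μ ν : ℂ} (h : GenericData lq ld μ ν) (τ : ℂ) (hτ : τ ≠ 0)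

/-- The module structure. -/
@[reducible] def GenericData.toroidalModule :
    Module (Toroidal lq ld) (relaxedData lq ld μ ν).Space :=
  Module.compHom _ (h.toroidalRep τ hτ).toRingHom

/-- The explicit form of the action of `F` and `E` on the basis. -/
theorem GenericData.field_ketOf_eq_finsum (e : Bool) (i : ZMod 2) (k : ℤ) {s : Finset RBox}
    (hs : Lower s) (S : Set RBox)
    (hS : ∀ b, b ∈ S ↔ b.pt.col = i ∧ Avail e s b ∧ Lower (toggle s b)) :
    h.field e i k (ketOf lq ld μ ν s) = ∑ᶠ b : S,
      (opCoeff lq ld μ ν e s b * posPt lq ld μ ν (b : RBox).pt ^ k) • ketOf lq ld μ ν (toggle s b) := by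
  rw [h.field_ketOf e i k hs, finsum_set_coe_eq_finsum_mem S (f := fun b : RBox =>
    (opCoeff lq ld μ ν e s b * posPt lq ld μ ν b.pt ^ k) • ketOf lq ld μ ν (toggle s b))]
  have hfin : S.Finite := (h.finite_corners s i).subset fun b hb =>
    ⟨((hS b).1 hb).1, (hs.isCorner_iff b).2 ((hS b).1 hb).2.2⟩
  rw [finsum_mem_eq_finite_toFinset_sum _ hfin]
  symm
  refine Finset.sum_subset_zero_on_sdiff (fun b hb => ?_) (fun b hb => ?_) fun b hb => ?_
  · rw [Set.Finite.mem_toFinset, hS] at hb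
    exact h.mem_corners.2 ⟨hb.1, (hs.isCorner_iff b).2 hb.2.2⟩
  · rw [Finset.mem_sdiff, Set.Finite.mem_toFinset, hS, h.mem_corners, hs.isCorner_iff] at hb
    rw [boxOp_ketOf _ _ _ _ _ _ hs, if_neg (by tauto), smul_zero]
  · rw [Set.Finite.mem_toFinset, hS] at hb
    rw [boxOp_ketOf _ _ _ _ _ _ hs, if_pos hb.2.1, smul_smul, mul_comm]

/-- The relaxed Verma module exists, and it is irreducible and tame of level `q₃`. -/
theorem GenericData.exists_module (h : GenericData lq ld μ ν) (hτ : τ ≠ 0) :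
    ∃ (_ : Module (Toroidal lq ld) (relaxedData lq ld μ ν).Space)
      (_ : IsScalarTower ℂ (Toroidal lq ld) (relaxedData lq ld μ ν).Space),
      (relaxedData lq ld μ ν).ActsByFormulas lq ld τ ∧
      IsSimpleModule (Toroidal lq ld) (relaxedData lq ld μ ν).Space ∧
      IsTame lq ld (relaxedData lq ld μ ν).Space ∧
      HasLevel lq ld (q3 lq ld) (relaxedData lq ld μ ν).Space := by
  let inst : Module (Toroidal lq ld) (relaxedData lq ld μ ν).Space := h.toroidalModule τ hτ
  have hsmul : ∀ (x : Toroidal lq ld) (v : (relaxedData lq ld μ ν).Space),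
      x • v = h.toroidalRep τ hτ x v := fun _ _ => rfl
  have hgen' : ∀ (g : Gen) (v : (relaxedData lq ld μ ν).Space), Toroidal.gen lq ld g • v =
      genAction lq ld μ ν τ h.field g v := fun g v => by rw [hsmul, h.toroidalRep_gen]
  have htower : IsScalarTower ℂ (Toroidal lq ld) (relaxedData lq ld μ ν).Space :=
    ⟨fun c x v => by rw [hsmul, hsmul, map_smul, LinearMap.smul_apply]⟩
  have hlower : ∀ s : (relaxedData lq ld μ ν).states, Lower (s : Finset RBox) :=
    fun s => (mem_states_iff lq ld μ ν s).1 s.2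
  have hacts : (relaxedData lq ld μ ν).ActsByFormulas lq ld τ := by
    constructor
    · intro s i r
      rw [hgen', ket_eq, genAction, diagOp_ketOf]
    · intro s i r
      rw [hgen', ket_eq, genAction, diagOp_ketOf]
    · intro s i k
      rw [hgen', ket_eq]
      refine (h.field_ketOf_eq_finsum true i k (hlower s) _
        (fun b => by rw [mem_concave_iff]; simp [Avail])).trans (finsum_congr fun b => ?_)
      obtain ⟨hb1, hb2, hb3⟩ := (mem_concave_iff lq ld μ ν s i b).1 b.2
      rw [ket_eq, pos_eq]
      simp only [addBox_eq lq ld μ ν hb2, opCoeff, if_true, hb1]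
    · intro s i k
      rw [hgen', ket_eq]
      refine (h.field_ketOf_eq_finsum false i k (hlower s) _
        (fun b => by rw [mem_convex_iff]; simp [Avail])).trans (finsum_congr fun b => ?_)
      obtain ⟨hb1, hb2, hb3⟩ := (mem_convex_iff lq ld μ ν s i b).1 b.2
      rw [ket_eq, pos_eq]
      simp only [removeBox_eq lq ld μ ν hb2, opCoeff, Bool.false_eq_true, if_false, hb1]
    · intro s
      rw [hgen']
      rfl
  refine ⟨inst, htower, hacts, ?_, ?_, ?_⟩
  · have : Nontrivial (relaxedData lq ld μ ν).Space :=
      ⟨⟨Finsupp.single ⟨∅, (mem_states_iff lq ld μ ν _).2 lower_empty⟩ 1, 0, by simp⟩⟩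
    refine (isSimpleModule_iff _ _).2 ⟨fun N => or_iff_not_imp_left.2 fun hN => ?_⟩
    have htop := h.eq_top_of_stable (N := N.restrictScalars ℂ)
      (fun i r v hv => by
        have := N.smul_mem (Toroidal.gen lq ld (Gen.Kminus i r)) hv
        rwa [hgen'] at this)
      (fun e i v hv => by
        cases e
        · have := N.smul_mem (Toroidal.gen lq ld (Gen.E i 0)) hv
          rwa [hgen'] at this
        · have := N.smul_mem (Toroidal.gen lq ld (Gen.F i 0)) hv
          rwa [hgen'] at this)
      (by rwa [Ne, Submodule.restrictScalars_eq_bot_iff])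
    rwa [Submodule.restrictScalars_eq_top_iff] at htop
  · refine ⟨(relaxedData lq ld μ ν).states, Finsupp.basisSingleOne,
      fun s => (relaxedData lq ld μ ν).phi lq ld s,
      fun s t hst => Subtype.ext (h.phi_injective hst), fun s i => ⟨h.wellDefined.balanced s s.2 i, ?_⟩⟩
    intro r
    rw [Finsupp.coe_basisSingleOne]
    exact ⟨hacts.Kplus s i r, hacts.Kminus s i r⟩
  · intro v
    induction v using GenericData.space_induction with
    | h0 => simp
    | hadd v w hv hw => rw [smul_add, smul_add, hv, hw]
    | hsmul c v hv => rw [smul_comm, hv, smul_comm]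
    | hket s hs =>
      obtain ⟨u, hu, hB⟩ := exists_balancedData_phi lq ld μ ν s
      have h0 := (hB 0).coeffInfty_zero
      have h1 := (hB 1).coeffInfty_zero
      -- The boxes contribute u to one component and u⁻¹ to the other, so the product is that of Ψ
      -- at infinity, namely q₃.
      rw [mul_smul, hgen', hgen', genAction, genAction, diagOp_ketOf, map_smul, diagOp_ketOf,
        smul_smul, Nat.cast_zero, h0, h1, ← psiInfty_mul lq ld μ ν, if_pos rfl, if_neg (by decide)]
      congr 1
      field_simp

end Module

end ToroidalGl2

theorem mainTheorem4 (lq ld : ℂ) (hgen : ToroidalGl2.GenericParameters lq ld)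
    (μ ν : ℂ)
    (hμ : ToroidalGl2.GenericExponent lq ld μ)
    (hν : ToroidalGl2.GenericExponent lq ld ν)
    (hμν : ToroidalGl2.GenericExponent lq ld (μ + ν))
    (τ : ℂ) (hτ : τ ≠ 0) :
    (ToroidalGl2.relaxedData lq ld μ ν).WellDefined lq ld ∧
    ∃ (_ : Module (ToroidalGl2.Toroidal lq ld) (ToroidalGl2.relaxedData lq ld μ ν).Space)
      (_ : IsScalarTower ℂ (ToroidalGl2.Toroidal lq ld)
        (ToroidalGl2.relaxedData lq ld μ ν).Space),
      (ToroidalGl2.relaxedData lq ld μ ν).ActsByFormulas lq ld τ ∧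
      IsSimpleModule (ToroidalGl2.Toroidal lq ld) (ToroidalGl2.relaxedData lq ld μ ν).Space ∧
      ToroidalGl2.IsTame lq ld (ToroidalGl2.relaxedData lq ld μ ν).Space ∧
      ToroidalGl2.HasLevel lq ld (ToroidalGl2.q3 lq ld)
        (ToroidalGl2.relaxedData lq ld μ ν).Space :=
  have h : ToroidalGl2.GenericData lq ld μ ν := ⟨hgen, hμ, hν, hμν⟩
  ⟨h.wellDefined, h.exists_module τ hτ⟩
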